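/- For $v\in\mathbb R^3$ let $v_\times$ be the skew-symmetric matrix with $v_\times u=v\wedge u$ (cross product), and let $Q_{\mathfrak{so}(3)}=D^\top D$, where $D\in\mathbb R^{9\times 3}$ is the duplication matrix $\mathrm{vec}(v_\times)=Dv$ (so $\mathrm{tr}(u_\times^\top v_\times)=u^\top Q_{\mathfrak{so}(3)}v$). Let $m\ge 3$, $C\in\mathbb R^{3\times m}$, $S\in\mathbb R^{m\times m}$ with $S=-S^\top$, and let the pair $(C,S)$ be observable, i.e. $CS^kv=0$ for all $k\ge 0$ implies $v=0$. Let $k_p,k_I>0$, $X_r\in SO(3)$ and $\mathring y_1,\dots,\mathring y_\nu\in\mathbb R^3$ be constant. For $R,R_d\in SO(3)$ put $y_i^r=X_r\mathring y_i$, $y_i=R^\top R_d\mathring y_i$, $e_i=y_i^r-y_i$. Consider the closed loop with state $(R,\delta,(R_d,w))\in SO(3)\times\mathbb R^m\times(SO(3)\times\mathbb R^m)$, $$\dot R=R\,\Omega_\times,\qquad \Omega_\times=R^\top (C\delta)_\times R+\frac{k_p}{2}\sum_{i=1}^{\nu}(e_i\wedge y_i^r)_\times,$$ $$\dot\delta=S\delta+C^\top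 Q_{\mathfrak{so}(3)}\beta,\qquad \beta=\frac{k_I}{2}R\sum_{i=1}^{\nu} e_i\wedge y_i^r,\qquad \dot R_d=(Cw)_\times R_d,\qquad \dot w=Sw .$$ Assume that at least two of the vectors $\mathring y_i$ (equivalently, of the measurements $y_i$) are linearly independent and that $Y=\frac{k_p}{2}\sum_{i=1}^{\nu} y_i^r y_i^{r\top}$ has three distinct eigenvalues. Then the set $$\mathcal S=\{(R,\delta,(R_d,w)) : R^\top R_d=X_r,\ \delta=w\}$$ is almost globally asymptotically stable and locally exponentially stable for the closed loop. That is, every initial state has a solution on $[0,\infty)$, and: 1. $\mathcal S$ is Lyapunov stable and locally attractive (with respect to the distance to $\mathcal S$, for neighbourhoods $\{\mathrm{dist}(\cdot,\mathcal S)<r\}$), and for every initial exosystem state $(R_d(0),w(0))$ the set of those $(R(0),\delta(0))\in SO(3)\times\mathbb R^m$ from which the state does not converge to $\mathcal S$ has measure zero; 2. for every $\rho$ there are $r,\kappa,\alpha>0$ such that every solution with $\|w(0)\|\le\rho$ that starts at distance less than $r$ from $\mathcal S$ satisfies $\mathrm{dist}(x(t),\mathcal S)\le\kappa e^{-\alpha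 t}\,\mathrm{dist}(x(0),\mathcal S)$ for all $t\ge 0$, where $x=(R,\delta,(R_d,w))$. -/

import Mathlib

open scoped Matrix Matrix.Norms.Frobenius
open Filter Topology MeasureTheory

/-! ### Stability of a set for a family of trajectories

`Sol` is the set of (forward) solutions `x : [0, ∞) → X` of a differential equation on a metric
space `X`; only the values `x t` with `0 ≤ t` matter.  `A` is the set whose stability is studied,
and `Metric.infDist (x t) A` is the distance from the current state to `A`. -/

section Stability

variable {X : Type*} [MetricSpace X]

/-- Every initial state is the initial value of a solution defined for all `t ≥ 0`. -/
def ForwardComplete (Sol : Set (ℝ → X)) : Prop :=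
  ∀ x₀ : X, ∃ x ∈ Sol, x 0 = x₀

/-- The trajectory `x` converges to the set `A`. -/
def ConvergesTo (x : ℝ → X) (A : Set X) : Prop :=
  Tendsto (fun t => Metric.infDist (x t) A) atTop (𝓝 0)

/-- Lyapunov stability of the set `A`. -/
def IsLyapunovStable (Sol : Set (ℝ → X)) (A : Set X) : Prop :=
  ∀ ε > 0, ∃ η > 0, ∀ x ∈ Sol, Metric.infDist (x 0) A < η →
    ∀ t ≥ 0, Metric.infDist (x t) A < ε

/-- Local attractivity of the set `A`. -/
def IsLocallyAttractive (Sol : Set (ℝ → X)) (A : Set X) : Prop :=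
  ∃ r > 0, ∀ x ∈ Sol, Metric.infDist (x 0) A < r → ConvergesTo x A

/-- Local exponential stability of the set `A`, for the trajectories that start in `K`. -/
def IsLocallyExpStableOn (Sol : Set (ℝ → X)) (A K : Set X) : Prop :=
  ∃ r > 0, ∃ κ > 0, ∃ α > 0, ∀ x ∈ Sol, x 0 ∈ K → Metric.infDist (x 0) A < r →
    ∀ t ≥ 0, Metric.infDist (x t) A ≤ κ * Real.exp (-α * t) * Metric.infDist (x 0) A

/-- `B` has vanishing `d`-dimensional Hausdorff measure.  For a subset of a `d`-dimensional smooth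
submanifold of a finite-dimensional normed space this says that `B` has measure zero in the manifold (in charts,
or for any Riemannian volume or Haar measure). -/
def IsNullOfDim (d : ℝ) (B : Set X) : Prop :=
  letI : MeasurableSpace X := borel X
  haveI : BorelSpace X := ⟨rfl⟩
  μH[d] B = 0

end Stability

/-! ### The closed-loop system on `SO(3)` -/

/-- The rotation group `SO(3)`, with the distance of the Frobenius norm. -/
abbrev SO3 : Type := Matrix.specialOrthogonalGroup (Fin 3) ℝ

/-- The skew-symmetric matrix `v_×` of `v ∈ ℝ³`. -/
def hat (v : Fin 3 → ℝ) : Matrix (Fin 3) (Fin 3) ℝ :=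
  !![0, -v 2, v 1; v 2, 0, -v 0; -v 1, v 0, 0]

/-- The duplication matrix of `so(3)`: `vec (v_×) = D v`. -/
def dupSO3 : Matrix (Fin 3 × Fin 3) (Fin 3) ℝ :=
  Matrix.of fun ij k => hat (Pi.single k 1) ij.1 ij.2

/-- The weight `Q = Dᵀ D` of `so(3)`, for which `tr (u_×ᵀ v_×) = uᵀ Q v`. -/
def Qso3 : Matrix (Fin 3) (Fin 3) ℝ := dupSO3ᵀ * dupSO3

theorem dupSO3_mulVec (v : Fin 3 → ℝ) (i j : Fin 3) : (dupSO3 *ᵥ v) (i, j) = hat v i j := by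
  have h0 : (Pi.single 0 1 : Fin 3 → ℝ) = ![1, 0, 0] := by ext k; fin_cases k <;> rfl
  have h1 : (Pi.single 1 1 : Fin 3 → ℝ) = ![0, 1, 0] := by ext k; fin_cases k <;> rfl
  have h2 : (Pi.single 2 1 : Fin 3 → ℝ) = ![0, 0, 1] := by ext k; fin_cases k <;> rfl
  simp only [dupSO3, Matrix.mulVec, dotProduct, Fin.sum_univ_three, Matrix.of_apply, h0, h1, h2]
  fin_cases i <;> fin_cases j <;> simp [hat]

theorem trace_hat_mul_hat (u v : Fin 3 → ℝ) :
    ((hat u)ᵀ * hat v).trace = u ⬝ᵥ (Qso3 *ᵥ v) := by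
  rw [Qso3, ← Matrix.mulVec_mulVec, Matrix.dotProduct_mulVec, Matrix.vecMul_transpose]
  simp only [Matrix.trace, Matrix.diag_apply, Matrix.mul_apply, Matrix.transpose_apply,
    dotProduct, Fintype.sum_prod_type, dupSO3_mulVec]
  exact Finset.sum_comm

/-- The state space: the tuples `(R, δ, (R_d, w))`. -/
abbrev LoopState (m : ℕ) : Type :=
  SO3 × EuclideanSpace ℝ (Fin m) × SO3 × EuclideanSpace ℝ (Fin m)

/-- The pair `(C, S)` is observable. -/
def IsObservablePair {m : ℕ} (C : Matrix (Fin 3) (Fin m) ℝ) (S : Matrix (Fin m) (Fin m) ℝ) :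
    Prop :=
  ∀ v : Fin m → ℝ, (∀ k : ℕ, C *ᵥ ((S ^ k) *ᵥ v) = 0) → v = 0

section Controller

variable {m ν : ℕ} (C : Matrix (Fin 3) (Fin m) ℝ) (S : Matrix (Fin m) (Fin m) ℝ)
  (kp kI : ℝ) (Xr : SO3) (y₀ : Fin ν → Fin 3 → ℝ)

/-- The constant reference vectors `y_iʳ = X_r ẙ_i`. -/
def yRef (i : Fin ν) : Fin 3 → ℝ := Xr.1 *ᵥ y₀ i

/-- The measurements `y_i = Rᵀ R_d ẙ_i`. -/
def yMeas (R Rd : SO3) (i : Fin ν) : Fin 3 → ℝ := (R.1ᵀ * Rd.1) *ᵥ y₀ i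

/-- The error vectors `e_i = y_iʳ - y_i`. -/
def errVec (R Rd : SO3) (i : Fin ν) : Fin 3 → ℝ := yRef Xr y₀ i - yMeas y₀ R Rd i

/-- The matrix `Y = (k_p / 2) ∑ y_iʳ y_iʳᵀ`. -/
noncomputable def Ymat : Matrix (Fin 3) (Fin 3) ℝ :=
  (kp / 2) • ∑ i, Matrix.vecMulVec (yRef Xr y₀ i) (yRef Xr y₀ i)

/-- The angular velocity input `Ω_×ᶜ = Ad_{Rᵀ} (C δ)_× + (k_p / 2) ∑ (e_i ∧ y_iʳ)_×`. -/
noncomputable def omegaCtrl (R : SO3) (δ : EuclideanSpace ℝ (Fin m)) (Rd : SO3) :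
    Matrix (Fin 3) (Fin 3) ℝ :=
  R.1ᵀ * hat (C *ᵥ δ.ofLp) * R.1
    + (kp / 2) • ∑ i, hat (errVec Xr y₀ R Rd i ⨯₃ yRef Xr y₀ i)

/-- The innovation term `β = (k_I / 2) R ∑ e_i ∧ y_iʳ`. -/
noncomputable def betaCtrl (R Rd : SO3) : Fin 3 → ℝ :=
  (kI / 2) • (R.1 *ᵥ ∑ i, errVec Xr y₀ R Rd i ⨯₃ yRef Xr y₀ i)

/-- The forward solutions of the closed loop
`Ṙ = R Ω_×ᶜ`, `δ̇ = S δ + Cᵀ Q β`, `Ṙ_d = (C w)_× R_d`, `ẇ = S w`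
(one-sided derivative at `t = 0`; matrix derivatives are taken entry by entry). -/
def closedLoop : Set (ℝ → LoopState m) :=
  {x | ∀ t ≥ (0 : ℝ),
    (∀ i j, HasDerivWithinAt (fun s => (x s).1.1 i j)
      (((x t).1.1 * omegaCtrl C kp Xr y₀ (x t).1 (x t).2.1 (x t).2.2.1) i j) (Set.Ici 0) t) ∧
    HasDerivWithinAt (fun s => (x s).2.1)
      (WithLp.toLp 2 (S *ᵥ (x t).2.1.ofLp
        + Cᵀ *ᵥ (Qso3 *ᵥ betaCtrl kI Xr y₀ (x t).1 (x t).2.2.1))) (Set.Ici 0) t ∧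
    (∀ i j, HasDerivWithinAt (fun s => (x s).2.2.1.1 i j)
      ((hat (C *ᵥ (x t).2.2.2.ofLp) * (x t).2.2.1.1) i j) (Set.Ici 0) t) ∧
    HasDerivWithinAt (fun s => (x s).2.2.2)
      (WithLp.toLp 2 (S *ᵥ (x t).2.2.2.ofLp)) (Set.Ici 0) t}

/-- The target set `{(R, δ, (R_d, w)) | Rᵀ R_d = X_r, δ = w}`. -/
def targetSet (m : ℕ) (Xr : SO3) : Set (LoopState m) :=
  {p | p.1.1ᵀ * p.2.2.1.1 = Xr.1 ∧ p.2.1 = p.2.2.2}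

end Controller

/-- Almost global asymptotic stability of the set `A ⊆ SO(3) × ℝᵐ × (SO(3) × ℝᵐ)`: all solutions
exist for all forward time, `A` is Lyapunov stable and locally attractive and, whatever the initial
state `(R_d(0), w(0))` of the exosystem, for almost all `(R(0), δ(0))` in the `(3 + m)`-dimensional
manifold `SO(3) × ℝᵐ` the solution converges to `A`. -/
def IsAlmostGloballyAsymptoticallyStable {m : ℕ} (Sol : Set (ℝ → LoopState m))
    (A : Set (LoopState m)) : Prop :=
  ForwardComplete Sol ∧ IsLyapunovStable Sol A ∧ IsLocallyAttractive Sol A ∧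
    ∀ (Rd₀ : SO3) (w₀ : EuclideanSpace ℝ (Fin m)),
      IsNullOfDim (3 + m : ℝ) {p : SO3 × EuclideanSpace ℝ (Fin m) |
        ¬ ∀ x ∈ Sol, x 0 = (p.1, p.2, Rd₀, w₀) → ConvergesTo x A}

/-- Local exponential stability of the set `A ⊆ SO(3) × ℝᵐ × (SO(3) × ℝᵐ)`, uniformly over every
compact range `{‖w(0)‖ ≤ ρ}` of exosystem states. -/
def IsLocallyExponentiallyStable {m : ℕ} (Sol : Set (ℝ → LoopState m))
    (A : Set (LoopState m)) : Prop :=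
  ∀ ρ : ℝ, IsLocallyExpStableOn Sol A {p | ‖p.2.2.2‖ ≤ ρ}

/-! ### Detectability forms, and a quadratic form that grows near an equilibrium -/

section Detectability

/-! Diagonalize `Y = U Λ Uᵀ` with a rotation `U` and `Λ = diag l`. The weights are nonnegative and
distinct, so at most one vanishes and all pairwise sums are positive. In the error variables `Q = Uᵀ
Rᵀ R_d X_rᵀ U` and `d = δ - w` the loop reads `Q' = Λ - Q Λ Q - Q (B d)_×`, `d' = S d + κ B* axial
(Λ Q)`, with `κ = 2 k_I / k_p` and `B = (R_d X_rᵀ U)ᵀ C` (`rotField_errRot`, `vecField_errRot`).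
Time enters only through `B`, and `‖B d‖ = ‖C d‖` because the frame is orthogonal. The target set is
`Q = 1`, `d = 0`, and the distance to it is comparable to the size of `(Q - 1, d)`.

The energy `tr (Λ (1 - Q)) + ‖d‖² / (2κ)` has derivative `-‖axial (Λ Q)‖²`: `S` is skew and the
coupling terms cancel. It is comparable to `‖Q - 1‖² + ‖d‖²`, which gives Lyapunov stability,
boundedness and global existence. By Barbalat's lemma `axial (Λ Q) → 0`. The zeros of this function
are diagonal rotations with entries `±1`, at mutual distance at least `2`, so by connectedness `Q`
ends up near a single one of them.

The rest of the argument uses one quadratic form `W` (`pairForm`). Observability gives `P` such that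
`⟨P d, d⟩` grows along `d' = S d` at rate at least `c‖d‖² - K‖C d‖²`. The cross term `-K⟨e, B d⟩`
recovers `K‖B d‖²`, and a large negative multiple of the linearized energy contributes `M₀‖H e‖²`,
with `H` invertible. Hence `W' ≥ (c/4)(‖e‖² + ‖d‖²)` near every diagonal rotation, where `e` is the
axial coordinate of the left-translated rotation error. The same holds for the difference of two
nearby trajectories (`exists_pairForm_growth`). There are three consequences.

Since `W` is bounded, a second use of Barbalat's lemma shows that every trajectory converges to an
equilibrium (`IsErrTraj.exists_tendsto`).

At the identity `H` is positive, so `-W` is equivalent to `‖e‖² + ‖d‖²` and decays exponentially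
(`exists_exp_decay`).

At any other equilibrium `H` has a negative eigenvalue. If two trajectories stay nearby forever,
their difference has `W ≤ 0`, as otherwise `W` would grow without bound; this cone condition bounds
one coordinate of `e` by the remaining coordinates and `d` (`exists_saddle_separation`). Together
with a backward Gronwall estimate, the bad initial states form a countable union of sets that map to
a space of dimension `2 + m` with Lipschitz inverse. So their Hausdorff dimension is at most `2 +
m`, and their `(3 + m)`-dimensional measure is zero (`dimH_not_tendsto_le`); this replaces a stable
manifold theorem. -/

lemma abs_inner_le_of_norm_le {F : Type*} [NormedAddCommGroup F] [InnerProductSpace ℝ F] (x y : F)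
    (u v : ℝ) (hx : ‖x‖ ≤ u) (hy : ‖y‖ ≤ v) : |inner ℝ x y| ≤ u * v :=
  (abs_real_inner_le_norm x y).trans
    (mul_le_mul hx hy (norm_nonneg _) ((norm_nonneg _).trans hx))

variable {D E : Type*} [NormedAddCommGroup D] [InnerProductSpace ℝ D] [CompleteSpace D]
  [NormedAddCommGroup E] [InnerProductSpace ℝ E] [CompleteSpace E]

/-- Along `ḋ = S d`, a quadratic form controls the first `j + 1` derivatives of the output `C d`,
up to the output itself and an arbitrarily small multiple of `‖d‖²`. -/
lemma exists_form_of_output_derivatives (C : D →L[ℝ] E) (S : D →L[ℝ] D) (j : ℕ) :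
    ∀ a θ : ℝ, 0 < a → 0 < θ → ∃ (P : D →L[ℝ] D) (K : ℝ), 0 ≤ K ∧ ∀ d : D,
      a * ∑ k ∈ Finset.range (j + 1), ‖C ((S ^ k) d)‖ ^ 2 - θ * ‖d‖ ^ 2
        ≤ inner ℝ (P (S d)) d + inner ℝ (P d) (S d) + K * ‖C d‖ ^ 2 := by
  induction j with
  | zero =>
    intro a θ ha hθ
    refine ⟨0, a, ha.le, fun d => ?_⟩
    have : 0 ≤ θ * ‖d‖ ^ 2 := by positivity
    simp
    linarith
  | succ j ih =>
    intro a θ ha hθ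
    set b := ‖C ∘L (S ^ (j + 2))‖ with hb
    -- The new summand of the form has derivative `a‖C S^(j+1) d‖² + a⟨C S^j d, C S^(j+2) d⟩`. The
    -- increased coefficient and the halved `θ` leave room to absorb the second term by Young's
    -- inequality (`e4`).
    obtain ⟨P, K, hK, hP⟩ := ih (a + a ^ 2 * b ^ 2 / (2 * θ)) (θ / 2) (by positivity) (by positivity)
    refine ⟨P + a • ((ContinuousLinearMap.adjoint (C ∘L (S ^ (j + 1)))) ∘L (C ∘L (S ^ j))), K, hK,
      fun d => ?_⟩
    have h := hP d
    have e1 : inner ℝ ((ContinuousLinearMap.adjoint (C ∘L (S ^ (j + 1)))) ((C ∘L (S ^ j)) (S d))) d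
        = ‖C ((S ^ (j + 1)) d)‖ ^ 2 := by
      rw [ContinuousLinearMap.adjoint_inner_left, ← real_inner_self_eq_norm_sq]
      simp [pow_succ]
    have e2 : inner ℝ ((ContinuousLinearMap.adjoint (C ∘L (S ^ (j + 1)))) ((C ∘L (S ^ j)) d)) (S d)
        = inner ℝ (C ((S ^ j) d)) ((C ∘L (S ^ (j + 2))) d) := by
      rw [ContinuousLinearMap.adjoint_inner_left]
      simp [pow_succ]
    have e3 : -(‖C ((S ^ j) d)‖ * (b * ‖d‖)) ≤ inner ℝ (C ((S ^ j) d)) ((C ∘L (S ^ (j + 2))) d) := by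
      have h1 := abs_real_inner_le_norm (C ((S ^ j) d)) ((C ∘L (S ^ (j + 2))) d)
      have h2 := (C ∘L (S ^ (j + 2))).le_opNorm d
      have h3 := mul_le_mul_of_nonneg_left h2 (norm_nonneg (C ((S ^ j) d)))
      have h4 := (abs_le.mp h1).1
      linarith
    have e4 : a * (‖C ((S ^ j) d)‖ * (b * ‖d‖))
        ≤ θ / 2 * ‖d‖ ^ 2 + a ^ 2 * b ^ 2 / (2 * θ) * ‖C ((S ^ j) d)‖ ^ 2 := by
      have : θ / 2 * ‖d‖ ^ 2 + a ^ 2 * b ^ 2 / (2 * θ) * ‖C ((S ^ j) d)‖ ^ 2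
          - a * (‖C ((S ^ j) d)‖ * (b * ‖d‖))
          = (θ * ‖d‖ - a * b * ‖C ((S ^ j) d)‖) ^ 2 / (2 * θ) := by
        field_simp
        ring
      have h0 : 0 ≤ (θ * ‖d‖ - a * b * ‖C ((S ^ j) d)‖) ^ 2 / (2 * θ) := by positivity
      linarith
    have e5 : ‖C ((S ^ j) d)‖ ^ 2 ≤ ∑ k ∈ Finset.range (j + 1), ‖C ((S ^ k) d)‖ ^ 2 :=
      Finset.single_le_sum (f := fun k => ‖C ((S ^ k) d)‖ ^ 2) (fun _ _ => by positivity)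
        (Finset.self_mem_range_succ j)
    have e6 := mul_le_mul_of_nonneg_left e5 (show 0 ≤ a ^ 2 * b ^ 2 / (2 * θ) by positivity)
    rw [Finset.sum_range_succ]
    simp only [add_apply, smul_apply, inner_add_left,
      inner_smul_left, ContinuousLinearMap.comp_apply, conj_trivial] at e1 e2 e3 ⊢
    rw [e1, e2]
    have e7 := mul_le_mul_of_nonneg_left e3 ha.le
    nlinarith

/-- A quadratic form whose derivative along `ḋ = S d` dominates `‖d‖²` up to the output `C d`. -/
lemma exists_detectability_form (C : D →L[ℝ] E) (S : D →L[ℝ] D) (n : ℕ) (K₀ : ℝ)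
    (hobs : ∀ d : D, ‖d‖ ^ 2 ≤ K₀ * ∑ k ∈ Finset.range (n + 1), ‖C ((S ^ k) d)‖ ^ 2) :
    ∃ (P : D →L[ℝ] D) (c K : ℝ), 0 < c ∧ 0 ≤ K ∧ ∀ d : D,
      c * ‖d‖ ^ 2 - K * ‖C d‖ ^ 2 ≤ inner ℝ (P (S d)) d + inner ℝ (P d) (S d) := by
  -- With this coefficient the sum dominates `2‖d‖²`, so subtracting `θ‖d‖²` with `θ = 1` leaves the
  -- constant `c = 1`.
  obtain ⟨P, K, hK, hP⟩ := exists_form_of_output_derivatives C S n (2 * (|K₀| + 1)) 1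
    (by positivity) one_pos
  refine ⟨P, 1, K, one_pos, hK, fun d => ?_⟩
  have h := hP d
  have h1 := hobs d
  have h2 : 0 ≤ ∑ k ∈ Finset.range (n + 1), ‖C ((S ^ k) d)‖ ^ 2 := by positivity
  have h3 : K₀ * ∑ k ∈ Finset.range (n + 1), ‖C ((S ^ k) d)‖ ^ 2
      ≤ (|K₀| + 1) * ∑ k ∈ Finset.range (n + 1), ‖C ((S ^ k) d)‖ ^ 2 :=
    mul_le_mul_of_nonneg_right (by linarith [le_abs_self K₀]) h2
  nlinarith

/-- The quadratic form `W` used near an equilibrium. -/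
noncomputable def pairForm (H : E →L[ℝ] E) (P : D →L[ℝ] D) (κ M₀ M₁ : ℝ) (B : D →L[ℝ] E)
    (e : E) (d : D) : ℝ :=
  -(M₀ / 2) * (inner ℝ (H e) e + ‖d‖ ^ 2 / κ) - M₁ * inner ℝ e (B d) + inner ℝ (P d) d

/-- The derivative of `pairForm` along a curve. -/
noncomputable def pairFormDeriv (H : E →L[ℝ] E) (P : D →L[ℝ] D) (κ M₀ M₁ : ℝ) (B B' : D →L[ℝ] E)
    (e e' : E) (d d' : D) : ℝ :=
  -M₀ * (inner ℝ (H e) e' + inner ℝ d d' / κ)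
    - M₁ * (inner ℝ e' (B d) + inner ℝ e (B' d) + inner ℝ e (B d'))
    + (inner ℝ (P d') d + inner ℝ (P d) d')

lemma hasDerivWithinAt_pairForm (H : E →L[ℝ] E) (hH : ∀ x y, inner ℝ (H x) y = inner ℝ x (H y))
    (P : D →L[ℝ] D) (κ M₀ M₁ : ℝ) {B : ℝ → D →L[ℝ] E} {B' : D →L[ℝ] E} {e : ℝ → E} {e' : E}
    {d : ℝ → D} {d' : D} {s : Set ℝ} {t : ℝ} (hB : HasDerivWithinAt B B' s t)
    (he : HasDerivWithinAt e e' s t) (hd : HasDerivWithinAt d d' s t) :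
    HasDerivWithinAt (fun τ => pairForm H P κ M₀ M₁ (B τ) (e τ) (d τ))
      (pairFormDeriv H P κ M₀ M₁ (B t) B' (e t) e' (d t) d') s t := by
  have hHe : HasDerivWithinAt (fun τ => H (e τ)) (H e') s t :=
    H.hasFDerivAt.comp_hasDerivWithinAt t he
  have hPd : HasDerivWithinAt (fun τ => P (d τ)) (P d') s t :=
    P.hasFDerivAt.comp_hasDerivWithinAt t hd
  have hBd := hB.clm_apply hd
  have h := (((hHe.inner ℝ he).add ((hd.norm_sq).div_const κ)).const_mul (-(M₀ / 2))).sub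
    ((he.inner ℝ hBd).const_mul M₁) |>.add (hPd.inner ℝ hd)
  refine h.congr_deriv ?_
  simp only [pairFormDeriv, inner_add_right]
  rw [hH e' (e t), real_inner_comm (H (e t)) e']
  ring

-- With the cross-term coefficient equal to `K`, the derivative contains `M₀‖H e‖² + K‖B d‖²` plus
-- at least `c‖d‖² - K‖B d‖²`. The `‖B d‖²` terms cancel, and the mixed terms independent of `M₀`
-- are absorbed by taking `M₀` large. The tolerance `θ` for the remainders is fixed only after `M₀`,
-- uniformly in `B` and `B'`.
set_option maxHeartbeats 1000000 in
lemma le_pairFormDeriv (H : E →L[ℝ] E) (S P : D →L[ℝ] D) (hS : ∀ d, inner ℝ d (S d) = 0)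
    {κ h b b' c K : ℝ} (hκ : 0 < κ) (hh : 0 < h) (hb : 0 ≤ b) (hc : 0 < c)
    (hK : 0 ≤ K) (hHinv : ∀ e, h * ‖e‖ ≤ ‖H e‖) :
    ∃ Mb : ℝ, ∀ M₀ ≥ Mb, ∃ θ > 0, ∀ (B B' : D →L[ℝ] E), ‖B‖ ≤ b → ‖B'‖ ≤ b' →
      (∀ d, c * ‖d‖ ^ 2 - K * ‖B d‖ ^ 2 ≤ inner ℝ (P (S d)) d + inner ℝ (P d) (S d)) →
      ∀ (e r₁ : E) (d r₂ : D), ‖r₁‖ ≤ θ * (‖e‖ + ‖d‖) → ‖r₂‖ ≤ θ * (‖e‖ + ‖d‖) →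
        c / 4 * (‖e‖ ^ 2 + ‖d‖ ^ 2) ≤ pairFormDeriv H P κ M₀ K B B' e (-H e - B d + r₁) d
          (S d + κ • (ContinuousLinearMap.adjoint B) (H e) + r₂) := by
  set a := ‖H‖ with ha
  set p := ‖P‖ with hp
  set s := ‖S‖ with hs
  have ha0 : 0 ≤ a := norm_nonneg _
  have hp0 : 0 ≤ p := norm_nonneg _
  have hs0 : 0 ≤ s := norm_nonneg _
  set k₄ := K * (a * b + b' + b * s) + 2 * p * κ * b * a with hk₄
  set k₂ := K * κ * b * b * a with hk₂
  -- Here `k₂` bounds the remaining `‖e‖²` terms and `k₄` the `‖e‖‖d‖` terms. Young's inequality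
  -- spends `c/2` of `‖d‖²` on the latter, and the extra `c/2` in the threshold leaves the same
  -- amount of `‖e‖²`.
  refine ⟨(k₂ + k₄ ^ 2 / (2 * c) + c / 2) / h ^ 2, fun M₀ hM => ?_⟩
  have hM' : k₂ + k₄ ^ 2 / (2 * c) + c / 2 ≤ M₀ * h ^ 2 := by
    rwa [ge_iff_le, div_le_iff₀ (by positivity)] at hM
  have hM0 : 0 ≤ M₀ := le_trans (by positivity) hM
  set k₅ := M₀ * (a + 1 / κ) + K * (b + b) + 2 * p with hk₅
  have hk₅0 : 0 ≤ k₅ := by positivity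
  -- The remainders cost at most `k₅ θ (‖e‖ + ‖d‖)² ≤ (c/4)(‖e‖² + ‖d‖²)`, that is, half of the
  -- surviving `c/2`.
  refine ⟨c / (8 * (k₅ + 1)), by positivity, fun B B' hB hB' hP e r₁ d r₂ hr₁ hr₂ => ?_⟩
  set θ := c / (8 * (k₅ + 1)) with hθ
  have hθ0 : 0 < θ := by positivity
  set x := ‖e‖ with hx
  set y := ‖d‖ with hy
  have hx0 : 0 ≤ x := norm_nonneg _
  have hy0 : 0 ≤ y := norm_nonneg _
  have nH : ‖H e‖ ≤ a * x := H.le_opNorm e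
  have nB : ∀ z : D, ‖B z‖ ≤ b * ‖z‖ := fun z => B.le_of_opNorm_le hB z
  have nB' : ‖B' d‖ ≤ b' * y := B'.le_of_opNorm_le hB' d
  have nBt : ∀ z : E, ‖(ContinuousLinearMap.adjoint B) z‖ ≤ b * ‖z‖ := fun z =>
    (ContinuousLinearMap.adjoint B).le_of_opNorm_le (by simpa using hB) z
  have nBH : ‖(ContinuousLinearMap.adjoint B) (H e)‖ ≤ b * (a * x) :=
    (nBt _).trans (mul_le_mul_of_nonneg_left nH hb)
  have nS : ‖S d‖ ≤ s * y := S.le_opNorm d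
  have nP : ∀ z : D, ‖P z‖ ≤ p * ‖z‖ := P.le_opNorm
  have nPd := nP d
  have i1 := abs_inner_le_of_norm_le (H e) (B d) _ _ nH (nB d)
  have i2 := abs_inner_le_of_norm_le e (B' d) _ _ le_rfl nB'
  have i3 := abs_inner_le_of_norm_le e (B (S d)) _ _ le_rfl ((nB _).trans (mul_le_mul_of_nonneg_left nS hb))
  have i4 := abs_inner_le_of_norm_le e (B ((ContinuousLinearMap.adjoint B) (H e))) _ _ le_rfl
    ((nB _).trans (mul_le_mul_of_nonneg_left nBH hb))
  have i5 := abs_inner_le_of_norm_le (P ((ContinuousLinearMap.adjoint B) (H e))) d _ _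
    ((nP _).trans (mul_le_mul_of_nonneg_left nBH hp0)) le_rfl
  have i6 := abs_inner_le_of_norm_le (P d) ((ContinuousLinearMap.adjoint B) (H e)) _ _ nPd nBH
  have j1 := abs_inner_le_of_norm_le (H e) r₁ _ _ nH hr₁
  have j2 := abs_inner_le_of_norm_le d r₂ _ _ le_rfl hr₂
  have j3 := abs_inner_le_of_norm_le r₁ (B d) _ _ hr₁ (nB d)
  have j4 := abs_inner_le_of_norm_le e (B r₂) _ _ le_rfl ((nB _).trans (mul_le_mul_of_nonneg_left hr₂ hb))
  have j5 := abs_inner_le_of_norm_le (P r₂) d _ _ ((nP _).trans (mul_le_mul_of_nonneg_left hr₂ hp0)) le_rfl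
  have j6 := abs_inner_le_of_norm_le (P d) r₂ _ _ nPd hr₂
  have hPd := hP d
  have hHe : h ^ 2 * x ^ 2 ≤ ‖H e‖ ^ 2 := by
    rw [← mul_pow]
    exact pow_le_pow_left₀ (by positivity) (hHinv e) 2
  -- In the energy part, `⟨H e, B d⟩` cancels against `⟨d, B* H e⟩` and `⟨d, S d⟩` vanishes, so `M₀`
  -- multiplies only `‖H e‖²` and remainder terms.
  have expand : pairFormDeriv H P κ M₀ K B B' e (-H e - B d + r₁) d
          (S d + κ • (ContinuousLinearMap.adjoint B) (H e) + r₂)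
      = M₀ * ‖H e‖ ^ 2 + K * ‖B d‖ ^ 2 + (inner ℝ (P (S d)) d + inner ℝ (P d) (S d))
        + (K * inner ℝ (H e) (B d) - K * inner ℝ e (B' d) - K * inner ℝ e (B (S d))
          - K * κ * inner ℝ e (B ((ContinuousLinearMap.adjoint B) (H e)))
          + κ * inner ℝ (P ((ContinuousLinearMap.adjoint B) (H e))) d
          + κ * inner ℝ (P d) ((ContinuousLinearMap.adjoint B) (H e)))
        + (-M₀ * inner ℝ (H e) r₁ - M₀ * inner ℝ d r₂ / κ - K * inner ℝ r₁ (B d)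
          - K * inner ℝ e (B r₂) + inner ℝ (P r₂) d + inner ℝ (P d) r₂) := by
    simp only [pairFormDeriv, map_add, map_smul, inner_add_left, inner_add_right, inner_sub_left,
      inner_sub_right, inner_neg_left, inner_neg_right, inner_smul_left, inner_smul_right,
      ContinuousLinearMap.adjoint_inner_right, hS, conj_trivial, real_inner_self_eq_norm_sq]
    rw [real_inner_comm (H e) (B d)]
    field_simp
    ring
  rw [expand]
  have a1 := abs_le.mp i1
  have a2 := abs_le.mp i2
  have a3 := abs_le.mp i3
  have a4 := abs_le.mp i4
  have a5 := abs_le.mp i5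
  have a6 := abs_le.mp i6
  have lin : -(k₄ * (x * y) + k₂ * x ^ 2) ≤
      (K * inner ℝ (H e) (B d) - K * inner ℝ e (B' d) - K * inner ℝ e (B (S d))
          - K * κ * inner ℝ e (B ((ContinuousLinearMap.adjoint B) (H e)))
          + κ * inner ℝ (P ((ContinuousLinearMap.adjoint B) (H e))) d
          + κ * inner ℝ (P d) ((ContinuousLinearMap.adjoint B) (H e))) := by
    have l1 := mul_le_mul_of_nonneg_left a1.1 hK
    have l2 := mul_le_mul_of_nonneg_left a2.2 hK
    have l3 := mul_le_mul_of_nonneg_left a3.2 hK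
    have l4 := mul_le_mul_of_nonneg_left a4.2 (mul_nonneg hK hκ.le)
    have l5 := mul_le_mul_of_nonneg_left a5.1 hκ.le
    have l6 := mul_le_mul_of_nonneg_left a6.1 hκ.le
    rw [hk₄, hk₂]
    linarith only [l1, l2, l3, l4, l5, l6]
  have pert : -(k₅ * θ * (x + y) ^ 2) ≤
      (-M₀ * inner ℝ (H e) r₁ - M₀ * inner ℝ d r₂ / κ - K * inner ℝ r₁ (B d)
          - K * inner ℝ e (B r₂) + inner ℝ (P r₂) d + inner ℝ (P d) r₂) := by
    have hxy : x ≤ x + y := by linarith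
    have hyx : y ≤ x + y := by linarith
    have hθx : 0 ≤ θ * (x + y) := by positivity
    have up : ∀ z, z ≤ x + y → θ * (x + y) * z ≤ θ * (x + y) ^ 2 := by
      intro z hz
      linarith only [mul_le_mul_of_nonneg_left hz hθx, sq (x + y)]
    have ux := up x hxy
    have uy := up y hyx
    have l1 := mul_le_mul_of_nonneg_left ((abs_le.mp j1).2.trans
      (show a * x * (θ * (x + y)) ≤ a * (θ * (x + y) ^ 2) by
        linarith only [mul_le_mul_of_nonneg_left ux ha0])) hM0
    have l2 := mul_le_mul_of_nonneg_left ((abs_le.mp j2).2.trans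
      (show y * (θ * (x + y)) ≤ θ * (x + y) ^ 2 by linarith only [uy])) (show 0 ≤ M₀ / κ by positivity)
    have l3 := mul_le_mul_of_nonneg_left ((abs_le.mp j3).2.trans
      (show θ * (x + y) * (b * y) ≤ b * (θ * (x + y) ^ 2) by
        linarith only [mul_le_mul_of_nonneg_left uy hb])) hK
    have l4 := mul_le_mul_of_nonneg_left ((abs_le.mp j4).2.trans
      (show x * (b * (θ * (x + y))) ≤ b * (θ * (x + y) ^ 2) by
        linarith only [mul_le_mul_of_nonneg_left ux hb])) hK
    have l5 : -(p * (θ * (x + y) ^ 2)) ≤ inner ℝ (P r₂) d := by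
      linarith only [(abs_le.mp j5).1, mul_le_mul_of_nonneg_left uy hp0]
    have l6 : -(p * (θ * (x + y) ^ 2)) ≤ inner ℝ (P d) r₂ := by
      linarith only [(abs_le.mp j6).1, mul_le_mul_of_nonneg_left uy hp0]
    have e2 : M₀ * inner ℝ d r₂ / κ = M₀ / κ * inner ℝ d r₂ := by ring
    have e5 : k₅ * θ * (x + y) ^ 2 = M₀ * (a * (θ * (x + y) ^ 2)) + M₀ / κ * (θ * (x + y) ^ 2)
        + K * (b * (θ * (x + y) ^ 2)) + K * (b * (θ * (x + y) ^ 2)) + p * (θ * (x + y) ^ 2)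
        + p * (θ * (x + y) ^ 2) := by
      rw [hk₅]
      ring
    rw [e2, e5]
    linarith only [l1, l2, l3, l4, l5, l6]
  have hθk : k₅ * θ ≤ c / 8 := by
    rw [hθ, ← mul_div_assoc, div_le_iff₀ (by positivity)]
    nlinarith only [hc, hk₅0]
  have q1 : k₅ * θ * (x + y) ^ 2 ≤ c / 8 * (x + y) ^ 2 :=
    mul_le_mul_of_nonneg_right hθk (by positivity)
  have q2 : (x + y) ^ 2 ≤ 2 * (x ^ 2 + y ^ 2) := by nlinarith only [sq_nonneg (x - y)]
  have q3 : k₄ * (x * y) ≤ c / 2 * y ^ 2 + k₄ ^ 2 / (2 * c) * x ^ 2 := by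
    have : c / 2 * y ^ 2 + k₄ ^ 2 / (2 * c) * x ^ 2 - k₄ * (x * y)
        = (c * y - k₄ * x) ^ 2 / (2 * c) := by
      field_simp
      ring
    have h0 : 0 ≤ (c * y - k₄ * x) ^ 2 / (2 * c) := by positivity
    linarith only [this, h0]
  have q4 : M₀ * h ^ 2 * x ^ 2 ≤ M₀ * ‖H e‖ ^ 2 := by
    rw [mul_assoc]
    exact mul_le_mul_of_nonneg_left hHe hM0
  have q5 : (k₂ + k₄ ^ 2 / (2 * c) + c / 2) * x ^ 2 ≤ M₀ * h ^ 2 * x ^ 2 :=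
    mul_le_mul_of_nonneg_right hM' (by positivity)
  have q6 := mul_le_mul_of_nonneg_left q2 (show 0 ≤ c / 8 by positivity)
  linarith only [lin, pert, q1, q3, q4, q5, q6, hPd]

end Detectability

/-! ### Skew-symmetric matrices and axial vectors -/

abbrev Mat3 : Type := Matrix (Fin 3) (Fin 3) ℝ

abbrev Vec3 : Type := EuclideanSpace ℝ (Fin 3)

/-- `hat` as a continuous linear map. -/
noncomputable def hatL : Vec3 →L[ℝ] Mat3 := LinearMap.toContinuousLinearMap
  { toFun := fun v => hat v.ofLp
    map_add' := fun u v => by ext i j; fin_cases i <;> fin_cases j <;> simp [hat] <;> ring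
    map_smul' := fun a v => by ext i j; fin_cases i <;> fin_cases j <;> simp [hat] }

lemma hatL_apply (v : Vec3) : hatL v = hat v.ofLp := rfl

/-- The vector `axial M` with `hat (axial M) = M - Mᵀ`. -/
noncomputable def axial : Mat3 →L[ℝ] Vec3 := LinearMap.toContinuousLinearMap
  { toFun := fun M => !₂[M 2 1 - M 1 2, M 0 2 - M 2 0, M 1 0 - M 0 1]
    map_add' := fun M N => by ext i; fin_cases i <;> simp <;> ring
    map_smul' := fun a M => by ext i; fin_cases i <;> simp <;> ring }

lemma axial_apply (M : Mat3) :
    axial M = !₂[M 2 1 - M 1 2, M 0 2 - M 2 0, M 1 0 - M 0 1] := rfl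

lemma hatL_axial (M : Mat3) : hatL (axial M) = M - Mᵀ := by
  ext i j
  fin_cases i <;> fin_cases j <;> simp [hatL_apply, axial_apply, hat]

lemma axial_hatL (v : Vec3) : axial (hatL v) = (2 : ℝ) • v := by
  ext i
  fin_cases i <;> simp [hatL_apply, axial_apply, hat] <;> ring

lemma frobenius_norm_sq (M : Mat3) : ‖M‖ ^ 2 = ∑ i, ∑ j, M i j ^ 2 := by
  rw [Matrix.frobenius_norm_def, ← Real.sqrt_eq_rpow, Real.sq_sqrt (by positivity)]
  simp

lemma norm_vec3_sq (v : Vec3) : ‖v‖ ^ 2 = v 0 ^ 2 + v 1 ^ 2 + v 2 ^ 2 := by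
  rw [EuclideanSpace.norm_sq_eq]
  simp [Fin.sum_univ_three]

lemma norm_hatL_sq (v : Vec3) : ‖hatL v‖ ^ 2 = 2 * ‖v‖ ^ 2 := by
  rw [frobenius_norm_sq, norm_vec3_sq]
  simp [Fin.sum_univ_three, hatL_apply, hat]
  ring

lemma norm_hatL_le (v : Vec3) : ‖hatL v‖ ≤ 2 * ‖v‖ := by
  refine le_of_sq_le_sq ?_ (by positivity)
  rw [norm_hatL_sq]
  nlinarith [sq_nonneg ‖v‖]

lemma norm_axial_le (M : Mat3) : ‖axial M‖ ≤ 2 * ‖M‖ := by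
  refine le_of_sq_le_sq ?_ (by positivity)
  rw [mul_pow, frobenius_norm_sq, norm_vec3_sq]
  simp only [axial_apply, Fin.sum_univ_three]
  simp
  nlinarith [sq_nonneg (M 2 1 + M 1 2), sq_nonneg (M 0 2 + M 2 0), sq_nonneg (M 1 0 + M 0 1),
    sq_nonneg (M 0 0), sq_nonneg (M 1 1), sq_nonneg (M 2 2), sq_nonneg (M 2 1), sq_nonneg (M 1 2),
    sq_nonneg (M 0 2), sq_nonneg (M 2 0), sq_nonneg (M 1 0), sq_nonneg (M 0 1)]

/-- Pairing with vectors `x`, `y` turns this into the scaling of the triple product by the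
determinant. For rotations it says that conjugation acts on axial vectors by the rotation. -/
lemma transpose_mul_hat_mul (M : Mat3) (v : Fin 3 → ℝ) :
    Mᵀ * hat (M *ᵥ v) * M = M.det • hat v := by
  ext i j
  fin_cases i <;> fin_cases j <;>
    simp [hat, Matrix.mul_apply, Fin.sum_univ_three, Matrix.mulVec, dotProduct,
      Matrix.det_fin_three] <;> ring

lemma SO3.transpose_mul (R : SO3) : R.1ᵀ * R.1 = 1 := by
  have := (Matrix.mem_specialOrthogonalGroup_iff.mp R.2).1
  exact (Matrix.mem_orthogonalGroup_iff' (Fin 3) ℝ).mp this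

lemma SO3.mul_transpose (R : SO3) : R.1 * R.1ᵀ = 1 := by
  have := (Matrix.mem_specialOrthogonalGroup_iff.mp R.2).1
  exact (Matrix.mem_orthogonalGroup_iff (Fin 3) ℝ).mp this

lemma SO3.det_eq (R : SO3) : R.1.det = 1 := (Matrix.mem_specialOrthogonalGroup_iff.mp R.2).2

lemma mem_SO3_iff (M : Mat3) :
    M ∈ Matrix.specialOrthogonalGroup (Fin 3) ℝ ↔ M * Mᵀ = 1 ∧ M.det = 1 := by
  rw [Matrix.mem_specialOrthogonalGroup_iff, Matrix.mem_orthogonalGroup_iff]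

lemma frobenius_norm_sq_eq_trace (M : Mat3) : ‖M‖ ^ 2 = (Mᵀ * M).trace := by
  rw [frobenius_norm_sq]
  simp [Matrix.trace, Matrix.mul_apply, Fin.sum_univ_three]
  ring

lemma norm_SO3_mul (R : SO3) (M : Mat3) : ‖R.1 * M‖ = ‖M‖ := by
  rw [← sq_eq_sq₀ (norm_nonneg _) (norm_nonneg _), frobenius_norm_sq_eq_trace,
    frobenius_norm_sq_eq_trace, Matrix.transpose_mul, Matrix.mul_assoc, ← Matrix.mul_assoc _ R.1 M,
    SO3.transpose_mul, Matrix.one_mul]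

lemma norm_transpose_SO3_mul (R : SO3) (M : Mat3) : ‖R.1ᵀ * M‖ = ‖M‖ := by
  conv_rhs => rw [← Matrix.one_mul M, ← SO3.mul_transpose R, Matrix.mul_assoc, norm_SO3_mul]

lemma norm_mul_SO3 (R : SO3) (M : Mat3) : ‖M * R.1‖ = ‖M‖ := by
  rw [← Matrix.frobenius_norm_transpose, Matrix.transpose_mul, norm_transpose_SO3_mul,
    Matrix.frobenius_norm_transpose]

lemma norm_mul_transpose_SO3 (R : SO3) (M : Mat3) : ‖M * R.1ᵀ‖ = ‖M‖ := by
  rw [← Matrix.frobenius_norm_transpose, Matrix.transpose_mul, Matrix.transpose_transpose,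
    norm_SO3_mul, Matrix.frobenius_norm_transpose]

lemma norm_SO3_le (R : SO3) : ‖R.1‖ ≤ 2 := by
  refine le_of_sq_le_sq ?_ (by positivity)
  rw [frobenius_norm_sq_eq_trace, SO3.transpose_mul]
  simp
  norm_num

lemma SO3.transpose_mul_hat_mul (R : SO3) (v : Fin 3 → ℝ) :
    R.1ᵀ * hat v * R.1 = hat (R.1ᵀ *ᵥ v) := by
  have := _root_.transpose_mul_hat_mul R.1 (R.1ᵀ *ᵥ v)
  rwa [Matrix.mulVec_mulVec, SO3.mul_transpose, Matrix.one_mulVec, SO3.det_eq, one_smul] at this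

lemma SO3.mul_hat_mul_transpose (R : SO3) (v : Fin 3 → ℝ) :
    R.1 * hat v * R.1ᵀ = hat (R.1 *ᵥ v) := by
  have := congrArg (fun N => R.1 * N * R.1ᵀ) (SO3.transpose_mul_hat_mul R (R.1 *ᵥ v))
  simp only [Matrix.mulVec_mulVec, SO3.transpose_mul, Matrix.one_mulVec] at this
  rw [← this]
  simp only [← Matrix.mul_assoc, SO3.mul_transpose, Matrix.one_mul]
  rw [Matrix.mul_assoc, SO3.mul_transpose, Matrix.mul_one]

lemma hat_transpose (v : Fin 3 → ℝ) : (hat v)ᵀ = -hat v := by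
  ext i j
  fin_cases i <;> fin_cases j <;> simp [hat]

lemma hat_injective : Function.Injective hat := by
  intro u v h
  have h0 := congrFun (congrFun h 2) 1
  have h1 := congrFun (congrFun h 0) 2
  have h2 := congrFun (congrFun h 1) 0
  simp [hat] at h0 h1 h2
  ext i
  fin_cases i <;> simp [h0, h1, h2]

lemma Qso3_eq : Qso3 = (2 : ℝ) • 1 := by
  ext i j
  fin_cases i <;> fin_cases j <;>
    simp [Qso3, dupSO3, Matrix.mul_apply, Fintype.sum_prod_type, Fin.sum_univ_three, hat] <;> norm_num

/-- The linearization at the equilibrium with weights `n`. -/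
noncomputable def hess (n : Fin 3 → ℝ) : Vec3 →L[ℝ] Vec3 := LinearMap.toContinuousLinearMap
  { toFun := fun v => !₂[(n 1 + n 2) * v 0, (n 2 + n 0) * v 1, (n 0 + n 1) * v 2]
    map_add' := fun u v => by ext i; fin_cases i <;> simp <;> ring
    map_smul' := fun a v => by ext i; fin_cases i <;> simp <;> ring }

lemma hess_apply (n : Fin 3 → ℝ) (v : Vec3) :
    hess n v = !₂[(n 1 + n 2) * v 0, (n 2 + n 0) * v 1, (n 0 + n 1) * v 2] := rfl

lemma inner_vec3 (u v : Vec3) : inner ℝ u v = u 0 * v 0 + u 1 * v 1 + u 2 * v 2 := by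
  simp [PiLp.inner_apply, Fin.sum_univ_three, mul_comm]

lemma hess_symm (n : Fin 3 → ℝ) (u v : Vec3) : inner ℝ (hess n u) v = inner ℝ u (hess n v) := by
  simp only [inner_vec3, hess_apply]
  simp
  ring

/-- `X Λ + Λ X` is the linearization of `Q Λ Q` at the identity. On axial vectors it is diagonal
with the pairwise sums of the weights as eigenvalues, so nondegeneracy only requires these sums to
be nonzero. -/
lemma axial_mul_diagonal_add (n : Fin 3 → ℝ) (X : Mat3) :
    axial (X * Matrix.diagonal n + Matrix.diagonal n * X) = hess n (axial X) := by
  ext i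
  fin_cases i <;> simp [axial_apply, hess_apply] <;> ring

/-- The skew part of `X` contributes half of the linearization. What is left depends on `X + Xᵀ`
alone, which is of second order for differences of rotations near the identity. -/
lemma axial_diagonal_mul (n : Fin 3 → ℝ) (X : Mat3) :
    axial (Matrix.diagonal n * X) = (1 / 2 : ℝ) • hess n (axial X)
      + (1 / 2 : ℝ) • axial (Matrix.diagonal n * (X + Xᵀ)) := by
  ext i
  fin_cases i <;> simp [axial_apply, hess_apply] <;> ring

/-! ### The error system -/

section ErrorSystem

variable {D : Type*} [NormedAddCommGroup D] [InnerProductSpace ℝ D] [CompleteSpace D]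

/-- Right-hand side of the rotation error. -/
noncomputable def rotField (n : Fin 3 → ℝ) (B : D →L[ℝ] Vec3) (Q : Mat3) (d : D) : Mat3 :=
  Matrix.diagonal n - Q * Matrix.diagonal n * Q - Q * hatL (B d)

/-- Right-hand side of the internal model error. -/
noncomputable def vecField (n : Fin 3 → ℝ) (κ : ℝ) (S : D →L[ℝ] D) (B : D →L[ℝ] Vec3) (Q : Mat3)
    (d : D) : D :=
  S d + κ • (ContinuousLinearMap.adjoint B) (axial (Matrix.diagonal n * Q))

/-- Forward trajectories of the error system driven by the output map `B t`. -/
structure IsErrTraj (n : Fin 3 → ℝ) (κ : ℝ) (S : D →L[ℝ] D) (B : ℝ → D →L[ℝ] Vec3)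
    (Q : ℝ → SO3) (d : ℝ → D) : Prop where
  rot : ∀ t ≥ 0, HasDerivWithinAt (fun s => (Q s).1) (rotField n (B t) (Q t).1 (d t)) (Set.Ici 0) t
  vec : ∀ t ≥ 0, HasDerivWithinAt d (vecField n κ S (B t) (Q t).1 (d t)) (Set.Ici 0) t

/-- Uniformly bounded and uniformly detectable output maps. -/
structure IsDetectableOutput (S P : D →L[ℝ] D) (b b' c K : ℝ) (B B' : ℝ → D →L[ℝ] Vec3) :
    Prop where
  deriv : ∀ t ≥ 0, HasDerivWithinAt B (B' t) (Set.Ici 0) t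
  norm_le : ∀ t ≥ 0, ‖B t‖ ≤ b
  norm_deriv_le : ∀ t ≥ 0, ‖B' t‖ ≤ b'
  detect : ∀ t ≥ 0, ∀ d, c * ‖d‖ ^ 2 - K * ‖B t d‖ ^ 2
    ≤ inner ℝ (P (S d)) d + inner ℝ (P d) (S d)

/-- Orthogonality of both matrices rewrites the symmetric part as a sum of products, each with a
factor `A₁ - 1` or `A₂ - 1`. -/
lemma norm_add_transpose_sub_le (A₁ A₂ : SO3) {r : ℝ} (h₁ : ‖A₁.1 - 1‖ ≤ r) (h₂ : ‖A₂.1 - 1‖ ≤ r) :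
    ‖(A₁.1 - A₂.1) + (A₁.1 - A₂.1)ᵀ‖ ≤ 2 * r * ‖A₁.1 - A₂.1‖ := by
  have e : (A₁.1 - A₂.1) + (A₁.1 - A₂.1)ᵀ
      = -((A₁.1 - 1)ᵀ * (A₁.1 - A₂.1) + (A₁.1 - A₂.1)ᵀ * (A₂.1 - 1)) := by
    have e1 := SO3.transpose_mul A₁
    have e2 := SO3.transpose_mul A₂
    simp only [Matrix.transpose_sub, Matrix.sub_mul, Matrix.mul_sub, e1, e2, Matrix.transpose_one,
      Matrix.one_mul, Matrix.mul_one]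
    abel
  rw [e, norm_neg]
  refine (norm_add_le _ _).trans ?_
  have h3 := Matrix.frobenius_norm_mul (A₁.1 - 1)ᵀ (A₁.1 - A₂.1)
  have h4 := Matrix.frobenius_norm_mul (A₁.1 - A₂.1)ᵀ (A₂.1 - 1)
  rw [Matrix.frobenius_norm_transpose] at h3 h4
  have h5 := mul_le_mul_of_nonneg_right h₁ (norm_nonneg (A₁.1 - A₂.1))
  have h6 := mul_le_mul_of_nonneg_left h₂ (norm_nonneg (A₁.1 - A₂.1))
  linarith

/-- Near the identity the symmetric part of a difference of rotations is at most half of the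
difference, so the axial vector is a faithful coordinate. -/
lemma norm_sub_le_axial (A₁ A₂ : SO3) (h₁ : ‖A₁.1 - 1‖ ≤ 1 / 2) (h₂ : ‖A₂.1 - 1‖ ≤ 1 / 2) :
    ‖A₁.1 - A₂.1‖ ≤ 4 * ‖(1 / 2 : ℝ) • axial (A₁.1 - A₂.1)‖ := by
  have h := norm_add_transpose_sub_le A₁ A₂ h₁ h₂
  set X := A₁.1 - A₂.1 with hX
  have e : X = hatL ((1 / 2 : ℝ) • axial X) + (1 / 2 : ℝ) • (X + Xᵀ) := by
    rw [map_smul, hatL_axial]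
    module
  have h1 := norm_hatL_le ((1 / 2 : ℝ) • axial X)
  have h2 : ‖(1 / 2 : ℝ) • (X + Xᵀ)‖ = 1 / 2 * ‖X + Xᵀ‖ := by
    rw [norm_smul]
    norm_num
  have h3 := norm_add_le (hatL ((1 / 2 : ℝ) • axial X)) ((1 / 2 : ℝ) • (X + Xᵀ))
  rw [← e] at h3
  linarith

/-- An exact identity rather than a Taylor expansion: each term beyond the linear part is a
difference of the two states times a small factor `A₁ - 1`, `A₂ - 1` or `B d₂`. This is what makes
the estimate valid for pairs of trajectories. -/
lemma half_axial_rotField_sub (n : Fin 3 → ℝ) (B : D →L[ℝ] Vec3) (A₁ A₂ : Mat3) (d₁ d₂ : D) :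
    (1 / 2 : ℝ) • axial (rotField n B A₁ d₁ - rotField n B A₂ d₂)
      = -hess n ((1 / 2 : ℝ) • axial (A₁ - A₂)) - B (d₁ - d₂)
        + -((1 / 2 : ℝ) • axial ((A₁ - A₂) * Matrix.diagonal n * (A₁ - 1)
          + (A₂ - 1) * Matrix.diagonal n * (A₁ - A₂) + (A₁ - 1) * hatL (B (d₁ - d₂))
          + (A₁ - A₂) * hatL (B d₂))) := by
  have e : rotField n B A₁ d₁ - rotField n B A₂ d₂
      = -((A₁ - A₂) * Matrix.diagonal n + Matrix.diagonal n * (A₁ - A₂)) - hatL (B (d₁ - d₂))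
        - ((A₁ - A₂) * Matrix.diagonal n * (A₁ - 1)
          + (A₂ - 1) * Matrix.diagonal n * (A₁ - A₂) + (A₁ - 1) * hatL (B (d₁ - d₂))
          + (A₁ - A₂) * hatL (B d₂)) := by
    simp only [rotField, map_sub]
    noncomm_ring
  rw [e, map_sub, map_sub, map_neg, axial_mul_diagonal_add, axial_hatL, map_smul]
  module

lemma vecField_sub (n : Fin 3 → ℝ) (κ : ℝ) (S : D →L[ℝ] D) (B : D →L[ℝ] Vec3) (A₁ A₂ : Mat3)
    (d₁ d₂ : D) :
    vecField n κ S B A₁ d₁ - vecField n κ S B A₂ d₂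
      = S (d₁ - d₂) + κ • (ContinuousLinearMap.adjoint B) (hess n ((1 / 2 : ℝ) • axial (A₁ - A₂)))
        + κ • (ContinuousLinearMap.adjoint B)
          ((1 / 2 : ℝ) • axial (Matrix.diagonal n * ((A₁ - A₂) + (A₁ - A₂)ᵀ))) := by
  have e := axial_diagonal_mul n (A₁ - A₂)
  have e' : vecField n κ S B A₁ d₁ - vecField n κ S B A₂ d₂
      = S (d₁ - d₂) + κ • (ContinuousLinearMap.adjoint B)
        (axial (Matrix.diagonal n * (A₁ - A₂))) := by
    simp only [vecField, map_sub, Matrix.mul_sub]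
    module
  rw [e', e, map_add, map_smul]
  simp only [map_smul]
  module

-- The differences of two trajectories near the identity satisfy the linear system of
-- `le_pairFormDeriv` up to remainders of size `q r (‖e‖ + ‖d‖)`. Only `d₂` must be small, since it
-- alone multiplies the rotation difference. The signs of the weights play no role, so the bound
-- also serves saddles after translation.
set_option maxHeartbeats 1000000 in
lemma exists_pairForm_growth (n : Fin 3 → ℝ) (hn : ∀ i j, i ≠ j → n i + n j ≠ 0) {κ : ℝ}
    (hκ : 0 < κ) (S P : D →L[ℝ] D) (hS : ∀ d, inner ℝ d (S d) = 0) {b b' c K : ℝ}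
    (hb : 0 ≤ b) (hc : 0 < c) (hK : 0 ≤ K) :
    ∃ Mb : ℝ, ∀ M₀ ≥ Mb, ∃ r > 0, ∀ B B' : ℝ → D →L[ℝ] Vec3, IsDetectableOutput S P b b' c K B B' →
      ∀ (A₁ A₂ : ℝ → SO3) (d₁ d₂ : ℝ → D), IsErrTraj n κ S B A₁ d₁ → IsErrTraj n κ S B A₂ d₂ →
      ∀ t ≥ 0, ‖(A₁ t).1 - 1‖ ≤ r → ‖(A₂ t).1 - 1‖ ≤ r → ‖d₂ t‖ ≤ r →
        ∃ w, HasDerivWithinAt (fun s => pairForm (hess n) P κ M₀ K (B s)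
            ((1 / 2 : ℝ) • axial ((A₁ s).1 - (A₂ s).1)) (d₁ s - d₂ s)) w (Set.Ici 0) t ∧
          c / 4 * (‖(1 / 2 : ℝ) • axial ((A₁ t).1 - (A₂ t).1)‖ ^ 2 + ‖d₁ t - d₂ t‖ ^ 2) ≤ w := by
  obtain ⟨h, hh, hHinv⟩ : ∃ h > 0, ∀ e, h * ‖e‖ ≤ ‖hess n e‖ := by
    have h12 := abs_pos.mpr (hn 1 2 (by decide))
    have h20 := abs_pos.mpr (hn 2 0 (by decide))
    have h01 := abs_pos.mpr (hn 0 1 (by decide))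
    refine ⟨min |n 1 + n 2| (min |n 2 + n 0| |n 0 + n 1|),
      lt_min h12 (lt_min h20 h01), fun e => ?_⟩
    set h := min |n 1 + n 2| (min |n 2 + n 0| |n 0 + n 1|) with hdef
    have hpos : 0 < h := lt_min h12 (lt_min h20 h01)
    have k1 : h ^ 2 ≤ (n 1 + n 2) ^ 2 := by
      rw [← sq_abs (n 1 + n 2)]
      exact pow_le_pow_left₀ hpos.le (min_le_left _ _) 2
    have k2 : h ^ 2 ≤ (n 2 + n 0) ^ 2 := by
      rw [← sq_abs (n 2 + n 0)]
      exact pow_le_pow_left₀ hpos.le ((min_le_right _ _).trans (min_le_left _ _)) 2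
    have k3 : h ^ 2 ≤ (n 0 + n 1) ^ 2 := by
      rw [← sq_abs (n 0 + n 1)]
      exact pow_le_pow_left₀ hpos.le ((min_le_right _ _).trans (min_le_right _ _)) 2
    refine le_of_sq_le_sq ?_ (norm_nonneg _)
    rw [mul_pow, norm_vec3_sq, norm_vec3_sq, hess_apply]
    simp only [Matrix.cons_val]
    nlinarith [mul_le_mul_of_nonneg_right k1 (sq_nonneg (e 0)),
      mul_le_mul_of_nonneg_right k2 (sq_nonneg (e 1)),
      mul_le_mul_of_nonneg_right k3 (sq_nonneg (e 2))]
  obtain ⟨Mb, hMb⟩ := le_pairFormDeriv (hess n) S P hS hκ hh hb hc hK hHinv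
  refine ⟨Mb, fun M₀ hM₀ => ?_⟩
  obtain ⟨θ, hθ, H⟩ := hMb M₀ hM₀
  set k := ‖(Matrix.diagonal n : Mat3)‖ with hk
  have hk0 : 0 ≤ k := norm_nonneg _
  set q := 8 * k + 10 * b + 8 * κ * b * k with hq
  have hq0 : 0 ≤ q := by positivity
  -- The bound `1/2` makes the axial coordinate faithful; the other one brings the remainders below
  -- the tolerance `θ`.
  refine ⟨min (1 / 2) (θ / (q + 1)), by positivity, ?_⟩
  intro B B' hB A₁ A₂ d₁ d₂ T₁ T₂ t ht h₁ h₂ h₃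
  set r := min (1 / 2) (θ / (q + 1)) with hr
  have hr0 : 0 ≤ r := by positivity
  have hr2 : r ≤ 1 / 2 := min_le_left _ _
  have hrq : q * r ≤ θ := by
    have : r * (q + 1) ≤ θ := by
      rw [← le_div_iff₀ (by positivity)]
      exact min_le_right _ _
    linarith
  have hX := norm_sub_le_axial (A₁ t) (A₂ t) (h₁.trans hr2) (h₂.trans hr2)
  have hZ := norm_add_transpose_sub_le (A₁ t) (A₂ t) h₁ h₂
  have hde : HasDerivWithinAt (fun s => (1 / 2 : ℝ) • axial ((A₁ s).1 - (A₂ s).1))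
      ((1 / 2 : ℝ) • axial (rotField n (B t) (A₁ t).1 (d₁ t) - rotField n (B t) (A₂ t).1 (d₂ t)))
      (Set.Ici 0) t :=
    HasDerivWithinAt.fun_const_smul (1 / 2 : ℝ)
      ((axial.hasFDerivAt).comp_hasDerivWithinAt t ((T₁.rot t ht).fun_sub (T₂.rot t ht)))
  have hdd := (T₁.vec t ht).sub (T₂.vec t ht)
  rw [half_axial_rotField_sub] at hde
  rw [vecField_sub] at hdd
  refine ⟨_, hasDerivWithinAt_pairForm (hess n) (hess_symm n) P κ M₀ K (hB.deriv t ht) hde hdd, ?_⟩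
  set e := (1 / 2 : ℝ) • axial ((A₁ t).1 - (A₂ t).1) with he
  set X := (A₁ t).1 - (A₂ t).1 with hXdef
  set d := d₁ t - d₂ t with hd
  have hBn : ∀ z, ‖B t z‖ ≤ b * ‖z‖ := fun z => (B t).le_of_opNorm_le (hB.norm_le t ht) z
  have half : ∀ M : Mat3, ‖(1 / 2 : ℝ) • axial M‖ ≤ ‖M‖ := fun M => by
    rw [norm_smul]
    have := norm_axial_le M
    norm_num
    linarith
  have x0 := norm_nonneg X
  have e0 := norm_nonneg e
  have d0 := norm_nonneg d
  have hR : q * r * (‖e‖ + ‖d‖) ≤ θ * (‖e‖ + ‖d‖) :=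
    mul_le_mul_of_nonneg_right hrq (by positivity)
  refine H (B t) (B' t) (hB.norm_le t ht) (hB.norm_deriv_le t ht) (hB.detect t ht) e _ d _ ?_ ?_
  · rw [norm_neg]
    refine (half _).trans (le_trans ?_ hR)
    have t1 : ‖X * Matrix.diagonal n * ((A₁ t).1 - 1)‖ ≤ 4 * ‖e‖ * k * r :=
      (Matrix.frobenius_norm_mul _ _).trans (mul_le_mul ((Matrix.frobenius_norm_mul _ _).trans
        (mul_le_mul_of_nonneg_right hX hk0)) h₁ (norm_nonneg _) (by positivity))
    have t2 : ‖((A₂ t).1 - 1) * Matrix.diagonal n * X‖ ≤ r * k * (4 * ‖e‖) :=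
      (Matrix.frobenius_norm_mul _ _).trans (mul_le_mul ((Matrix.frobenius_norm_mul _ _).trans
        (mul_le_mul_of_nonneg_right h₂ hk0)) hX (norm_nonneg _) (by positivity))
    have t3 : ‖((A₁ t).1 - 1) * hatL (B t d)‖ ≤ r * (2 * (b * ‖d‖)) :=
      (Matrix.frobenius_norm_mul _ _).trans (mul_le_mul h₁ ((norm_hatL_le _).trans
        (mul_le_mul_of_nonneg_left (hBn d) zero_le_two)) (norm_nonneg _) hr0)
    have t4 : ‖X * hatL (B t (d₂ t))‖ ≤ 4 * ‖e‖ * (2 * (b * r)) :=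
      (Matrix.frobenius_norm_mul _ _).trans (mul_le_mul hX ((norm_hatL_le _).trans
        (mul_le_mul_of_nonneg_left ((hBn _).trans (mul_le_mul_of_nonneg_left h₃ hb)) zero_le_two))
          (norm_nonneg _) (by positivity))
    refine (norm_add_le _ _).trans ?_
    have s1 := norm_add_le (X * Matrix.diagonal n * ((A₁ t).1 - 1)
      + ((A₂ t).1 - 1) * Matrix.diagonal n * X) (((A₁ t).1 - 1) * hatL (B t d))
    have s2 := norm_add_le (X * Matrix.diagonal n * ((A₁ t).1 - 1))
      (((A₂ t).1 - 1) * Matrix.diagonal n * X)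
    have p1 : 0 ≤ b * r * ‖e‖ := by positivity
    have p2 : 0 ≤ b * r * ‖d‖ := by positivity
    have p3 : 0 ≤ k * r * ‖d‖ := by positivity
    have p4 : 0 ≤ κ * b * k * r * (‖e‖ + ‖d‖) := by positivity
    rw [hq]
    linarith only [t1, t2, t3, t4, s1, s2, p1, p2, p3, p4]
  · refine le_trans ?_ hR
    rw [norm_smul, Real.norm_eq_abs, abs_of_pos hκ]
    have t1 : ‖Matrix.diagonal n * (X + Xᵀ)‖ ≤ k * (2 * r * (4 * ‖e‖)) :=
      (Matrix.frobenius_norm_mul _ _).trans (mul_le_mul_of_nonneg_left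
        (hZ.trans (mul_le_mul_of_nonneg_left hX (by positivity))) hk0)
    have t2 := (ContinuousLinearMap.adjoint (B t)).le_of_opNorm_le
      (by simpa using hB.norm_le t ht) ((1 / 2 : ℝ) • axial (Matrix.diagonal n * (X + Xᵀ)))
    have t3 := mul_le_mul_of_nonneg_left (t2.trans (mul_le_mul_of_nonneg_left
      ((half _).trans t1) hb)) hκ.le
    have p1 : 0 ≤ b * r * (‖e‖ + ‖d‖) := by positivity
    have p3 : 0 ≤ k * r * (‖e‖ + ‖d‖) := by positivity
    have p4 : 0 ≤ κ * b * k * r * ‖d‖ := by positivity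
    rw [hq]
    linarith only [t3, p1, p3, p4]

end ErrorSystem

/-! ### Scalar differential inequalities on `[0, ∞)` -/

/-- The derivative is assumed to exist pointwise, and only on the given interval, because the growth
of `pairForm` is available only while trajectories stay close to an equilibrium. -/
lemma mul_sub_le_of_exists_deriv {f : ℝ → ℝ} {c a b : ℝ} (ha : 0 ≤ a) (hab : a ≤ b)
    (hf : ∀ t, a ≤ t → t ≤ b → ∃ w, HasDerivWithinAt f w (Set.Ici 0) t ∧ c ≤ w) :
    c * (b - a) ≤ f b - f a := by
  have hcont : ContinuousOn f (Set.Icc a b) := fun t ht => by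
    obtain ⟨w, hw, -⟩ := hf t ht.1 ht.2
    exact hw.continuousWithinAt.mono fun s hs => ha.trans hs.1
  have hd : ∀ t ∈ Set.Ioo a b, ∃ w, HasDerivAt f w t ∧ c ≤ w := fun t ht => by
    obtain ⟨w, hw, hc⟩ := hf t ht.1.le ht.2.le
    exact ⟨w, hw.hasDerivAt (Ici_mem_nhds (ha.trans_lt ht.1)), hc⟩
  refine (convex_Icc a b).mul_sub_le_image_sub_of_le_deriv hcont ?_ ?_ a
    (Set.left_mem_Icc.mpr hab) b (Set.right_mem_Icc.mpr hab) hab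
  · rw [interior_Icc]
    intro t ht
    obtain ⟨w, hw, -⟩ := hd t ht
    exact hw.differentiableAt.differentiableWithinAt
  · rw [interior_Icc]
    intro t ht
    obtain ⟨w, hw, hc⟩ := hd t ht
    rwa [hw.deriv]

lemma mul_sub_le_of_le_deriv {f f' : ℝ → ℝ}
    (hf : ∀ t ≥ 0, HasDerivWithinAt f (f' t) (Set.Ici 0) t) {c a b : ℝ} (ha : 0 ≤ a) (hab : a ≤ b)
    (hc : ∀ t, a ≤ t → t ≤ b → c ≤ f' t) : c * (b - a) ≤ f b - f a :=
  mul_sub_le_of_exists_deriv ha hab fun t h1 h2 => ⟨f' t, hf t (ha.trans h1), hc t h1 h2⟩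

lemma sub_le_mul_of_deriv_le {f f' : ℝ → ℝ}
    (hf : ∀ t ≥ 0, HasDerivWithinAt f (f' t) (Set.Ici 0) t) {c a b : ℝ} (ha : 0 ≤ a) (hab : a ≤ b)
    (hc : ∀ t, a ≤ t → t ≤ b → f' t ≤ c) : f b - f a ≤ c * (b - a) := by
  have := mul_sub_le_of_le_deriv (f := fun t => -f t) (fun t ht => (hf t ht).fun_neg) (c := -c) ha
    hab (fun t h1 h2 => neg_le_neg (hc t h1 h2))
  linarith

/-- Barbalat's lemma: if `W` is bounded above and grows at least at the rate `f ≥ 0`, where `f`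
cannot decrease faster than at rate `L`, then `f → 0`. -/
lemma tendsto_zero_of_le_deriv {W W' f f' : ℝ → ℝ} {T L M : ℝ} (hT : 0 ≤ T) (hL : 0 ≤ L)
    (hW : ∀ t ≥ 0, HasDerivWithinAt W (W' t) (Set.Ici 0) t)
    (hf : ∀ t ≥ 0, HasDerivWithinAt f (f' t) (Set.Ici 0) t)
    (hf0 : ∀ t ≥ T, 0 ≤ f t) (hfL : ∀ t ≥ T, -L ≤ f' t)
    (hWf : ∀ t ≥ T, f t ≤ W' t) (hM : ∀ t ≥ T, W t ≤ M) : Tendsto f atTop (𝓝 0) := by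
  -- Freezing `W` before time `T` makes it monotone on the whole line, so it converges to its
  -- supremum.
  have hmono : Monotone fun t => W (max T t) := by
    intro s t hst
    have := mul_sub_le_of_le_deriv hW (hT.trans (le_max_left T s)) (max_le_max_left T hst) (c := 0)
      (fun τ h1 _ => (hf0 τ ((le_max_left _ _).trans h1)).trans (hWf τ ((le_max_left _ _).trans h1)))
    simp only
    linarith
  have hlim := tendsto_atTop_ciSup hmono ⟨M, by rintro _ ⟨t, rfl⟩; exact hM _ (le_max_left _ _)⟩
  set w := ⨆ t, W (max T t)
  rw [Metric.tendsto_atTop]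
  intro ε hε
  -- If `f t ≥ ε`, then `f ≥ ε/2` throughout a window of length `a`, so `W` gains at least `a ε/2`
  -- there; this is impossible once `W` has nearly converged.
  set a := ε / (2 * (L + 1)) with ha
  have ha0 : 0 < a := by positivity
  have hLa : L * a ≤ ε / 2 := by
    rw [ha, ← mul_div_assoc, div_le_div_iff₀ (by positivity) (by positivity)]
    nlinarith
  have hdiff : Tendsto (fun t => W (max T (t + a)) - W (max T t)) atTop (𝓝 0) := by
    have := (hlim.comp (tendsto_atTop_add_const_right atTop a tendsto_id)).sub hlim
    simpa using this
  have hev := hdiff.eventually (gt_mem_nhds (show 0 < a * (ε / 2) by positivity))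
  obtain ⟨N, hN⟩ := (hev.and (eventually_ge_atTop T)).exists_forall_of_atTop
  refine ⟨N, fun t ht => ?_⟩
  obtain ⟨h1, h2⟩ := hN t ht
  rw [max_eq_right h2, max_eq_right (by linarith)] at h1
  have h3 : (f t - L * a) * ((t + a) - t) ≤ W (t + a) - W t := by
    refine mul_sub_le_of_le_deriv hW (hT.trans h2) (by linarith) (fun τ h4 h5 => ?_)
    have h6 := mul_sub_le_of_le_deriv hf (hT.trans h2) h4 (c := -L)
      (fun s h7 _ => hfL s (h2.trans h7))
    have h8 := hWf τ (h2.trans h4)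
    nlinarith
  have h4 : f t < ε := by
    by_contra hcon
    push Not at hcon
    have : ε / 2 * a ≤ (f t - L * a) * ((t + a) - t) := by
      rw [add_sub_cancel_left]
      exact mul_le_mul_of_nonneg_right (by linarith) ha0.le
    linarith
  rw [Real.dist_eq, sub_zero, abs_of_nonneg (hf0 t h2)]
  exact h4

lemma le_mul_exp_of_deriv_le {f f' : ℝ → ℝ}
    (hf : ∀ t ≥ 0, HasDerivWithinAt f (f' t) (Set.Ici 0) t) {a : ℝ}
    (h : ∀ t ≥ 0, f' t ≤ a * f t) {t : ℝ} (ht : 0 ≤ t) : f t ≤ f 0 * Real.exp (a * t) := by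
  have hexp : ∀ τ : ℝ, HasDerivAt (fun s => Real.exp (-a * s)) (Real.exp (-a * τ) * -a) τ :=
    fun τ => by
      have := ((hasDerivAt_id τ).const_mul (-a)).exp
      simpa using this
  have hg : ∀ τ ≥ 0, HasDerivWithinAt (fun s => f s * Real.exp (-a * s))
      (f' τ * Real.exp (-a * τ) + f τ * (Real.exp (-a * τ) * -a)) (Set.Ici 0) τ := fun τ hτ =>
    (hf τ hτ).mul (hexp τ).hasDerivWithinAt
  have := sub_le_mul_of_deriv_le hg le_rfl ht (c := 0) (fun τ h1 _ => by
    have h2 := h τ h1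
    have h3 := Real.exp_pos (-a * τ)
    nlinarith [mul_le_mul_of_nonneg_right h2 h3.le])
  have h2 : f t * Real.exp (-a * t) ≤ f 0 := by simpa using this
  have h3 : f t = f t * Real.exp (-a * t) * Real.exp (a * t) := by
    rw [mul_assoc, ← Real.exp_add]
    simp
  rw [h3]
  exact mul_le_mul_of_nonneg_right h2 (Real.exp_pos _).le

lemma le_mul_exp_of_neg_le_deriv {f f' : ℝ → ℝ}
    (hf : ∀ t ≥ 0, HasDerivWithinAt f (f' t) (Set.Ici 0) t) {a : ℝ}
    (h : ∀ t ≥ 0, -a * f t ≤ f' t) {t : ℝ} (ht : 0 ≤ t) : f 0 ≤ f t * Real.exp (a * t) := by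
  have := le_mul_exp_of_deriv_le (f := fun t => -f t) (fun t ht => (hf t ht).fun_neg) (a := -a)
    (fun t ht => by linarith [h t ht]) ht
  have h2 : f 0 * Real.exp (-a * t) ≤ f t := by linarith
  have h3 : f 0 = f 0 * Real.exp (-a * t) * Real.exp (a * t) := by
    rw [mul_assoc, ← Real.exp_add]
    simp
  rw [h3]
  exact mul_le_mul_of_nonneg_right h2 (Real.exp_pos _).le

/-! ### Bounds on the quadratic form -/

section PairForm

variable {D : Type*} [NormedAddCommGroup D] [InnerProductSpace ℝ D]

/-- The eigenvalues of `hess n`. -/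
def hessCoef (n : Fin 3 → ℝ) : Fin 3 → ℝ := ![n 1 + n 2, n 2 + n 0, n 0 + n 1]

lemma inner_hess_self (n : Fin 3 → ℝ) (e : Vec3) :
    inner ℝ (hess n e) e = ∑ k, hessCoef n k * e k ^ 2 := by
  rw [inner_vec3, hess_apply, Fin.sum_univ_three]
  simp [hessCoef]
  ring

/-- This part of the form has no definite sign, but its bound does not depend on `M₀`; a large `M₀`
therefore lets the energy part decide the sign. -/
lemma abs_cross_le {b : ℝ} (P : D →L[ℝ] D) {M₁ : ℝ} (hM₁ : 0 ≤ M₁) (B : D →L[ℝ] Vec3)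
    (hB : ‖B‖ ≤ b) (e : Vec3) (d : D) :
    |-(M₁ * inner ℝ e (B d)) + inner ℝ (P d) d| ≤ (M₁ * b + ‖P‖) * (‖e‖ ^ 2 + ‖d‖ ^ 2) := by
  have hb : 0 ≤ b := (norm_nonneg _).trans hB
  have h1 := abs_inner_le_of_norm_le e (B d) _ _ le_rfl (B.le_of_opNorm_le hB d)
  have h2 := abs_inner_le_of_norm_le (P d) d _ _ (P.le_opNorm d) le_rfl
  have h3 : ‖e‖ * (b * ‖d‖) ≤ b * (‖e‖ ^ 2 + ‖d‖ ^ 2) := by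
    nlinarith [mul_nonneg hb (sq_nonneg (‖e‖ - ‖d‖)), mul_nonneg hb (sq_nonneg ‖e‖),
      mul_nonneg hb (sq_nonneg ‖d‖)]
  have h4 := mul_le_mul_of_nonneg_left (h1.trans h3) hM₁
  have h5 : 0 ≤ ‖P‖ * ‖e‖ ^ 2 := by positivity
  refine (abs_add_le _ _).trans ?_
  rw [abs_neg, abs_mul, abs_of_nonneg hM₁]
  nlinarith

lemma abs_pairForm_le (n : Fin 3 → ℝ) (P : D →L[ℝ] D) {κ M₀ M₁ b : ℝ} (hκ : 0 < κ) (hM₀ : 0 ≤ M₀)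
    (hM₁ : 0 ≤ M₁) (B : D →L[ℝ] Vec3) (hB : ‖B‖ ≤ b) (e : Vec3) (d : D) :
    |pairForm (hess n) P κ M₀ M₁ B e d|
      ≤ (M₀ / 2 * (‖hess n‖ + 1 / κ) + (M₁ * b + ‖P‖)) * (‖e‖ ^ 2 + ‖d‖ ^ 2) := by
  have h1 := abs_cross_le P hM₁ B hB e d
  have h2 := abs_inner_le_of_norm_le (hess n e) e _ _ ((hess n).le_opNorm e) le_rfl
  have h3 : |inner ℝ (hess n e) e + ‖d‖ ^ 2 / κ| ≤ (‖hess n‖ + 1 / κ) * (‖e‖ ^ 2 + ‖d‖ ^ 2) := by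
    refine (abs_add_le _ _).trans ?_
    rw [abs_of_nonneg (show 0 ≤ ‖d‖ ^ 2 / κ by positivity)]
    have : 0 ≤ ‖hess n‖ * ‖d‖ ^ 2 + ‖e‖ ^ 2 / κ := by positivity
    have e1 : (‖hess n‖ + 1 / κ) * (‖e‖ ^ 2 + ‖d‖ ^ 2) = ‖hess n‖ * ‖e‖ * ‖e‖ + ‖d‖ ^ 2 / κ
      + (‖hess n‖ * ‖d‖ ^ 2 + ‖e‖ ^ 2 / κ) := by ring
    linarith
  have h4 := mul_le_mul_of_nonneg_left h3 (show 0 ≤ M₀ / 2 by positivity)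
  have e1 : pairForm (hess n) P κ M₀ M₁ B e d = -(M₀ / 2 * (inner ℝ (hess n e) e + ‖d‖ ^ 2 / κ))
      + (-(M₁ * inner ℝ e (B d)) + inner ℝ (P d) d) := by
    rw [pairForm]
    ring
  rw [e1]
  refine (abs_add_le _ _).trans ?_
  rw [abs_neg, abs_mul, abs_of_nonneg (show 0 ≤ M₀ / 2 by positivity)]
  linarith

lemma exists_pairForm_le_neg (n : Fin 3 → ℝ) (hn : ∀ i, 0 < hessCoef n i) (P : D →L[ℝ] D)
    {κ M₁ b : ℝ} (hκ : 0 < κ) (hM₁ : 0 ≤ M₁) (hb : 0 ≤ b) :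
    ∃ Mb : ℝ, ∀ M₀ ≥ Mb, ∀ B : D →L[ℝ] Vec3, ‖B‖ ≤ b → ∀ (e : Vec3) (d : D),
      pairForm (hess n) P κ M₀ M₁ B e d ≤ -(‖e‖ ^ 2 + ‖d‖ ^ 2) := by
  set h := min (min (hessCoef n 0) (hessCoef n 1)) (min (hessCoef n 2) (1 / κ)) with hh
  have hpos : 0 < h := lt_min (lt_min (hn 0) (hn 1)) (lt_min (hn 2) (by positivity))
  refine ⟨2 * (M₁ * b + ‖P‖ + 1) / h, fun M₀ hM B hB e d => ?_⟩
  rw [ge_iff_le, div_le_iff₀ hpos] at hM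
  have hM0 : 0 ≤ M₀ := by
    by_contra hcon
    push Not at hcon
    have : 0 ≤ 2 * (M₁ * b + ‖P‖ + 1) := by positivity
    nlinarith
  have h1 := (abs_le.mp (abs_cross_le P hM₁ B hB e d)).2
  have h2 : h * (‖e‖ ^ 2 + ‖d‖ ^ 2) ≤ inner ℝ (hess n e) e + ‖d‖ ^ 2 / κ := by
    rw [inner_hess_self, norm_vec3_sq, Fin.sum_univ_three]
    have k0 : h ≤ hessCoef n 0 := (min_le_left _ _).trans (min_le_left _ _)
    have k1 : h ≤ hessCoef n 1 := (min_le_left _ _).trans (min_le_right _ _)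
    have k2 : h ≤ hessCoef n 2 := (min_le_right _ _).trans (min_le_left _ _)
    have k3 : h ≤ 1 / κ := (min_le_right _ _).trans (min_le_right _ _)
    have e1 : ‖d‖ ^ 2 / κ = 1 / κ * ‖d‖ ^ 2 := by ring
    rw [e1]
    linarith [mul_le_mul_of_nonneg_right k0 (sq_nonneg (e 0)),
      mul_le_mul_of_nonneg_right k1 (sq_nonneg (e 1)),
      mul_le_mul_of_nonneg_right k2 (sq_nonneg (e 2)),
      mul_le_mul_of_nonneg_right k3 (sq_nonneg ‖d‖)]
  have h3 := mul_le_mul_of_nonneg_left h2 (show 0 ≤ M₀ / 2 by positivity)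
  have h4 := mul_le_mul_of_nonneg_right hM (show 0 ≤ ‖e‖ ^ 2 + ‖d‖ ^ 2 by positivity)
  rw [pairForm]
  linarith

/-- Along an unstable direction the energy part of the form is positive and, for large `M₀`,
outweighs the cross terms. A nonpositive value therefore forces that coordinate to be dominated by
the others. -/
lemma exists_le_of_pairForm_nonpos (n : Fin 3 → ℝ) (i : Fin 3) (hn : hessCoef n i < 0)
    (P : D →L[ℝ] D) {κ M₁ b : ℝ} (hκ : 0 < κ) (hM₁ : 0 ≤ M₁) (hb : 0 ≤ b) :
    ∃ Mb : ℝ, ∀ M₀ ≥ Mb, ∃ C > 0, ∀ B : D →L[ℝ] Vec3, ‖B‖ ≤ b → ∀ (e : Vec3) (d : D),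
      pairForm (hess n) P κ M₀ M₁ B e d ≤ 0 →
        ‖e‖ ^ 2 + ‖d‖ ^ 2 ≤ C * ((‖e‖ ^ 2 - e i ^ 2) + ‖d‖ ^ 2) := by
  set h := -hessCoef n i with hh
  have hpos : 0 < h := by linarith
  set m := M₁ * b + ‖P‖ with hm
  have hm0 : 0 ≤ m := by positivity
  refine ⟨2 * (m + 1) / h, fun M₀ hM => ?_⟩
  rw [ge_iff_le, div_le_iff₀ hpos] at hM
  have hM0 : 0 ≤ M₀ := by
    by_contra hcon
    push Not at hcon
    nlinarith
  set Hm := ∑ k, |hessCoef n k| with hHm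
  have hHm0 : 0 ≤ Hm := by positivity
  refine ⟨M₀ / 2 * (Hm + 1 / κ) + m + 1, by positivity, fun B hB e d hle => ?_⟩
  have h1 := (abs_le.mp (abs_cross_le P hM₁ B hB e d)).1
  have hs : ‖e‖ ^ 2 = ∑ k, e k ^ 2 := by
    rw [EuclideanSpace.norm_sq_eq]
    simp
  have h2 : inner ℝ (hess n e) e ≤ -h * e i ^ 2 + Hm * (‖e‖ ^ 2 - e i ^ 2) := by
    rw [inner_hess_self, hs, ← Finset.add_sum_erase _ _ (Finset.mem_univ i),
      ← Finset.add_sum_erase _ (fun k => e k ^ 2) (Finset.mem_univ i), add_sub_cancel_left, hh,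
      neg_neg, Finset.mul_sum]
    gcongr with k hk
    exact (le_abs_self _).trans
      (Finset.single_le_sum (f := fun k => |hessCoef n k|) (fun _ _ => abs_nonneg _)
        (Finset.mem_univ k))
  have hq : 0 ≤ ‖e‖ ^ 2 - e i ^ 2 := by
    rw [hs, ← Finset.add_sum_erase _ _ (Finset.mem_univ i), add_sub_cancel_left]
    positivity
  have h3 := mul_le_mul_of_nonneg_left h2 (show 0 ≤ M₀ / 2 by positivity)
  have h4 := mul_le_mul_of_nonneg_right hM (sq_nonneg (e i))
  have p1 : 0 ≤ M₀ / 2 * Hm * ‖d‖ ^ 2 := by positivity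
  have p2 : 0 ≤ M₀ / 2 * (1 / κ) * (‖e‖ ^ 2 - e i ^ 2) := by positivity
  rw [pairForm] at hle
  have e1 : M₀ / 2 * (‖d‖ ^ 2 / κ) = M₀ / 2 * (1 / κ) * ‖d‖ ^ 2 := by ring
  linarith

end PairForm

/-! ### Rotations and the critical points of the error energy -/

lemma dist_SO3 (Q R : SO3) : dist Q R = ‖Q.1 - R.1‖ := by
  rw [Subtype.dist_eq, dist_eq_norm]

instance : CompactSpace SO3 := by
  refine isCompact_iff_compactSpace.mp (Metric.isCompact_of_isClosed_isBounded ?_ ?_)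
  · have e : (Matrix.specialOrthogonalGroup (Fin 3) ℝ : Set Mat3)
        = {M | M * Mᵀ = 1} ∩ {M | M.det = 1} := by
      ext M
      exact mem_SO3_iff M
    rw [e]
    refine IsClosed.inter (isClosed_eq ?_ continuous_const) (isClosed_eq ?_ continuous_const)
    · exact continuous_id.matrix_mul continuous_id.matrix_transpose
    · exact continuous_id.matrix_det
  · refine (Metric.isBounded_closedBall (x := (0 : Mat3)) (r := 2)).subset fun M hM => ?_
    rw [mem_closedBall_zero_iff]
    exact norm_SO3_le ⟨M, hM⟩

lemma norm_SO3_sub_one_sq (Q : SO3) : ‖Q.1 - 1‖ ^ 2 = 2 * ∑ i, (1 - Q.1 i i) := by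
  have h := SO3.transpose_mul Q
  rw [frobenius_norm_sq_eq_trace]
  have e : (Q.1 - 1)ᵀ * (Q.1 - 1) = 1 - Q.1ᵀ - Q.1 + 1 := by
    simp only [Matrix.transpose_sub, Matrix.sub_mul, Matrix.mul_sub, h, Matrix.transpose_one,
      Matrix.one_mul, Matrix.mul_one]
    abel
  rw [e]
  simp [Matrix.trace_sub, Matrix.trace_add, Matrix.trace_transpose]
  simp [Matrix.trace, Fin.sum_univ_three]
  ring

lemma SO3.apply_self_le_one (Q : SO3) (i : Fin 3) : Q.1 i i ≤ 1 := by
  have h := congrFun (congrFun (SO3.mul_transpose Q) i) i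
  simp only [Matrix.mul_apply, Matrix.transpose_apply, Matrix.one_apply_eq] at h
  have h2 : Q.1 i i * Q.1 i i ≤ ∑ j, Q.1 i j * Q.1 i j :=
    Finset.single_le_sum (f := fun j => Q.1 i j * Q.1 i j) (fun j _ => mul_self_nonneg _)
      (Finset.mem_univ i)
  nlinarith

lemma SO3.adjugate_eq (Q : SO3) : Q.1.adjugate = Q.1ᵀ := by
  have h := Matrix.adjugate_mul Q.1
  rw [SO3.det_eq, one_smul] at h
  calc Q.1.adjugate = Q.1.adjugate * (Q.1 * Q.1ᵀ) := by rw [SO3.mul_transpose, Matrix.mul_one]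
    _ = Q.1ᵀ := by rw [← Matrix.mul_assoc, h, Matrix.one_mul]

/-- For axis `u` and angle `θ` one has `1 - Q i i = (1 - cos θ)(1 - u i ^ 2)`, so each inequality
amounts to `-u i ^ 2 ≤ u i ^ 2`. The algebraic proof uses sums of squares and the equality of
adjugate and transpose. -/
lemma SO3.one_sub_apply_le (Q : SO3) :
    1 - Q.1 0 0 ≤ (1 - Q.1 1 1) + (1 - Q.1 2 2) ∧ 1 - Q.1 1 1 ≤ (1 - Q.1 0 0) + (1 - Q.1 2 2) ∧
      1 - Q.1 2 2 ≤ (1 - Q.1 0 0) + (1 - Q.1 1 1) := by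
  have h := norm_SO3_sub_one_sq Q
  rw [frobenius_norm_sq] at h
  have ha := SO3.adjugate_eq Q
  have h0 := congrFun (congrFun ha 0) 0
  have h1 := congrFun (congrFun ha 1) 1
  have h2 := congrFun (congrFun ha 2) 2
  rw [Matrix.adjugate_fin_three] at h0 h1 h2
  simp [Fin.sum_univ_three] at h h0 h1 h2
  refine ⟨?_, ?_, ?_⟩
  · nlinarith [sq_nonneg (1 + Q.1 0 0 - Q.1 1 1 - Q.1 2 2), sq_nonneg (Q.1 0 1 + Q.1 1 0),
      sq_nonneg (Q.1 0 2 + Q.1 2 0), sq_nonneg (Q.1 1 2 - Q.1 2 1)]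
  · nlinarith [sq_nonneg (1 + Q.1 1 1 - Q.1 0 0 - Q.1 2 2), sq_nonneg (Q.1 0 1 + Q.1 1 0),
      sq_nonneg (Q.1 1 2 + Q.1 2 1), sq_nonneg (Q.1 0 2 - Q.1 2 0)]
  · nlinarith [sq_nonneg (1 + Q.1 2 2 - Q.1 0 0 - Q.1 1 1), sq_nonneg (Q.1 0 2 + Q.1 2 0),
      sq_nonneg (Q.1 1 2 + Q.1 2 1), sq_nonneg (Q.1 0 1 - Q.1 1 0)]

/-- Symmetric products `diag l * Q` occur only for diagonal rotations. -/
lemma SO3.eq_diagonal_of_axial_eq_zero {l : Fin 3 → ℝ} (hl : ∀ i, 0 ≤ l i)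
    (hinj : Function.Injective l) (Q : SO3) (h : axial (Matrix.diagonal l * Q.1) = 0) :
    ∃ s : Fin 3 → ℝ, (∀ i, s i ^ 2 = 1) ∧ Q.1 = Matrix.diagonal s := by
  have hsym : Matrix.diagonal l * Q.1 = (Matrix.diagonal l * Q.1)ᵀ := by
    have := hatL_axial (Matrix.diagonal l * Q.1)
    rw [h, map_zero] at this
    exact (sub_eq_zero.mp this.symm)
  -- A symmetric `Λ Q` satisfies `(Λ Q)² = Λ Q Qᵀ Λ = Λ²`. Hence it commutes with `Λ²`, whose
  -- entries are distinct, and must be diagonal.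
  have hsq : (Matrix.diagonal l * Q.1) * (Matrix.diagonal l * Q.1)
      = Matrix.diagonal l * Matrix.diagonal l := by
    conv_lhs => rw [hsym]
    rw [← hsym]
    conv_lhs => enter [2]; rw [hsym]
    rw [Matrix.transpose_mul, Matrix.diagonal_transpose, Matrix.mul_assoc,
      ← Matrix.mul_assoc Q.1 Q.1ᵀ, SO3.mul_transpose, Matrix.one_mul]
  have hcomm : (Matrix.diagonal l * Q.1) * (Matrix.diagonal l * Matrix.diagonal l)
      = (Matrix.diagonal l * Matrix.diagonal l) * (Matrix.diagonal l * Q.1) := by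
    rw [← hsq]
    simp only [Matrix.mul_assoc]
  have hoff : ∀ i j, i ≠ j → l i * Q.1 i j = 0 := by
    intro i j hij
    have h1 := congrFun (congrFun hcomm i) j
    simp only [Matrix.diagonal_mul_diagonal, Matrix.mul_diagonal, Matrix.diagonal_mul] at h1
    have h2 : (l i * Q.1 i j) * ((l j - l i) * (l j + l i)) = 0 := by linarith
    rcases mul_eq_zero.mp h2 with h3 | h3
    · exact h3
    · rcases mul_eq_zero.mp h3 with h4 | h4
      · exact absurd (hinj (by linarith)) hij
      · have : l i = 0 := by linarith [hl i, hl j]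
        rw [this, zero_mul]
  have hdiag : ∀ i j, i ≠ j → Q.1 i j = 0 := by
    intro i j hij
    rcases mul_eq_zero.mp (hoff i j hij) with h0 | h0
    -- The row of a vanishing weight is not constrained directly. Row `j` is already diagonal of
    -- unit length, so orthonormality of column `j` kills its other entries.
    · have hj : l j ≠ 0 := fun h1 => hij (hinj (h0.trans h1.symm))
      have hrow : ∀ k, j ≠ k → Q.1 j k = 0 := fun k hk =>
        (mul_eq_zero.mp (hoff j k hk)).resolve_left hj
      have h1 := congrFun (congrFun (SO3.mul_transpose Q) j) j
      have h2 := congrFun (congrFun (SO3.transpose_mul Q) j) j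
      simp only [Matrix.mul_apply, Matrix.transpose_apply, Matrix.one_apply_eq] at h1 h2
      rw [Finset.sum_eq_single j (fun k _ hk => by rw [hrow k hk.symm, zero_mul]) (by simp)] at h1
      rw [← Finset.add_sum_erase _ _ (Finset.mem_univ j), h1] at h2
      have h3 : ∑ k ∈ Finset.univ.erase j, Q.1 k j * Q.1 k j = 0 := by linarith
      rw [Finset.sum_eq_zero_iff_of_nonneg (fun k _ => mul_self_nonneg _)] at h3
      exact mul_self_eq_zero.mp (h3 i (Finset.mem_erase.mpr ⟨hij, Finset.mem_univ i⟩))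
    · exact h0
  have hQ : Q.1 = Matrix.diagonal fun i => Q.1 i i := by
    ext i j
    by_cases hij : i = j
    · subst hij
      simp
    · rw [Matrix.diagonal_apply_ne _ hij, hdiag i j hij]
  refine ⟨fun i => Q.1 i i, fun i => ?_, hQ⟩
  have h1 := congrFun (congrFun (SO3.mul_transpose Q) i) i
  rw [hQ] at h1
  simp only [Matrix.diagonal_transpose, Matrix.diagonal_mul_diagonal, Matrix.diagonal_apply_eq,
    Matrix.one_apply_eq] at h1
  rw [sq]
  exact h1

lemma finite_diagonal_SO3 :
    {c : SO3 | ∃ s : Fin 3 → ℝ, (∀ i, s i ^ 2 = 1) ∧ c.1 = Matrix.diagonal s}.Finite := by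
  have hfin : (Set.pi Set.univ fun _ : Fin 3 => ({1, -1} : Set ℝ)).Finite :=
    Set.Finite.pi fun _ => Set.toFinite _
  refine Set.Finite.of_finite_image ((hfin.image Matrix.diagonal).subset ?_)
    (Subtype.val_injective.injOn)
  rintro _ ⟨c, ⟨s, hs, hc⟩, rfl⟩
  refine ⟨s, fun i _ => ?_, hc.symm⟩
  simpa using hs i

lemma two_le_dist_diagonal_SO3 {c c' : SO3} {s s' : Fin 3 → ℝ} (hs : ∀ i, s i ^ 2 = 1)
    (hs' : ∀ i, s' i ^ 2 = 1) (hc : c.1 = Matrix.diagonal s) (hc' : c'.1 = Matrix.diagonal s')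
    (hne : c ≠ c') : 2 ≤ dist c c' := by
  obtain ⟨i, hi⟩ : ∃ i, s i ≠ s' i := by
    by_contra hcon
    push Not at hcon
    exact hne (Subtype.ext (by rw [hc, hc', funext hcon]))
  rw [dist_SO3, hc, hc']
  refine le_of_sq_le_sq ?_ (norm_nonneg _)
  rw [frobenius_norm_sq]
  have h1 : s i * s' i ≤ 0 := by
    have : (s i - s' i) * (s i + s' i) = 0 := by linarith [hs i, hs' i]
    have h2 := (mul_eq_zero.mp this).resolve_left (sub_ne_zero.mpr hi)
    have h3 : s' i = -s i := by linarith
    rw [h3]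
    nlinarith [sq_nonneg (s i)]
  have h2 : (2 : ℝ) ^ 2 ≤ ((Matrix.diagonal s - Matrix.diagonal s' : Mat3) i i) ^ 2 := by
    have e : ((Matrix.diagonal s - Matrix.diagonal s' : Mat3) i i) = s i - s' i := by simp
    rw [e]
    have : s' i = -s i := by
      have : (s i - s' i) * (s i + s' i) = 0 := by linarith [hs i, hs' i]
      linarith [(mul_eq_zero.mp this).resolve_left (sub_ne_zero.mpr hi)]
    rw [this]
    nlinarith [hs i]
  refine h2.trans ?_
  refine le_trans ?_ (Finset.single_le_sum (f := fun k => ∑ j,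
    ((Matrix.diagonal s - Matrix.diagonal s' : Mat3) k j) ^ 2) (fun _ _ => by positivity)
      (Finset.mem_univ i))
  exact Finset.single_le_sum (f := fun j =>
    ((Matrix.diagonal s - Matrix.diagonal s' : Mat3) i j) ^ 2) (fun _ _ => by positivity)
      (Finset.mem_univ i)

/-! ### The error energy -/

lemma hasDerivWithinAt_matrix_iff {Q : ℝ → Mat3} {Q' : Mat3} {s : Set ℝ} {t : ℝ} :
    HasDerivWithinAt Q Q' s t ↔ ∀ i j, HasDerivWithinAt (fun τ => Q τ i j) (Q' i j) s t := by
  constructor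
  · intro h i j
    exact (LinearMap.toContinuousLinearMap
      (Matrix.entryLinearMap ℝ ℝ i j)).hasFDerivAt.comp_hasDerivWithinAt t h
  · intro h
    have e : ∀ M : Mat3, M = ∑ i, ∑ j, M i j • Matrix.single i j (1 : ℝ) := fun M => by
      conv_lhs => rw [Matrix.matrix_eq_sum_single M]
      simp
    have h2 : HasDerivWithinAt (fun τ => ∑ i, ∑ j, Q τ i j • Matrix.single i j (1 : ℝ))
        (∑ i, ∑ j, Q' i j • Matrix.single i j (1 : ℝ)) s t :=
      HasDerivWithinAt.fun_sum fun i _ => HasDerivWithinAt.fun_sum fun j _ =>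
        (h i j).smul_const _
    rw [← e] at h2
    convert h2 using 2 with τ
    exact e _

section Energy

variable {D : Type*} [NormedAddCommGroup D]

/-- The energy `tr (Λ (1 - Q)) + ‖d‖² / (2 κ)`. -/
noncomputable def errEnergy (l : Fin 3 → ℝ) (κ : ℝ) (Q : Mat3) (d : D) : ℝ :=
  ∑ i, l i * (1 - Q i i) + ‖d‖ ^ 2 / (2 * κ)

/-- One weight may be zero, so the three summands `1 - Q i i` cannot be treated separately. The
triangle inequalities between them let the two larger ones, whose weights have positive sum, control
the smallest. -/
lemma exists_le_errEnergy {l : Fin 3 → ℝ} (hl : ∀ i, 0 ≤ l i) (hinj : Function.Injective l)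
    {κ : ℝ} (hκ : 0 < κ) :
    ∃ c > 0, ∀ (Q : SO3) (d : D), c * (‖Q.1 - 1‖ ^ 2 + ‖d‖ ^ 2) ≤ errEnergy l κ Q.1 d := by
  have hpair : ∀ i j, i ≠ j → 0 < l i + l j := fun i j hij => by
    rcases (hl i).lt_or_eq with h | h
    · linarith [hl j]
    · rcases (hl j).lt_or_eq with h' | h'
      · linarith
      · exact absurd (hinj (h.symm.trans h')) hij
  set μ := min (l 0 + l 1) (min (l 0 + l 2) (l 1 + l 2)) with hμ
  have hμ0 : 0 < μ := lt_min (hpair 0 1 (by decide)) (lt_min (hpair 0 2 (by decide))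
    (hpair 1 2 (by decide)))
  have m01 : μ ≤ l 0 + l 1 := min_le_left _ _
  have m02 : μ ≤ l 0 + l 2 := (min_le_right _ _).trans (min_le_left _ _)
  have m12 : μ ≤ l 1 + l 2 := (min_le_right _ _).trans (min_le_right _ _)
  refine ⟨min (μ / 8) (1 / (2 * κ)), by positivity, fun Q d => ?_⟩
  obtain ⟨h0, h1, h2⟩ := SO3.one_sub_apply_le Q
  have a0 := SO3.apply_self_le_one Q 0
  have a1 := SO3.apply_self_le_one Q 1
  have a2 := SO3.apply_self_le_one Q 2
  have l0 := hl 0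
  have l1 := hl 1
  have l2 := hl 2
  -- From `px + qy + rz ≥ (q + r) y` and `x + y + z ≤ 2 (x + y) ≤ 4 y`, for increasingly ordered
  -- `x`, `y`, `z`; the eight cases below sort the three entries.
  have hlow : ∀ x y z p q r : ℝ, 0 ≤ x → x ≤ y → y ≤ z → z ≤ x + y → 0 ≤ p → 0 ≤ q → 0 ≤ r →
      μ ≤ q + r → μ / 4 * (x + y + z) ≤ p * x + q * y + r * z := by
    intro x y z p q r hx hxy hyz hz hp hq hr hqr
    have b1 := mul_nonneg hp hx
    have b2 := mul_le_mul_of_nonneg_left hyz hr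
    have b3 := mul_le_mul_of_nonneg_right hqr (hx.trans hxy)
    nlinarith
  have key : μ / 4 * ((1 - Q.1 0 0) + (1 - Q.1 1 1) + (1 - Q.1 2 2))
      ≤ l 0 * (1 - Q.1 0 0) + l 1 * (1 - Q.1 1 1) + l 2 * (1 - Q.1 2 2) := by
    rcases le_total (1 - Q.1 0 0) (1 - Q.1 1 1) with k1 | k1 <;>
    rcases le_total (1 - Q.1 1 1) (1 - Q.1 2 2) with k2 | k2 <;>
    rcases le_total (1 - Q.1 0 0) (1 - Q.1 2 2) with k3 | k3
    · linarith [hlow _ _ _ (l 0) (l 1) (l 2) (by linarith) k1 k2 (by linarith) l0 l1 l2 (by linarith)]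
    · linarith [hlow _ _ _ (l 0) (l 1) (l 2) (by linarith) k1 k2 (by linarith) l0 l1 l2 (by linarith)]
    · linarith [hlow _ _ _ (l 0) (l 2) (l 1) (by linarith) k3 k2 (by linarith) l0 l2 l1 (by linarith)]
    · linarith [hlow _ _ _ (l 2) (l 0) (l 1) (by linarith) k3 k1 (by linarith) l2 l0 l1 (by linarith)]
    · linarith [hlow _ _ _ (l 1) (l 0) (l 2) (by linarith) k1 k3 (by linarith) l1 l0 l2 (by linarith)]
    · linarith [hlow _ _ _ (l 1) (l 2) (l 0) (by linarith) k2 k3 (by linarith) l1 l2 l0 (by linarith)]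
    · linarith [hlow _ _ _ (l 2) (l 1) (l 0) (by linarith) k2 k1 (by linarith) l2 l1 l0 (by linarith)]
    · linarith [hlow _ _ _ (l 2) (l 1) (l 0) (by linarith) k2 k1 (by linarith) l2 l1 l0 (by linarith)]
  rw [errEnergy, norm_SO3_sub_one_sq, Fin.sum_univ_three, Fin.sum_univ_three]
  have c1 := mul_le_mul_of_nonneg_right (min_le_left (μ / 8) (1 / (2 * κ)))
    (show 0 ≤ 2 * ((1 - Q.1 0 0) + (1 - Q.1 1 1) + (1 - Q.1 2 2)) by linarith)
  have c2 := mul_le_mul_of_nonneg_right (min_le_right (μ / 8) (1 / (2 * κ))) (sq_nonneg ‖d‖)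
  have e1 : ‖d‖ ^ 2 / (2 * κ) = 1 / (2 * κ) * ‖d‖ ^ 2 := by ring
  rw [e1]
  linarith

lemma exists_errEnergy_le {l : Fin 3 → ℝ} (hl : ∀ i, 0 ≤ l i) {κ : ℝ} (hκ : 0 < κ) :
    ∃ C > 0, ∀ (Q : SO3) (d : D), errEnergy l κ Q.1 d ≤ C * (‖Q.1 - 1‖ ^ 2 + ‖d‖ ^ 2) := by
  refine ⟨∑ i, l i + 1 / (2 * κ),
    add_pos_of_nonneg_of_pos (Finset.sum_nonneg fun i _ => hl i) (by positivity), fun Q d => ?_⟩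
  have hs : 0 ≤ ∑ i, l i := Finset.sum_nonneg fun i _ => hl i
  have ha : ∀ i, 0 ≤ 1 - Q.1 i i := fun i => by linarith [SO3.apply_self_le_one Q i]
  have h1 : ∑ i, l i * (1 - Q.1 i i) ≤ ∑ i, l i * ∑ j, (1 - Q.1 j j) :=
    Finset.sum_le_sum fun i _ => mul_le_mul_of_nonneg_left
      (Finset.single_le_sum (f := fun j => 1 - Q.1 j j) (fun j _ => ha j) (Finset.mem_univ i))
      (hl i)
  rw [← Finset.sum_mul] at h1
  have h2 := norm_SO3_sub_one_sq Q
  have h3 : 0 ≤ ∑ j, (1 - Q.1 j j) := Finset.sum_nonneg fun j _ => ha j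
  have p1 : 0 ≤ (∑ i, l i) * ‖d‖ ^ 2 := by positivity
  have p2 : 0 ≤ 1 / (2 * κ) * ‖Q.1 - 1‖ ^ 2 := by positivity
  have e1 : ‖d‖ ^ 2 / (2 * κ) = 1 / (2 * κ) * ‖d‖ ^ 2 := by ring
  rw [errEnergy, e1]
  nlinarith [mul_nonneg hs h3]

variable [InnerProductSpace ℝ D]

lemma hasDerivWithinAt_errEnergy (l : Fin 3 → ℝ) {κ : ℝ} (hκ : κ ≠ 0) {Q : ℝ → Mat3} {Q' : Mat3}
    {d : ℝ → D} {d' : D} {s : Set ℝ} {t : ℝ} (hQ : HasDerivWithinAt Q Q' s t)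
    (hd : HasDerivWithinAt d d' s t) :
    HasDerivWithinAt (fun τ => errEnergy l κ (Q τ) (d τ))
      (-(∑ i, l i * Q' i i) + inner ℝ (d t) d' / κ) s t := by
  have h1 : HasDerivWithinAt (fun τ => ∑ i, l i * (1 - Q τ i i)) (∑ i, l i * -(Q' i i)) s t :=
    HasDerivWithinAt.fun_sum fun i _ =>
      ((hasDerivWithinAt_matrix_iff.mp hQ i i).const_sub 1).const_mul (l i)
  refine (h1.add ((hd.norm_sq).div_const (2 * κ))).congr_deriv ?_
  simp only [mul_neg, Finset.sum_neg_distrib]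
  field_simp

variable [CompleteSpace D]

/-- The division by `κ` and the adjoint feedback are matched so that the `B d` contributions of
rotation and internal model cancel. What remains is a polynomial identity that follows from the unit
length of the rows of `Q`. -/
lemma errEnergy_deriv_eq (l : Fin 3 → ℝ) {κ : ℝ} (hκ : κ ≠ 0) (S : D →L[ℝ] D)
    (hS : ∀ d, inner ℝ d (S d) = 0) (B : D →L[ℝ] Vec3) (Q : SO3) (d : D) :
    -(∑ i, l i * rotField l B Q.1 d i i) + inner ℝ d (vecField l κ S B Q.1 d) / κ
      = -‖axial (Matrix.diagonal l * Q.1)‖ ^ 2 := by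
  have h1 : inner ℝ d (vecField l κ S B Q.1 d) / κ
      = inner ℝ (B d) (axial (Matrix.diagonal l * Q.1)) := by
    rw [vecField, inner_add_right, hS, inner_smul_right, ContinuousLinearMap.adjoint_inner_right]
    field_simp
    ring
  rw [h1, inner_vec3, norm_vec3_sq]
  set v := B d
  have g0 := congrFun (congrFun (SO3.mul_transpose Q) 0) 0
  have g1 := congrFun (congrFun (SO3.mul_transpose Q) 1) 1
  have g2 := congrFun (congrFun (SO3.mul_transpose Q) 2) 2
  simp [rotField, Matrix.mul_apply, Fin.sum_univ_three, Matrix.diagonal_apply, axial_apply,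
    hatL_apply, hat] at g0 g1 g2 ⊢
  linear_combination (l 0 ^ 2) * g0 + (l 1 ^ 2) * g1 + (l 2 ^ 2) * g2

end Energy

/-! ### Convergence of the error system -/

section Convergence

variable {D : Type*} [NormedAddCommGroup D] [InnerProductSpace ℝ D] [CompleteSpace D]

lemma norm_rotField_le (n : Fin 3 → ℝ) {b : ℝ} (B : D →L[ℝ] Vec3) (hB : ‖B‖ ≤ b) (Q : SO3) (d : D) :
    ‖rotField n B Q.1 d‖ ≤ 5 * ‖(Matrix.diagonal n : Mat3)‖ + 4 * b * ‖d‖ := by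
  have hq := norm_SO3_le Q
  have h1 : ‖Q.1 * Matrix.diagonal n * Q.1‖ ≤ 2 * ‖(Matrix.diagonal n : Mat3)‖ * 2 :=
    (Matrix.frobenius_norm_mul _ _).trans (mul_le_mul ((Matrix.frobenius_norm_mul _ _).trans
      (mul_le_mul_of_nonneg_right hq (norm_nonneg _))) hq (norm_nonneg _) (by positivity))
  have h2 : ‖Q.1 * hatL (B d)‖ ≤ 2 * (2 * (b * ‖d‖)) :=
    (Matrix.frobenius_norm_mul _ _).trans (mul_le_mul hq ((norm_hatL_le _).trans
      (mul_le_mul_of_nonneg_left (B.le_of_opNorm_le hB d) zero_le_two)) (norm_nonneg _) zero_le_two)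
  have h3 := norm_sub_le (Matrix.diagonal n - Q.1 * Matrix.diagonal n * Q.1) (Q.1 * hatL (B d))
  have h4 := norm_sub_le (Matrix.diagonal n) (Q.1 * Matrix.diagonal n * Q.1)
  rw [rotField]
  linarith

lemma norm_vecField_le (n : Fin 3 → ℝ) {κ b : ℝ} (hκ : 0 ≤ κ) (S : D →L[ℝ] D) (B : D →L[ℝ] Vec3)
    (hB : ‖B‖ ≤ b) (Q : SO3) (d : D) :
    ‖vecField n κ S B Q.1 d‖ ≤ ‖S‖ * ‖d‖ + 4 * κ * b * ‖(Matrix.diagonal n : Mat3)‖ := by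
  have hb : 0 ≤ b := (norm_nonneg _).trans hB
  have h1 : ‖axial (Matrix.diagonal n * Q.1)‖ ≤ 2 * (‖(Matrix.diagonal n : Mat3)‖ * 2) :=
    (norm_axial_le _).trans (mul_le_mul_of_nonneg_left ((Matrix.frobenius_norm_mul _ _).trans
      (mul_le_mul_of_nonneg_left (norm_SO3_le Q) (norm_nonneg _))) zero_le_two)
  have h2 := ((ContinuousLinearMap.adjoint B).le_of_opNorm_le (by simpa using hB)
    (axial (Matrix.diagonal n * Q.1))).trans (mul_le_mul_of_nonneg_left h1 hb)
  have h3 := norm_add_le (S d) (κ • (ContinuousLinearMap.adjoint B) (axial (Matrix.diagonal n * Q.1)))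
  rw [norm_smul, Real.norm_eq_abs, abs_of_nonneg hκ] at h3
  have h4 := mul_le_mul_of_nonneg_left h2 hκ
  have h5 := S.le_opNorm d
  rw [vecField]
  linarith

/-- Serves as second trajectory, turning the estimates for pairs into estimates for one trajectory.
-/
lemma isErrTraj_equilibrium (n : Fin 3 → ℝ) (κ : ℝ) (S : D →L[ℝ] D) (B : ℝ → D →L[ℝ] Vec3) :
    IsErrTraj n κ S B (fun _ => 1) (fun _ => 0) := by
  have h : axial (Matrix.diagonal n * (1 : Mat3)) = 0 := by
    ext i
    fin_cases i <;> simp [axial_apply]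
  constructor
  · intro t _
    have e : rotField n (B t) (1 : SO3).1 (0 : D) = 0 := by
      simp [rotField]
    rw [e]
    exact hasDerivWithinAt_const _ _ _
  · intro t _
    have e : vecField n κ S (B t) (1 : SO3).1 (0 : D) = 0 := by
      rw [vecField, OneMemClass.coe_one, h]
      simp
    rw [e]
    exact hasDerivWithinAt_const _ _ _

namespace IsErrTraj

variable {l : Fin 3 → ℝ} {κ : ℝ} {S P : D →L[ℝ] D} {b b' c K : ℝ} {B B' : ℝ → D →L[ℝ] Vec3}
  {Q : ℝ → SO3} {d : ℝ → D}

/-- Left translation by a diagonal rotation moves the corresponding equilibrium to the identity. -/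
lemma translate (h : IsErrTraj l κ S B Q d) {q : SO3} {s : Fin 3 → ℝ}
    (hs : ∀ i, s i ^ 2 = 1) (hq : q.1 = Matrix.diagonal s) :
    IsErrTraj (fun i => s i * l i) κ S B (fun t => q * Q t) d := by
  have e1 : (Matrix.diagonal fun i => s i * l i : Mat3) = Matrix.diagonal s * Matrix.diagonal l := by
    rw [Matrix.diagonal_mul_diagonal]
  have e2 : (Matrix.diagonal s * Matrix.diagonal s : Mat3) = 1 := by
    rw [Matrix.diagonal_mul_diagonal, ← Matrix.diagonal_one]
    congr 1
    ext i
    rw [← sq, hs i]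
  have e3 : (Matrix.diagonal s * Matrix.diagonal l : Mat3)
      = Matrix.diagonal l * Matrix.diagonal s := by
    rw [Matrix.diagonal_mul_diagonal, Matrix.diagonal_mul_diagonal]
    congr 1
    ext i
    ring
  have e4 : ∀ t, ((q * Q t : SO3) : Mat3) = Matrix.diagonal s * (Q t).1 := fun t => by
    rw [← hq]
    rfl
  have e5 : ∀ t, (Matrix.diagonal fun i => s i * l i) * ((q * Q t : SO3) : Mat3)
      = Matrix.diagonal l * (Q t).1 := fun t => by
    rw [e1, e3, e4, Matrix.mul_assoc, ← Matrix.mul_assoc (Matrix.diagonal s), e2, Matrix.one_mul]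
  constructor
  · intro t ht
    have h1 := (h.rot t ht).const_mul (Matrix.diagonal s)
    simp only [e4]
    refine h1.congr_deriv ?_
    simp only [rotField]
    rw [← e4, Matrix.mul_assoc ((q * Q t : SO3) : Mat3), e5, e4, e1]
    simp only [Matrix.mul_sub, Matrix.mul_assoc]
  · intro t ht
    have h1 := h.vec t ht
    simp only [vecField, e5] at h1 ⊢
    exact h1

lemma energy (h : IsErrTraj l κ S B Q d) (hκ : κ ≠ 0) (hS : ∀ d, inner ℝ d (S d) = 0) :
    ∀ t ≥ 0, HasDerivWithinAt (fun t => errEnergy l κ (Q t).1 (d t))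
      (-‖axial (Matrix.diagonal l * (Q t).1)‖ ^ 2) (Set.Ici 0) t := fun t ht =>
  (hasDerivWithinAt_errEnergy l hκ (h.rot t ht) (h.vec t ht)).congr_deriv
    (errEnergy_deriv_eq l hκ S hS (B t) (Q t) (d t))

lemma energy_le (h : IsErrTraj l κ S B Q d) (hκ : κ ≠ 0) (hS : ∀ d, inner ℝ d (S d) = 0)
    {t : ℝ} (ht : 0 ≤ t) : errEnergy l κ (Q t).1 (d t) ≤ errEnergy l κ (Q 0).1 (d 0) := by
  have := sub_le_mul_of_deriv_le (h.energy hκ hS) le_rfl ht (c := 0)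
    (fun τ _ _ => neg_nonpos.mpr (sq_nonneg _))
  linarith

lemma exists_norm_le (h : IsErrTraj l κ S B Q d) (hl : ∀ i, 0 ≤ l i)
    (hinj : Function.Injective l) (hκ : 0 < κ) (hS : ∀ d, inner ℝ d (S d) = 0) :
    ∃ M, ∀ t ≥ 0, ‖d t‖ ≤ M := by
  obtain ⟨c, hc, hcl⟩ := exists_le_errEnergy (D := D) hl hinj hκ
  refine ⟨Real.sqrt (errEnergy l κ (Q 0).1 (d 0) / c), fun t ht => Real.le_sqrt_of_sq_le ?_⟩
  rw [le_div_iff₀ hc]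
  nlinarith [hcl (Q t) (d t), h.energy_le hκ.ne' hS ht, sq_nonneg ‖(Q t).1 - 1‖]

/-- The system is driven by the time-dependent `B`, so Barbalat's lemma takes the place of an
invariance principle. The energy bounds `d`, and with it the rate of change of the dissipation. -/
lemma tendsto_axial (h : IsErrTraj l κ S B Q d) (hl : ∀ i, 0 ≤ l i)
    (hinj : Function.Injective l) (hκ : 0 < κ) (hS : ∀ d, inner ℝ d (S d) = 0)
    (hB : ∀ t ≥ 0, ‖B t‖ ≤ b) :
    Tendsto (fun t => ‖axial (Matrix.diagonal l * (Q t).1)‖ ^ 2) atTop (𝓝 0) := by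
  obtain ⟨M, hM⟩ := h.exists_norm_le hl hinj hκ hS
  have hM0 : 0 ≤ M := (norm_nonneg _).trans (hM 0 le_rfl)
  have hb0 : 0 ≤ b := (norm_nonneg _).trans (hB 0 le_rfl)
  obtain ⟨c, hc, hcl⟩ := exists_le_errEnergy (D := D) hl hinj hκ
  set k := ‖(Matrix.diagonal l : Mat3)‖ with hk
  have hf : ∀ t ≥ 0, HasDerivWithinAt (fun t => ‖axial (Matrix.diagonal l * (Q t).1)‖ ^ 2)
      (2 * inner ℝ (axial (Matrix.diagonal l * (Q t).1))
        (axial (Matrix.diagonal l * rotField l (B t) (Q t).1 (d t)))) (Set.Ici 0) t :=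
    fun t ht => (axial.hasFDerivAt.comp_hasDerivWithinAt t
      ((h.rot t ht).const_mul (Matrix.diagonal l))).norm_sq
  refine tendsto_zero_of_le_deriv (W := fun t => -errEnergy l κ (Q t).1 (d t)) (T := 0) (M := 0)
    (L := 2 * ((2 * (k * 2)) * (2 * (k * (5 * k + 4 * b * M))))) le_rfl (by positivity)
    (fun t ht => (h.energy hκ.ne' hS t ht).fun_neg) hf (fun t _ => by positivity) ?_ ?_ ?_
  · intro t ht
    have h1 := abs_inner_le_of_norm_le (axial (Matrix.diagonal l * (Q t).1))
      (axial (Matrix.diagonal l * rotField l (B t) (Q t).1 (d t))) (2 * (k * 2))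
      (2 * (k * (5 * k + 4 * b * M)))
      ((norm_axial_le _).trans (mul_le_mul_of_nonneg_left ((Matrix.frobenius_norm_mul _ _).trans
        (mul_le_mul_of_nonneg_left (norm_SO3_le _) (norm_nonneg _))) zero_le_two))
      ((norm_axial_le _).trans (mul_le_mul_of_nonneg_left ((Matrix.frobenius_norm_mul _ _).trans
        (mul_le_mul_of_nonneg_left ((norm_rotField_le l (B t) (hB t ht) _ _).trans (by
          have := mul_le_mul_of_nonneg_left (hM t ht) (show 0 ≤ 4 * b by positivity)
          linarith)) (norm_nonneg _))) zero_le_two))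
    linarith [(abs_le.mp h1).1]
  · intro t _
    rw [neg_neg]
  · intro t _
    have := hcl (Q t) (d t)
    have h2 : 0 ≤ c * (‖(Q t).1 - 1‖ ^ 2 + ‖d t‖ ^ 2) := by positivity
    linarith

lemma continuousOn_rot (h : IsErrTraj l κ S B Q d) : ContinuousOn Q (Set.Ici 0) := by
  rw [Topology.IsInducing.subtypeVal.continuousOn_iff]
  exact fun t ht => (h.rot t ht).continuousWithinAt

/-- The rotation error ends up in the prescribed neighbourhood of one diagonal rotation. -/
lemma eventually_mem_ball (h : IsErrTraj l κ S B Q d) (hl : ∀ i, 0 ≤ l i)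
    (hinj : Function.Injective l) (hκ : 0 < κ) (hS : ∀ d, inner ℝ d (S d) = 0)
    (hB : ∀ t ≥ 0, ‖B t‖ ≤ b) (r : SO3 → ℝ) (hr : ∀ q, 0 < r q) (hr1 : ∀ q, r q ≤ 1) :
    ∃ q : SO3, (∃ s : Fin 3 → ℝ, (∀ i, s i ^ 2 = 1) ∧ q.1 = Matrix.diagonal s) ∧
      ∃ T ≥ 0, ∀ t ≥ T, Q t ∈ Metric.ball q (r q) := by
  set E := {q : SO3 | ∃ s : Fin 3 → ℝ, (∀ i, s i ^ 2 = 1) ∧ q.1 = Matrix.diagonal s} with hE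
  set U := ⋃ q ∈ E, Metric.ball q (r q) with hU
  have hUo : IsOpen U := isOpen_biUnion fun _ _ => Metric.isOpen_ball
  have hg : Continuous fun q : SO3 => ‖axial (Matrix.diagonal l * q.1)‖ ^ 2 := by fun_prop
  -- Outside the balls the dissipation has a positive minimum by compactness, which it eventually
  -- undercuts.
  have hev : ∀ᶠ t in atTop, Q t ∈ U := by
    rcases (Uᶜ).eq_empty_or_nonempty with h0 | h0
    · exact Eventually.of_forall fun t => by
        rw [Set.compl_empty_iff.mp h0]
        trivial
    · obtain ⟨q₀, hq₀, hmin⟩ := hUo.isClosed_compl.isCompact.exists_isMinOn h0 hg.continuousOn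
      have hpos : 0 < ‖axial (Matrix.diagonal l * q₀.1)‖ ^ 2 := by
        have : axial (Matrix.diagonal l * q₀.1) ≠ 0 := fun hz =>
          hq₀ (Set.mem_biUnion (SO3.eq_diagonal_of_axial_eq_zero hl hinj q₀ hz)
            (Metric.mem_ball_self (hr q₀)))
        positivity
      filter_upwards [(h.tendsto_axial hl hinj hκ hS hB).eventually (gt_mem_nhds hpos)] with t ht
      by_contra hcon
      exact absurd (hmin hcon) (not_le.mpr ht)
  obtain ⟨T, hT⟩ := (hev.and (eventually_ge_atTop 0)).exists_forall_of_atTop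
  have hT0 : 0 ≤ T := (hT T le_rfl).2
  obtain ⟨q, hq, hqT⟩ := Set.mem_iUnion₂.mp (hT T le_rfl).1
  refine ⟨q, hq, T, hT0, ?_⟩
  -- The tail of the trajectory is connected and covered by disjoint balls: radii are at most `1`
  -- and centres at least `2` apart. So it stays in the ball that it meets at time `T`.
  have hconn : IsPreconnected (Q '' Set.Ici T) :=
    isPreconnected_Ici.image _ (h.continuousOn_rot.mono (Set.Ici_subset_Ici.mpr hT0))
  have hsub := hconn.subset_left_of_subset_union (u := Metric.ball q (r q))
    (v := ⋃ p ∈ E \ {q}, Metric.ball p (r p)) Metric.isOpen_ball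
    (isOpen_biUnion fun _ _ => Metric.isOpen_ball) ?_ ?_
    ⟨Q T, Set.mem_image_of_mem Q Set.self_mem_Ici, hqT⟩
  · exact fun t ht => hsub ⟨t, ht, rfl⟩
  · rw [Set.disjoint_iUnion₂_right]
    intro p hp
    refine Metric.ball_disjoint_ball ?_
    obtain ⟨s, hs, hqs⟩ := hq
    obtain ⟨⟨s', hs', hps⟩, hne⟩ := hp
    have := two_le_dist_diagonal_SO3 hs hs' hqs hps (fun hh => hne hh.symm)
    linarith [hr1 q, hr1 p]
  · rintro _ ⟨t, ht, rfl⟩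
    obtain ⟨p, hp, hpt⟩ := Set.mem_iUnion₂.mp (hT t ht).1
    by_cases hpq : p = q
    · exact Or.inl (hpq ▸ hpt)
    · exact Or.inr (Set.mem_biUnion (show p ∈ E \ {q} from ⟨hp, hpq⟩) hpt)

end IsErrTraj

/-- Nonnegative distinct weights have distinct squares, so every diagonal equilibrium is
nondegenerate. -/
lemma signed_add_ne_zero {l : Fin 3 → ℝ} (hl : ∀ i, 0 ≤ l i) (hinj : Function.Injective l)
    {s : Fin 3 → ℝ} (hs : ∀ i, s i ^ 2 = 1) : ∀ i j, i ≠ j → s i * l i + s j * l j ≠ 0 := by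
  intro i j hij h0
  have h1 : (s i * l i) ^ 2 = (s j * l j) ^ 2 := by
    rw [show s i * l i = -(s j * l j) by linarith]
    ring
  rw [mul_pow, mul_pow, hs, hs, one_mul, one_mul, sq_eq_sq₀ (hl i) (hl j)] at h1
  exact hij (hinj h1)

lemma dist_eq_norm_mul_sub_one {q : SO3} {s : Fin 3 → ℝ} (hs : ∀ i, s i ^ 2 = 1)
    (hq : q.1 = Matrix.diagonal s) (Q : SO3) : ‖((q * Q : SO3) : Mat3) - 1‖ = dist Q q := by
  have e2 : (Matrix.diagonal s * Matrix.diagonal s : Mat3) = 1 := by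
    rw [Matrix.diagonal_mul_diagonal, ← Matrix.diagonal_one]
    congr 1
    ext i
    rw [← sq, hs i]
  rw [dist_SO3, ← norm_SO3_mul q (Q.1 - q.1), Matrix.mul_sub, hq, e2, ← hq]
  rfl

/-- Every trajectory of the error system converges to an equilibrium. -/
theorem IsErrTraj.exists_tendsto {l : Fin 3 → ℝ} {κ : ℝ} {S P : D →L[ℝ] D} {b b' c K : ℝ}
    {B B' : ℝ → D →L[ℝ] Vec3} {Q : ℝ → SO3} {d : ℝ → D} (h : IsErrTraj l κ S B Q d)
    (hl : ∀ i, 0 ≤ l i) (hinj : Function.Injective l) (hκ : 0 < κ)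
    (hS : ∀ d, inner ℝ d (S d) = 0) (hc : 0 < c) (hK : 0 ≤ K)
    (hB : IsDetectableOutput S P b b' c K B B') :
    ∃ q : SO3, (∃ s : Fin 3 → ℝ, (∀ i, s i ^ 2 = 1) ∧ q.1 = Matrix.diagonal s) ∧
      Tendsto (fun t => dist (Q t) q) atTop (𝓝 0) ∧ Tendsto d atTop (𝓝 0) := by
  have hb : 0 ≤ b := (norm_nonneg _).trans (hB.norm_le 0 le_rfl)
  -- The constants are chosen for all `q` in advance, since the radii are needed before the limiting
  -- rotation is known. For `q` that are not diagonal sign rotations the values `0` and `1` are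
  -- placeholders.
  have hloc : ∀ q : SO3, ∃ M₀ r : ℝ, 0 ≤ M₀ ∧ 0 < r ∧ ∀ s : Fin 3 → ℝ, (∀ i, s i ^ 2 = 1) →
      q.1 = Matrix.diagonal s → ∀ t ≥ 0, dist (Q t) q ≤ r →
        ∃ w, HasDerivWithinAt (fun τ => pairForm (hess fun i => s i * l i) P κ M₀ K (B τ)
            ((1 / 2 : ℝ) • axial ((q * Q τ).1 - 1)) (d τ)) w (Set.Ici 0) t ∧
          c / 4 * (‖(1 / 2 : ℝ) • axial ((q * Q t).1 - 1)‖ ^ 2 + ‖d t‖ ^ 2) ≤ w := by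
    intro q
    by_cases hq : ∃ s : Fin 3 → ℝ, (∀ i, s i ^ 2 = 1) ∧ q.1 = Matrix.diagonal s
    · obtain ⟨s, hs, hqs⟩ := hq
      obtain ⟨Mb, hMb⟩ := exists_pairForm_growth (fun i => s i * l i)
        (signed_add_ne_zero hl hinj hs) hκ S P hS hb hc hK
      obtain ⟨r, hr, H⟩ := hMb (max Mb 0) (le_max_left _ _)
      refine ⟨max Mb 0, r, le_max_right _ _, hr, fun s' hs' hqs' t ht hd => ?_⟩
      have hss : s' = s := Matrix.diagonal_injective (hqs'.symm.trans hqs)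
      subst hss
      have := H B B' hB _ _ _ _ (h.translate hs hqs)
        (isErrTraj_equilibrium _ κ S B) t ht
        (by rwa [dist_eq_norm_mul_sub_one hs hqs]) (by simpa using hr.le) (by simpa using hr.le)
      simpa using this
    · exact ⟨0, 1, le_rfl, one_pos, fun s hs hqs => absurd ⟨s, hs, hqs⟩ hq⟩
  choose M₀ r hM₀ hr hloc using hloc
  obtain ⟨q, ⟨s, hs, hqs⟩, T, hT, hball⟩ := h.eventually_mem_ball hl hinj hκ hS hB.norm_le
    (fun q => min (r q) (1 / 2)) (fun q => lt_min (hr q) (by norm_num))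
    (fun q => (min_le_right _ _).trans (by norm_num))
  obtain ⟨M, hM⟩ := h.exists_norm_le hl hinj hκ hS
  have hM0 : 0 ≤ M := (norm_nonneg _).trans (hM 0 le_rfl)
  set k := ‖(Matrix.diagonal l : Mat3)‖ with hk
  set e : ℝ → Vec3 := fun t => (1 / 2 : ℝ) • axial ((q * Q t).1 - 1) with he
  have hqd : ∀ t, ((q * Q t : SO3) : Mat3) = q.1 * (Q t).1 := fun t => rfl
  have hede : ∀ t ≥ 0, HasDerivWithinAt e ((1 / 2 : ℝ) • axial (q.1 * rotField l (B t) (Q t).1 (d t)))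
      (Set.Ici 0) t := fun t ht => by
    refine HasDerivWithinAt.fun_const_smul (1 / 2 : ℝ)
      ((axial.hasFDerivAt).comp_hasDerivWithinAt t ?_)
    simp only [hqd]
    exact ((h.rot t ht).const_mul q.1).sub_const 1
  have half : ∀ N : Mat3, ‖(1 / 2 : ℝ) • axial N‖ ≤ ‖N‖ := fun N => by
    rw [norm_smul]
    have := norm_axial_le N
    norm_num
    linarith
  have hen : ∀ t, ‖e t‖ ≤ 4 := fun t => by
    refine (half _).trans ((norm_sub_le _ _).trans ?_)
    have h1 := norm_SO3_le (q * Q t)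
    have h2 : ‖(1 : Mat3)‖ ≤ 2 := norm_SO3_le 1
    linarith
  have hrot : ∀ t ≥ 0, ‖rotField l (B t) (Q t).1 (d t)‖ ≤ 5 * k + 4 * b * M := fun t ht => by
    have h1 := norm_rotField_le l (B t) (hB.norm_le t ht) (Q t) (d t)
    have := mul_le_mul_of_nonneg_left (hM t ht) (show 0 ≤ 4 * b by positivity)
    linarith
  have hvec : ∀ t ≥ 0, ‖vecField l κ S (B t) (Q t).1 (d t)‖ ≤ ‖S‖ * M + 4 * κ * b * k :=
    fun t ht => by
      have h1 := norm_vecField_le l hκ.le S (B t) (hB.norm_le t ht) (Q t) (d t)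
      have := mul_le_mul_of_nonneg_left (hM t ht) (norm_nonneg S)
      linarith
  have hf : ∀ t ≥ 0, HasDerivWithinAt (fun t => c / 4 * (‖e t‖ ^ 2 + ‖d t‖ ^ 2))
      (c / 4 * (2 * inner ℝ (e t) ((1 / 2 : ℝ) • axial (q.1 * rotField l (B t) (Q t).1 (d t)))
        + 2 * inner ℝ (d t) (vecField l κ S (B t) (Q t).1 (d t)))) (Set.Ici 0) t := fun t ht =>
    (((hede t ht).norm_sq).add ((h.vec t ht).norm_sq)).const_mul (c / 4)
  have hdist : ∀ t ≥ T, dist (Q t) q ≤ min (r q) (1 / 2) := fun t ht => (hball t ht).le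
  have hder : ∀ t ≥ T, ∃ w, HasDerivWithinAt (fun τ => pairForm (hess fun i => s i * l i) P κ (M₀ q) K
      (B τ) (e τ) (d τ)) w (Set.Ici 0) t ∧ c / 4 * (‖e t‖ ^ 2 + ‖d t‖ ^ 2) ≤ w := fun t ht =>
    hloc q s hs hqs t (hT.trans ht) ((hdist t ht).trans (min_le_left _ _))
  have hW : ∀ t ≥ 0, HasDerivWithinAt (fun τ => pairForm (hess fun i => s i * l i) P κ (M₀ q) K
      (B τ) (e τ) (d τ)) (pairFormDeriv (hess fun i => s i * l i) P κ (M₀ q) K (B t) (B' t) (e t)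
        ((1 / 2 : ℝ) • axial (q.1 * rotField l (B t) (Q t).1 (d t))) (d t)
        (vecField l κ S (B t) (Q t).1 (d t))) (Set.Ici 0) t := fun t ht =>
    hasDerivWithinAt_pairForm _ (hess_symm _) P κ _ _ (hB.deriv t ht) (hede t ht) (h.vec t ht)
  -- Barbalat's lemma again, now from time `T` on and with the bounded form `W`. It gives `d → 0`,
  -- which the energy argument alone does not show.
  have hlim : Tendsto (fun t => c / 4 * (‖e t‖ ^ 2 + ‖d t‖ ^ 2)) atTop (𝓝 0) := by
    refine tendsto_zero_of_le_deriv hT (L := c / 4 * (2 * (4 * (2 * (5 * k + 4 * b * M)))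
      + 2 * (M * (‖S‖ * M + 4 * κ * b * k)))) (by positivity) hW hf (fun t _ => by positivity) ?_ ?_
      (M := (M₀ q / 2 * (‖hess fun i => s i * l i‖ + 1 / κ) + (K * b + ‖P‖)) * (4 ^ 2 + M ^ 2)) ?_
    · intro t ht
      have h0 := hT.trans ht
      have i1 := abs_inner_le_of_norm_le (e t)
        ((1 / 2 : ℝ) • axial (q.1 * rotField l (B t) (Q t).1 (d t))) _ (2 * (5 * k + 4 * b * M))
        (hen t) ((half _).trans ((Matrix.frobenius_norm_mul _ _).trans
          (mul_le_mul (norm_SO3_le q) (hrot t h0) (norm_nonneg _) zero_le_two)))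
      have i2 := abs_inner_le_of_norm_le (d t) (vecField l κ S (B t) (Q t).1 (d t)) _ _
        (hM t h0) (hvec t h0)
      rw [← mul_neg]
      refine mul_le_mul_of_nonneg_left ?_ (by positivity)
      linarith [(abs_le.mp i1).1, (abs_le.mp i2).1]
    · intro t ht
      obtain ⟨w, hw, hle⟩ := hder t ht
      exact hle.trans (((uniqueDiffOn_Ici (0 : ℝ)).uniqueDiffWithinAt (hT.trans ht)).eq_deriv _ hw
        (hW t (hT.trans ht))).le
    · intro t ht
      have h0 := hT.trans ht
      refine (le_abs_self _).trans ((abs_pairForm_le _ P hκ (hM₀ q) hK (B t) (hB.norm_le t h0) _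
        _).trans ?_)
      have h1 := hM₀ q
      refine mul_le_mul_of_nonneg_left ?_ (by positivity)
      have h2 := pow_le_pow_left₀ (norm_nonneg _) (hen t) 2
      have h3 := pow_le_pow_left₀ (norm_nonneg _) (hM t h0) 2
      linarith
  have hlim2 : Tendsto (fun t => ‖e t‖ ^ 2 + ‖d t‖ ^ 2) atTop (𝓝 0) := by
    have h1 := hlim.const_mul (4 / c)
    rw [mul_zero] at h1
    refine h1.congr fun t => ?_
    field_simp
  have hd2 : Tendsto (fun t => ‖d t‖ ^ 2) atTop (𝓝 0) :=
    squeeze_zero (fun t => by positivity) (fun t => by nlinarith [sq_nonneg ‖e t‖]) hlim2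
  have he2 : Tendsto (fun t => ‖e t‖ ^ 2) atTop (𝓝 0) :=
    squeeze_zero (fun t => by positivity) (fun t => by nlinarith [sq_nonneg ‖d t‖]) hlim2
  have sqrt_lim : ∀ g : ℝ → ℝ, (∀ t, 0 ≤ g t) → Tendsto (fun t => g t ^ 2) atTop (𝓝 0) →
      Tendsto g atTop (𝓝 0) := fun g hg hlim => by
    have := (Real.continuous_sqrt.tendsto 0).comp hlim
    rw [Real.sqrt_zero] at this
    exact this.congr fun t => Real.sqrt_sq (hg t)
  refine ⟨q, ⟨s, hs, hqs⟩, ?_, ?_⟩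
  · have h4 : Tendsto (fun t => 4 * ‖e t‖) atTop (𝓝 0) := by
      have := (sqrt_lim _ (fun t => norm_nonneg _) he2).const_mul 4
      rwa [mul_zero] at this
    refine squeeze_zero' (Eventually.of_forall fun t => dist_nonneg) ?_ h4
    filter_upwards [eventually_ge_atTop T] with t ht
    have h1 := norm_sub_le_axial (q * Q t) 1 (by
      rw [dist_eq_norm_mul_sub_one hs hqs]
      exact (hdist t ht).trans (min_le_right _ _)) (by simp)
    rw [← dist_eq_norm_mul_sub_one hs hqs]
    simpa [he] using h1
  · exact tendsto_zero_iff_norm_tendsto_zero.mpr (sqrt_lim _ (fun t => norm_nonneg _) hd2)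

end Convergence

/-! ### Exponential decay and the stable sets of the saddle points -/

section Local

variable {D : Type*} [NormedAddCommGroup D] [InnerProductSpace ℝ D] [CompleteSpace D]

lemma half_axial_norm_le (M : Mat3) : ‖(1 / 2 : ℝ) • axial M‖ ≤ ‖M‖ := by
  rw [norm_smul]
  have := norm_axial_le M
  norm_num
  linarith

lemma hessCoef_pos {l : Fin 3 → ℝ} (hl : ∀ i, 0 ≤ l i) (hinj : Function.Injective l) :
    ∀ i, 0 < hessCoef l i := by
  have hpair : ∀ i j, i ≠ j → 0 < l i + l j := fun i j hij => by
    rcases (hl i).lt_or_eq with h | h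
    · linarith [hl j]
    · rcases (hl j).lt_or_eq with h' | h'
      · linarith
      · exact absurd (hinj (h.symm.trans h')) hij
  intro i
  fin_cases i
  · exact hpair 1 2 (by decide)
  · exact hpair 2 0 (by decide)
  · exact hpair 0 1 (by decide)

/-- Exponential decay of the trajectories that stay close to the identity. -/
theorem exists_exp_decay {l : Fin 3 → ℝ} (hl : ∀ i, 0 ≤ l i) (hinj : Function.Injective l) {κ : ℝ}
    (hκ : 0 < κ) (S P : D →L[ℝ] D) (hS : ∀ d, inner ℝ d (S d) = 0) {b b' c K : ℝ}
    (hb : 0 ≤ b) (hc : 0 < c) (hK : 0 ≤ K) :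
    ∃ r > 0, ∃ k > 0, ∃ α > 0, ∀ B B' : ℝ → D →L[ℝ] Vec3, IsDetectableOutput S P b b' c K B B' →
      ∀ (Q : ℝ → SO3) (d : ℝ → D), IsErrTraj l κ S B Q d → (∀ t ≥ 0, ‖(Q t).1 - 1‖ ≤ r) →
      ∀ t ≥ 0, ‖(Q t).1 - 1‖ ^ 2 + ‖d t‖ ^ 2
        ≤ k * Real.exp (-α * t) * (‖(Q 0).1 - 1‖ ^ 2 + ‖d 0‖ ^ 2) := by
  have hlne : ∀ i j, i ≠ j → l i + l j ≠ 0 := fun i j hij => by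
    simpa using signed_add_ne_zero hl hinj (s := fun _ => 1) (fun _ => one_pow 2) i j hij
  obtain ⟨Mb₁, h₁⟩ := exists_pairForm_growth l hlne hκ S P hS hb hc hK
  obtain ⟨Mb₂, h₂⟩ := exists_pairForm_le_neg l (hessCoef_pos hl hinj) P hκ hK hb
  set M₀ := max (max Mb₁ Mb₂) 0 with hM
  have hM0 : 0 ≤ M₀ := le_max_right _ _
  obtain ⟨r, hr, h₁⟩ := h₁ M₀ ((le_max_left _ _).trans (le_max_left _ _))
  replace h₂ := h₂ M₀ ((le_max_right _ _).trans (le_max_left _ _))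
  set C := M₀ / 2 * (‖hess l‖ + 1 / κ) + (K * b + ‖P‖) + 1 with hC
  have hC0 : 0 < C := by positivity
  refine ⟨min r (1 / 2), by positivity, 16 * C, by positivity, c / (4 * C), by positivity, ?_⟩
  intro B B' hB Q d hQ hnear t ht
  set e : ℝ → Vec3 := fun t => (1 / 2 : ℝ) • axial ((Q t).1 - 1) with he
  set W : ℝ → ℝ := fun t => pairForm (hess l) P κ M₀ K (B t) (e t) (d t) with hW
  have hder : ∀ t, ∃ w, 0 ≤ t → HasDerivWithinAt W w (Set.Ici 0) t ∧
      c / 4 * (‖e t‖ ^ 2 + ‖d t‖ ^ 2) ≤ w := by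
    intro t
    by_cases ht : 0 ≤ t
    · have := h₁ B B' hB Q (fun _ => 1) d (fun _ => 0) hQ (isErrTraj_equilibrium l κ S B) t ht
        ((hnear t ht).trans (min_le_left _ _)) (by simpa using hr.le) (by simpa using hr.le)
      obtain ⟨w, hw1, hw2⟩ := this
      refine ⟨w, fun _ => ⟨?_, ?_⟩⟩
      · simpa [hW, he] using hw1
      · simpa [he] using hw2
    · exact ⟨0, fun h => absurd h ht⟩
  choose w hw using hder
  have hup : ∀ t ≥ 0, -W t ≤ C * (‖e t‖ ^ 2 + ‖d t‖ ^ 2) := fun t ht => by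
    have h3 := (abs_le.mp (abs_pairForm_le l P hκ hM0 hK (B t) (hB.norm_le t ht) (e t) (d t))).1
    have h4 : 0 ≤ ‖e t‖ ^ 2 + ‖d t‖ ^ 2 := by positivity
    simp only [hW]
    rw [hC]
    linarith
  have hlow : ∀ t ≥ 0, ‖e t‖ ^ 2 + ‖d t‖ ^ 2 ≤ -W t := fun t ht => by
    have := h₂ (B t) (hB.norm_le t ht) (e t) (d t)
    simp only [hW]
    linarith
  -- Positivity at the identity makes `-W` a strict Lyapunov function, squeezed between multiples of
  -- `‖e‖² + ‖d‖²` by `hlow` and `hup`.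
  have hdecay := le_mul_exp_of_deriv_le (f := fun t => -W t) (f' := fun t => -w t)
    (a := -(c / (4 * C))) (fun t ht => (hw t ht).1.fun_neg) (fun t ht => by
      have h3 := mul_le_mul_of_nonneg_left (hup t ht) (show 0 ≤ c / (4 * C) by positivity)
      have h4 : c / (4 * C) * (C * (‖e t‖ ^ 2 + ‖d t‖ ^ 2)) = c / 4 * (‖e t‖ ^ 2 + ‖d t‖ ^ 2) := by
        field_simp
      linarith [(hw t ht).2]) ht
  have hQe : ‖(Q t).1 - 1‖ ≤ 4 * ‖e t‖ := by
    have := norm_sub_le_axial (Q t) 1 ((hnear t ht).trans (min_le_right _ _)) (by simp)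
    simpa [he] using this
  have heQ : ‖e 0‖ ≤ ‖(Q 0).1 - 1‖ := half_axial_norm_le _
  have h5 := pow_le_pow_left₀ (norm_nonneg _) hQe 2
  have h6 := pow_le_pow_left₀ (norm_nonneg _) heQ 2
  have hexp := Real.exp_pos (-(c / (4 * C)) * t)
  calc ‖(Q t).1 - 1‖ ^ 2 + ‖d t‖ ^ 2 ≤ 16 * (‖e t‖ ^ 2 + ‖d t‖ ^ 2) := by
        nlinarith [sq_nonneg ‖d t‖]
    _ ≤ 16 * (-W 0 * Real.exp (-(c / (4 * C)) * t)) := by linarith [hlow t ht]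
    _ ≤ 16 * (C * (‖e 0‖ ^ 2 + ‖d 0‖ ^ 2) * Real.exp (-(c / (4 * C)) * t)) := by
        gcongr
        exact hup 0 le_rfl
    _ ≤ 16 * (C * (‖(Q 0).1 - 1‖ ^ 2 + ‖d 0‖ ^ 2) * Real.exp (-(c / (4 * C)) * t)) := by
        gcongr
    _ = 16 * C * Real.exp (-(c / (4 * C)) * t) * (‖(Q 0).1 - 1‖ ^ 2 + ‖d 0‖ ^ 2) := by ring

/-- Determinant one and `q ≠ 1` leave exactly two signs `-1`. The coefficient at the remaining index
is minus the sum of two weights. -/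
lemma exists_hessCoef_neg {l : Fin 3 → ℝ} (hl : ∀ i, 0 ≤ l i) (hinj : Function.Injective l)
    {q : SO3} {s : Fin 3 → ℝ} (hs : ∀ i, s i ^ 2 = 1) (hq : q.1 = Matrix.diagonal s) (hne : q ≠ 1) :
    ∃ i, hessCoef (fun i => s i * l i) i < 0 := by
  have hp := hessCoef_pos hl hinj
  have hdet : s 0 * s 1 * s 2 = 1 := by
    have := SO3.det_eq q
    rw [hq, Matrix.det_diagonal, Fin.prod_univ_three] at this
    exact this
  have p0 : 0 < l 1 + l 2 := hp 0
  have p1 : 0 < l 2 + l 0 := hp 1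
  have p2 : 0 < l 0 + l 1 := hp 2
  rcases sq_eq_one_iff.mp (hs 0) with h0 | h0 <;>
  rcases sq_eq_one_iff.mp (hs 1) with h1 | h1 <;>
  rcases sq_eq_one_iff.mp (hs 2) with h2 | h2 <;>
  simp only [h0, h1, h2] at hdet <;> norm_num at hdet
  · refine absurd (Subtype.ext ?_) hne
    rw [hq, OneMemClass.coe_one, ← Matrix.diagonal_one]
    congr 1
    ext i
    fin_cases i <;> simp [h0, h1, h2]
  · refine ⟨0, ?_⟩
    simp only [hessCoef, Matrix.cons_val, h0, h1, h2]
    linarith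
  · refine ⟨1, ?_⟩
    simp only [hessCoef, Matrix.cons_val, h0, h1, h2]
    linarith
  · refine ⟨2, ?_⟩
    simp only [hessCoef, Matrix.cons_val, h0, h1, h2]
    linarith

/-- Two trajectories that stay close to a saddle point are separated by the coordinates transverse
to an unstable direction. -/
theorem exists_saddle_separation {l : Fin 3 → ℝ} (hl : ∀ i, 0 ≤ l i) (hinj : Function.Injective l)
    {κ : ℝ} (hκ : 0 < κ) (S P : D →L[ℝ] D) (hS : ∀ d, inner ℝ d (S d) = 0) {b b' c K : ℝ}
    (hb : 0 ≤ b) (hc : 0 < c) (hK : 0 ≤ K) {q : SO3} {s : Fin 3 → ℝ}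
    (hs : ∀ i, s i ^ 2 = 1) (hq : q.1 = Matrix.diagonal s) (hne : q ≠ 1) :
    ∃ r > 0, ∃ i : Fin 3, ∃ C > 0, ∀ B B' : ℝ → D →L[ℝ] Vec3,
      IsDetectableOutput S P b b' c K B B' →
      ∀ (Q₁ Q₂ : ℝ → SO3) (d₁ d₂ : ℝ → D), IsErrTraj l κ S B Q₁ d₁ → IsErrTraj l κ S B Q₂ d₂ →
      ∀ T ≥ 0, (∀ t ≥ T, dist (Q₁ t) q ≤ r ∧ ‖d₁ t‖ ≤ r) →
        (∀ t ≥ T, dist (Q₂ t) q ≤ r ∧ ‖d₂ t‖ ≤ r) →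
        ‖(Q₁ T).1 - (Q₂ T).1‖ ^ 2 + ‖d₁ T - d₂ T‖ ^ 2 ≤
          C * (‖(1 / 2 : ℝ) • axial (q.1 * ((Q₁ T).1 - (Q₂ T).1))‖ ^ 2
            - ((1 / 2 : ℝ) • axial (q.1 * ((Q₁ T).1 - (Q₂ T).1))) i ^ 2 + ‖d₁ T - d₂ T‖ ^ 2) := by
  obtain ⟨i, hi⟩ := exists_hessCoef_neg hl hinj hs hq hne
  set n := fun i => s i * l i with hn
  obtain ⟨Mb₁, h₁⟩ := exists_pairForm_growth n (signed_add_ne_zero hl hinj hs) hκ S P hS hb hc hK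
  obtain ⟨Mb₂, h₂⟩ := exists_le_of_pairForm_nonpos n i hi P hκ hK hb
  set M₀ := max (max Mb₁ Mb₂) 0 with hM
  have hM0 : 0 ≤ M₀ := le_max_right _ _
  obtain ⟨r, hr, h₁⟩ := h₁ M₀ ((le_max_left _ _).trans (le_max_left _ _))
  obtain ⟨C, hC, h₂⟩ := h₂ M₀ ((le_max_right _ _).trans (le_max_left _ _))
  refine ⟨min r (1 / 2), by positivity, i, 16 * C, by positivity, ?_⟩
  intro B B' hB Q₁ Q₂ d₁ d₂ T₁ T₂ T hT N₁ N₂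
  have hsub : ∀ t, ((q * Q₁ t : SO3) : Mat3) - ((q * Q₂ t : SO3) : Mat3)
      = q.1 * ((Q₁ t).1 - (Q₂ t).1) := fun t => (Matrix.mul_sub _ _ _).symm
  set e : ℝ → Vec3 := fun t => (1 / 2 : ℝ) • axial (q.1 * ((Q₁ t).1 - (Q₂ t).1)) with he
  set d : ℝ → D := fun t => d₁ t - d₂ t with hd
  set W : ℝ → ℝ := fun t => pairForm (hess n) P κ M₀ K (B t) (e t) (d t) with hW
  have hder : ∀ t ≥ T, ∃ w, HasDerivWithinAt W w (Set.Ici 0) t ∧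
      c / 4 * (‖e t‖ ^ 2 + ‖d t‖ ^ 2) ≤ w := by
    intro t ht
    have := h₁ B B' hB _ _ _ _ (T₁.translate hs hq) (T₂.translate hs hq) t (hT.trans ht)
      (by rw [dist_eq_norm_mul_sub_one hs hq]; exact (N₁ t ht).1.trans (min_le_left _ _))
      (by rw [dist_eq_norm_mul_sub_one hs hq]; exact (N₂ t ht).1.trans (min_le_left _ _))
      ((N₂ t ht).2.trans (min_le_left _ _))
    simpa only [hsub] using this
  set Cu := M₀ / 2 * (‖hess n‖ + 1 / κ) + (K * b + ‖P‖) + 1 with hCu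
  have hCu0 : 0 < Cu := by positivity
  have hup : ∀ t ≥ T, W t ≤ Cu * (‖e t‖ ^ 2 + ‖d t‖ ^ 2) := fun t ht => by
    have h3 := (abs_le.mp (abs_pairForm_le n P hκ hM0 hK (B t) (hB.norm_le t (hT.trans ht))
      (e t) (d t))).2
    have h4 : 0 ≤ ‖e t‖ ^ 2 + ‖d t‖ ^ 2 := by positivity
    simp only [hW]
    rw [hCu]
    linarith
  have hsize : ∀ t ≥ T, ‖e t‖ ^ 2 + ‖d t‖ ^ 2 ≤ 4 ^ 2 + 1 ^ 2 := fun t ht => by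
    have h3 : ‖e t‖ ≤ 4 := by
      refine (half_axial_norm_le _).trans ?_
      rw [norm_SO3_mul]
      have h5 := norm_sub_le (Q₁ t).1 (Q₂ t).1
      linarith [norm_SO3_le (Q₁ t), norm_SO3_le (Q₂ t)]
    have h4 : ‖d t‖ ≤ 1 := by
      have h5 := norm_sub_le (d₁ t) (d₂ t)
      have h6 := (N₁ t ht).2.trans (min_le_right _ _)
      have h7 := (N₂ t ht).2.trans (min_le_right _ _)
      simp only [hd]
      linarith
    exact add_le_add (pow_le_pow_left₀ (norm_nonneg _) h3 2) (pow_le_pow_left₀ (norm_nonneg _) h4 2)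
  -- A positive value of `W` would persist, and `W ≤ Cu (‖e‖² + ‖d‖²)` would then force at least
  -- linear growth, contradicting the uniform bound on trajectories that stay near the saddle.
  have hWT : W T ≤ 0 := by
    by_contra hcon
    push Not at hcon
    have hmono : ∀ t ≥ T, W T ≤ W t := fun t ht => by
      have := mul_sub_le_of_exists_deriv (c := 0) hT ht (fun τ h1 _ => by
        obtain ⟨w, hw1, hw2⟩ := hder τ h1
        exact ⟨w, hw1, le_trans (by positivity) hw2⟩)
      linarith
    set a := c / (4 * Cu) * W T with ha
    have ha0 : 0 < a := by positivity
    have hgrow : ∀ t ≥ T, a * (t - T) ≤ W t - W T := fun t ht =>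
      mul_sub_le_of_exists_deriv hT ht (fun τ h1 _ => by
        obtain ⟨w, hw1, hw2⟩ := hder τ h1
        refine ⟨w, hw1, le_trans ?_ hw2⟩
        have h3 := mul_le_mul_of_nonneg_left ((hmono τ h1).trans (hup τ h1))
          (show 0 ≤ c / (4 * Cu) by positivity)
        have h4 : c / (4 * Cu) * (Cu * (‖e τ‖ ^ 2 + ‖d τ‖ ^ 2))
            = c / 4 * (‖e τ‖ ^ 2 + ‖d τ‖ ^ 2) := by
          field_simp
        linarith)
    set t := T + (Cu * (4 ^ 2 + 1 ^ 2)) / a with htdef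
    have htT : t ≥ T := le_add_of_nonneg_right (by positivity)
    have h3 := hgrow t htT
    have h4 := (hup t htT).trans (mul_le_mul_of_nonneg_left (hsize t htT) hCu0.le)
    have h5 : a * (t - T) = Cu * (4 ^ 2 + 1 ^ 2) := by
      rw [htdef, add_sub_cancel_left]
      field_simp
    linarith
  have hfin := h₂ (B T) (hB.norm_le T hT) (e T) (d T) hWT
  have hQe := norm_sub_le_axial (q * Q₁ T) (q * Q₂ T)
    (by rw [dist_eq_norm_mul_sub_one hs hq]; exact (N₁ T le_rfl).1.trans (min_le_right _ _))
    (by rw [dist_eq_norm_mul_sub_one hs hq]; exact (N₂ T le_rfl).1.trans (min_le_right _ _))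
  rw [hsub, norm_SO3_mul] at hQe
  have h5 := pow_le_pow_left₀ (norm_nonneg _) hQe 2
  have h6 : (4 * ‖(1 / 2 : ℝ) • axial (q.1 * ((Q₁ T).1 - (Q₂ T).1))‖) ^ 2 = 16 * ‖e T‖ ^ 2 := by
    simp only [he]
    ring
  rw [h6] at h5
  change ‖(Q₁ T).1 - (Q₂ T).1‖ ^ 2 + ‖d T‖ ^ 2
    ≤ 16 * C * (‖e T‖ ^ 2 - (e T) i ^ 2 + ‖d T‖ ^ 2)
  nlinarith [sq_nonneg ‖d T‖]

lemma norm_rotField_sub_le (l : Fin 3 → ℝ) {b M : ℝ} (B : D →L[ℝ] Vec3) (hB : ‖B‖ ≤ b)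
    (Q₁ Q₂ : SO3) (d₁ d₂ : D) (hd₁ : ‖d₁‖ ≤ M) :
    ‖rotField l B Q₁.1 d₁ - rotField l B Q₂.1 d₂‖
      ≤ (4 * ‖(Matrix.diagonal l : Mat3)‖ + 2 * b * M) * ‖Q₁.1 - Q₂.1‖ + 4 * b * ‖d₁ - d₂‖ := by
  have hb : 0 ≤ b := (norm_nonneg _).trans hB
  have e : rotField l B Q₁.1 d₁ - rotField l B Q₂.1 d₂
      = -((Q₁.1 - Q₂.1) * Matrix.diagonal l * Q₁.1) - Q₂.1 * Matrix.diagonal l * (Q₁.1 - Q₂.1)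
        - (Q₁.1 - Q₂.1) * hatL (B d₁) - Q₂.1 * hatL (B (d₁ - d₂)) := by
    simp only [rotField, map_sub]
    noncomm_ring
  rw [e]
  set X := Q₁.1 - Q₂.1
  set k := ‖(Matrix.diagonal l : Mat3)‖
  have hk0 : 0 ≤ k := norm_nonneg _
  have hBn : ∀ z, ‖B z‖ ≤ b * ‖z‖ := fun z => B.le_of_opNorm_le hB z
  have n1 : ‖X * Matrix.diagonal l * Q₁.1‖ ≤ ‖X‖ * k * 2 :=
    (Matrix.frobenius_norm_mul _ _).trans (mul_le_mul (Matrix.frobenius_norm_mul _ _)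
      (norm_SO3_le _) (norm_nonneg _) (by positivity))
  have n2 : ‖Q₂.1 * Matrix.diagonal l * X‖ ≤ 2 * k * ‖X‖ :=
    (Matrix.frobenius_norm_mul _ _).trans (mul_le_mul_of_nonneg_right
      ((Matrix.frobenius_norm_mul _ _).trans (mul_le_mul_of_nonneg_right (norm_SO3_le _) hk0))
        (norm_nonneg _))
  have n3 : ‖X * hatL (B d₁)‖ ≤ ‖X‖ * (2 * (b * M)) :=
    (Matrix.frobenius_norm_mul _ _).trans (mul_le_mul_of_nonneg_left ((norm_hatL_le _).trans
      (mul_le_mul_of_nonneg_left ((hBn _).trans (mul_le_mul_of_nonneg_left hd₁ hb))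
        zero_le_two)) (norm_nonneg _))
  have n4 : ‖Q₂.1 * hatL (B (d₁ - d₂))‖ ≤ 2 * (2 * (b * ‖d₁ - d₂‖)) :=
    (Matrix.frobenius_norm_mul _ _).trans (mul_le_mul (norm_SO3_le _) ((norm_hatL_le _).trans
      (mul_le_mul_of_nonneg_left (hBn _) zero_le_two)) (norm_nonneg _) zero_le_two)
  have m1 := norm_sub_le (-(X * Matrix.diagonal l * Q₁.1) - Q₂.1 * Matrix.diagonal l * X
    - X * hatL (B d₁)) (Q₂.1 * hatL (B (d₁ - d₂)))
  have m2 := norm_sub_le (-(X * Matrix.diagonal l * Q₁.1) - Q₂.1 * Matrix.diagonal l * X)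
    (X * hatL (B d₁))
  have m3 := norm_sub_le (-(X * Matrix.diagonal l * Q₁.1)) (Q₂.1 * Matrix.diagonal l * X)
  rw [norm_neg] at m3
  linarith only [n1, n2, n3, n4, m1, m2, m3]

lemma norm_vecField_sub_le (l : Fin 3 → ℝ) {κ b : ℝ} (hκ : 0 ≤ κ) (S : D →L[ℝ] D)
    (B : D →L[ℝ] Vec3) (hB : ‖B‖ ≤ b) (Q₁ Q₂ : Mat3) (d₁ d₂ : D) :
    ‖vecField l κ S B Q₁ d₁ - vecField l κ S B Q₂ d₂‖
      ≤ ‖S‖ * ‖d₁ - d₂‖ + κ * b * (2 * ‖(Matrix.diagonal l : Mat3)‖) * ‖Q₁ - Q₂‖ := by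
  have hb : 0 ≤ b := (norm_nonneg _).trans hB
  have e : vecField l κ S B Q₁ d₁ - vecField l κ S B Q₂ d₂
      = S (d₁ - d₂) + κ • (ContinuousLinearMap.adjoint B)
        (axial (Matrix.diagonal l * (Q₁ - Q₂))) := by
    simp only [vecField, map_sub, Matrix.mul_sub]
    module
  rw [e]
  have n1 : ‖axial (Matrix.diagonal l * (Q₁ - Q₂))‖
      ≤ 2 * (‖(Matrix.diagonal l : Mat3)‖ * ‖Q₁ - Q₂‖) :=
    (norm_axial_le _).trans (mul_le_mul_of_nonneg_left (Matrix.frobenius_norm_mul _ _) zero_le_two)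
  have n2 := ((ContinuousLinearMap.adjoint B).le_of_opNorm_le (by simpa using hB)
    (axial (Matrix.diagonal l * (Q₁ - Q₂)))).trans (mul_le_mul_of_nonneg_left n1 hb)
  have n3 := norm_add_le (S (d₁ - d₂)) (κ • (ContinuousLinearMap.adjoint B)
    (axial (Matrix.diagonal l * (Q₁ - Q₂))))
  rw [norm_smul, Real.norm_eq_abs, abs_of_nonneg hκ] at n3
  have n4 := mul_le_mul_of_nonneg_left n2 hκ
  have n5 := S.le_opNorm (d₁ - d₂)
  linarith only [n3, n4, n5]

/-- Backward Gronwall estimate for pairs of trajectories. -/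
theorem exists_backward_estimate (l : Fin 3 → ℝ) {κ b M : ℝ} (hκ : 0 ≤ κ) (hb : 0 ≤ b)
    (hM : 0 ≤ M) (S : D →L[ℝ] D) :
    ∃ L : ℝ, ∀ B : ℝ → D →L[ℝ] Vec3, (∀ t ≥ 0, ‖B t‖ ≤ b) →
      ∀ (Q₁ Q₂ : ℝ → SO3) (d₁ d₂ : ℝ → D), IsErrTraj l κ S B Q₁ d₁ → IsErrTraj l κ S B Q₂ d₂ →
      (∀ t ≥ 0, ‖d₁ t‖ ≤ M) → ∀ t ≥ 0,
        ‖(Q₁ 0).1 - (Q₂ 0).1‖ ^ 2 + ‖d₁ 0 - d₂ 0‖ ^ 2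
          ≤ (‖(Q₁ t).1 - (Q₂ t).1‖ ^ 2 + ‖d₁ t - d₂ t‖ ^ 2) * Real.exp (L * t) := by
  set k := ‖(Matrix.diagonal l : Mat3)‖ with hk
  have hk0 : 0 ≤ k := norm_nonneg _
  set g := 4 * k + 2 * b * M + 4 * b + ‖S‖ + κ * b * (2 * k) with hg
  have hg0 : 0 ≤ g := by positivity
  -- From `2⟨x, x'⟩ ≥ -(‖x‖² + ‖x'‖²)`: each of the two derivatives has squared norm at most `2 g²`
  -- times the squared distance.
  refine ⟨1 + 4 * g ^ 2, fun B hB Q₁ Q₂ d₁ d₂ T₁ T₂ hd₁ t ht => ?_⟩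
  set E : ℝ → Mat3 := fun t => (Q₁ t).1 - (Q₂ t).1 with hE
  set d : ℝ → D := fun t => d₁ t - d₂ t with hd
  set E' : ℝ → Mat3 := fun t => rotField l (B t) (Q₁ t).1 (d₁ t) - rotField l (B t) (Q₂ t).1 (d₂ t)
    with hE'
  set d' : ℝ → D := fun t => vecField l κ S (B t) (Q₁ t).1 (d₁ t)
    - vecField l κ S (B t) (Q₂ t).1 (d₂ t) with hd'
  have hEd : ∀ t ≥ 0, HasDerivWithinAt E (E' t) (Set.Ici 0) t := fun t ht =>
    (T₁.rot t ht).fun_sub (T₂.rot t ht)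
  have hdd : ∀ t ≥ 0, HasDerivWithinAt d (d' t) (Set.Ici 0) t := fun t ht =>
    (T₁.vec t ht).fun_sub (T₂.vec t ht)
  have hN : ∀ t ≥ 0, HasDerivWithinAt (fun t => ‖E t‖ ^ 2 + ‖d t‖ ^ 2)
      ((∑ i, ∑ j, 2 * E t i j * E' t i j) + 2 * inner ℝ (d t) (d' t)) (Set.Ici 0) t := fun t ht => by
    refine HasDerivWithinAt.fun_add ?_ (hdd t ht).norm_sq
    simp only [frobenius_norm_sq]
    refine HasDerivWithinAt.fun_sum fun i _ => HasDerivWithinAt.fun_sum fun j _ => ?_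
    refine ((hasDerivWithinAt_matrix_iff.mp (hEd t ht) i j).fun_pow 2).congr_deriv ?_
    ring
  have hEn : ∀ t ≥ 0, ‖E' t‖ ≤ g * (‖E t‖ + ‖d t‖) := fun t ht => by
    have h1 : ‖E' t‖ ≤ (4 * k + 2 * b * M) * ‖E t‖ + 4 * b * ‖d t‖ :=
      norm_rotField_sub_le l (B t) (hB t ht) (Q₁ t) (Q₂ t) (d₁ t) (d₂ t) (hd₁ t ht)
    have p1 : 0 ≤ 4 * b * ‖E t‖ := by positivity
    have p2 : 0 ≤ (4 * k + 2 * b * M) * ‖d t‖ := by positivity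
    have p3 : 0 ≤ (‖S‖ + κ * b * (2 * k)) * (‖E t‖ + ‖d t‖) := by positivity
    rw [hg]
    linarith only [h1, p1, p2, p3]
  have hdn : ∀ t ≥ 0, ‖d' t‖ ≤ g * (‖E t‖ + ‖d t‖) := fun t ht => by
    have h1 : ‖d' t‖ ≤ ‖S‖ * ‖d t‖ + κ * b * (2 * k) * ‖E t‖ :=
      norm_vecField_sub_le l hκ S (B t) (hB t ht) (Q₁ t).1 (Q₂ t).1 (d₁ t) (d₂ t)
    have p1 : 0 ≤ (4 * k + 2 * b * M + 4 * b) * (‖E t‖ + ‖d t‖) := by positivity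
    have p2 : 0 ≤ ‖S‖ * ‖E t‖ := by positivity
    have p3 : 0 ≤ κ * b * (2 * k) * ‖d t‖ := by positivity
    rw [hg]
    linarith only [h1, p1, p2, p3]
  refine le_mul_exp_of_neg_le_deriv hN (fun t ht => ?_) ht
  have h1 : -(‖E t‖ ^ 2 + ‖E' t‖ ^ 2) ≤ ∑ i, ∑ j, 2 * E t i j * E' t i j := by
    rw [frobenius_norm_sq, frobenius_norm_sq, ← Finset.sum_add_distrib, ← Finset.sum_neg_distrib]
    refine Finset.sum_le_sum fun i _ => ?_
    rw [← Finset.sum_add_distrib, ← Finset.sum_neg_distrib]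
    refine Finset.sum_le_sum fun j _ => ?_
    nlinarith only [sq_nonneg (E t i j + E' t i j)]
  have h2 : -(‖d t‖ ^ 2 + ‖d' t‖ ^ 2) ≤ 2 * inner ℝ (d t) (d' t) := by
    have := (abs_le.mp (abs_real_inner_le_norm (d t) (d' t))).1
    linarith only [this, sq_nonneg (‖d t‖ - ‖d' t‖)]
  have h3 := pow_le_pow_left₀ (norm_nonneg _) (hEn t ht) 2
  have h4 := pow_le_pow_left₀ (norm_nonneg _) (hdn t ht) 2
  have h5 : (g * (‖E t‖ + ‖d t‖)) ^ 2 ≤ 2 * g ^ 2 * (‖E t‖ ^ 2 + ‖d t‖ ^ 2) := by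
    linarith only [mul_nonneg (sq_nonneg g) (sq_nonneg (‖E t‖ - ‖d t‖))]
  linarith only [h1, h2, h3, h4, h5]

end Local

/-! ### Hausdorff dimension of the exceptional initial errors -/

lemma dimH_le_finrank_of_dist_le {X F : Type*} [MetricSpace X] [NormedAddCommGroup F]
    [NormedSpace ℝ F] [FiniteDimensional ℝ F] (A : Set X) (f : A → F) {C : ℝ} (hC : 0 ≤ C)
    (hf : ∀ p p' : A, dist (p : X) p' ≤ C * dist (f p) (f p')) :
    dimH A ≤ Module.finrank ℝ F := by
  have hanti : AntilipschitzWith C.toNNReal f := AntilipschitzWith.of_le_mul_dist fun p p' => by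
    rw [Real.coe_toNNReal _ hC]
    exact hf p p'
  calc dimH A = dimH (Subtype.val '' (Set.univ : Set A)) := by simp
    _ = dimH (Set.univ : Set A) := isometry_subtype_coe.dimH_image _
    _ ≤ dimH (f '' Set.univ) := hanti.le_dimH_image _
    _ ≤ dimH (Set.univ : Set F) := dimH_mono (Set.subset_univ _)
    _ = Module.finrank ℝ F := Real.dimH_univ_eq_finrank F

/-- The initial errors whose trajectory fails to converge to the desired equilibrium form a set of
Hausdorff dimension at most `dim (SO(3) × D) - 1`. -/
theorem dimH_not_tendsto_le {D : Type*} [NormedAddCommGroup D] [InnerProductSpace ℝ D]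
    [FiniteDimensional ℝ D] [CompleteSpace D] {l : Fin 3 → ℝ} (hl : ∀ i, 0 ≤ l i)
    (hinj : Function.Injective l) {κ : ℝ} (hκ : 0 < κ) (S P : D →L[ℝ] D)
    (hS : ∀ d, inner ℝ d (S d) = 0) {b b' c K : ℝ} (hc : 0 < c) (hK : 0 ≤ K)
    {B B' : ℝ → D →L[ℝ] Vec3} (hB : IsDetectableOutput S P b b' c K B B') :
    dimH {p : SO3 × D | ∃ (Q : ℝ → SO3) (d : ℝ → D), IsErrTraj l κ S B Q d ∧ Q 0 = p.1 ∧ d 0 = p.2 ∧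
      ¬(Tendsto (fun t => dist (Q t) 1) atTop (𝓝 0) ∧ Tendsto d atTop (𝓝 0))}
      ≤ (2 + Module.finrank ℝ D : ℕ) := by
  have hb : 0 ≤ b := (norm_nonneg _).trans (hB.norm_le 0 le_rfl)
  set E := {q : SO3 | ∃ s : Fin 3 → ℝ, (∀ i, s i ^ 2 = 1) ∧ q.1 = Matrix.diagonal s} with hE
  have hsep : ∀ q : SO3, ∃ (r : ℝ) (i : Fin 3) (C : ℝ), 0 < r ∧ 0 < C ∧ (q ∈ E \ {1} →
      ∀ (Q₁ Q₂ : ℝ → SO3) (d₁ d₂ : ℝ → D), IsErrTraj l κ S B Q₁ d₁ → IsErrTraj l κ S B Q₂ d₂ →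
      ∀ T ≥ 0, (∀ t ≥ T, dist (Q₁ t) q ≤ r ∧ ‖d₁ t‖ ≤ r) →
        (∀ t ≥ T, dist (Q₂ t) q ≤ r ∧ ‖d₂ t‖ ≤ r) →
        ‖(Q₁ T).1 - (Q₂ T).1‖ ^ 2 + ‖d₁ T - d₂ T‖ ^ 2 ≤
          C * (‖(1 / 2 : ℝ) • axial (q.1 * ((Q₁ T).1 - (Q₂ T).1))‖ ^ 2
            - ((1 / 2 : ℝ) • axial (q.1 * ((Q₁ T).1 - (Q₂ T).1))) i ^ 2
            + ‖d₁ T - d₂ T‖ ^ 2)) := by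
    intro q
    by_cases hq : q ∈ E \ {1}
    · obtain ⟨⟨s, hs, hqs⟩, hne⟩ := hq
      obtain ⟨r, hr, i, C, hC, H⟩ := exists_saddle_separation hl hinj hκ S P hS hb hc hK hs hqs hne
      exact ⟨r, i, C, hr, hC, fun _ => H B B' hB⟩
    · exact ⟨1, 0, 1, one_pos, one_pos, fun h => absurd h hq⟩
  choose r i C hr hC hsep using hsep
  -- A single integer `N` bounds both the entrance time and the size of `d`, so the union is
  -- countable and all constants are uniform on each piece.
  set Z : SO3 → ℕ → Set (SO3 × D) := fun q N => {p | ∃ (Q : ℝ → SO3) (d : ℝ → D),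
    IsErrTraj l κ S B Q d ∧ Q 0 = p.1 ∧ d 0 = p.2 ∧
      (∀ t ≥ (N : ℝ), dist (Q t) q ≤ r q ∧ ‖d t‖ ≤ r q) ∧ ∀ t ≥ 0, ‖d t‖ ≤ N} with hZ
  have hcover : {p : SO3 × D | ∃ (Q : ℝ → SO3) (d : ℝ → D), IsErrTraj l κ S B Q d ∧ Q 0 = p.1 ∧
      d 0 = p.2 ∧ ¬(Tendsto (fun t => dist (Q t) 1) atTop (𝓝 0) ∧ Tendsto d atTop (𝓝 0))}
      ⊆ ⋃ q ∈ E \ {1}, ⋃ N : ℕ, Z q N := by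
    rintro p ⟨Q, d, hT, hQ0, hd0, hnot⟩
    obtain ⟨q, hq, hQ, hd⟩ := hT.exists_tendsto hl hinj hκ hS hc hK hB
    have hne : q ≠ 1 := fun h => hnot ⟨h ▸ hQ, hd⟩
    obtain ⟨M, hM⟩ := hT.exists_norm_le hl hinj hκ hS
    have hdn := tendsto_zero_iff_norm_tendsto_zero.mp hd
    obtain ⟨T, hTT⟩ := ((hQ.eventually (gt_mem_nhds (hr q))).and
      (hdn.eventually (gt_mem_nhds (hr q)))).exists_forall_of_atTop
    obtain ⟨N, hN⟩ := exists_nat_ge (max M T)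
    refine Set.mem_biUnion (show q ∈ E \ {1} from ⟨hq, hne⟩) (Set.mem_iUnion.mpr ⟨N, Q, d, hT, hQ0,
      hd0, fun t ht => ?_, fun t ht => (hM t ht).trans ((le_max_left _ _).trans hN)⟩)
    have := hTT t (((le_max_right _ _).trans hN).trans ht)
    exact ⟨this.1.le, this.2.le⟩
  refine (dimH_mono hcover).trans ?_
  rw [dimH_bUnion (finite_diagonal_SO3.subset Set.sdiff_subset).countable]
  refine iSup₂_le fun q hq => ?_
  rw [dimH_iUnion]
  refine iSup_le fun N => ?_
  obtain ⟨L, hL⟩ := exists_backward_estimate l hκ.le hb (Nat.cast_nonneg N) S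
  choose Q d hT hQ0 hd0 hnear hbound using fun p : Z q N => p.2
  -- The transverse coordinates at time `N`: one component of the axial vector is dropped, the one
  -- controlled by the cone condition.
  set f : Z q N → (Fin 2 → ℝ) × D := fun p =>
    (fun k => ((1 / 2 : ℝ) • axial (q.1 * (Q p N).1)) ((i q).succAbove k), d p N) with hf
  have hfin : Module.finrank ℝ ((Fin 2 → ℝ) × D) = 2 + Module.finrank ℝ D := by
    rw [Module.finrank_prod, Module.finrank_fin_fun]
  rw [← hfin]
  -- In the sup metric the two kept coordinates and `d` contribute at most `3 δ²`. The exponential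
  -- transports the separation from time `N` back to time `0`.
  refine dimH_le_finrank_of_dist_le (Z q N) f (C := Real.sqrt (3 * C q * Real.exp (L * N)))
    (Real.sqrt_nonneg _) fun p p' => ?_
  have hN0 : (0 : ℝ) ≤ N := Nat.cast_nonneg N
  have h1 := hL B hB.norm_le (Q p) (Q p') (d p) (d p') (hT p) (hT p') (hbound p) N hN0
  have h2 := hsep q hq (Q p) (Q p') (d p) (d p') (hT p) (hT p') N hN0 (hnear p) (hnear p')
  set δ := dist (f p) (f p') with hδ
  have hδ0 : 0 ≤ δ := dist_nonneg
  have h3 : ‖d p N - d p' N‖ ≤ δ := by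
    rw [← dist_eq_norm]
    exact le_max_right _ _
  set e := (1 / 2 : ℝ) • axial (q.1 * ((Q p N).1 - (Q p' N).1)) with he
  have h4 : ∀ k, |e ((i q).succAbove k)| ≤ δ := fun k => by
    have h5 : dist ((f p).1 k) ((f p').1 k) ≤ δ := (dist_le_pi_dist _ _ k).trans (le_max_left _ _)
    rw [Real.dist_eq] at h5
    convert h5 using 2
    simp only [hf, he, Matrix.mul_sub, map_sub, smul_sub]
    rfl
  have h5 : ‖e‖ ^ 2 - e (i q) ^ 2 ≤ 2 * δ ^ 2 := by
    rw [EuclideanSpace.norm_sq_eq, Fin.sum_univ_succAbove _ (i q), Fin.sum_univ_two]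
    have k0 := sq_le_sq' (abs_le.mp (h4 0)).1 (abs_le.mp (h4 0)).2
    have k1 := sq_le_sq' (abs_le.mp (h4 1)).1 (abs_le.mp (h4 1)).2
    simp only [Real.norm_eq_abs, sq_abs]
    linarith
  have h6 := pow_le_pow_left₀ (norm_nonneg _) h3 2
  have h7 : ‖(Q p 0).1 - (Q p' 0).1‖ ^ 2 + ‖d p 0 - d p' 0‖ ^ 2
      ≤ 3 * C q * Real.exp (L * N) * δ ^ 2 := by
    refine h1.trans ?_
    have h8 : ‖(Q p N).1 - (Q p' N).1‖ ^ 2 + ‖d p N - d p' N‖ ^ 2 ≤ C q * (3 * δ ^ 2) :=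
      h2.trans (mul_le_mul_of_nonneg_left (by linarith) (hC q).le)
    have := mul_le_mul_of_nonneg_right h8 (Real.exp_pos (L * N)).le
    linarith
  have h8 : (3 * C q * Real.exp (L * N) * δ ^ 2) = (Real.sqrt (3 * C q * Real.exp (L * N)) * δ) ^ 2 := by
    rw [mul_pow, Real.sq_sqrt (by have := hC q; positivity)]
  rw [h8] at h7
  have h9 : dist (p : SO3 × D) p' = max (dist p.1.1 p'.1.1) (dist p.1.2 p'.1.2) := rfl
  rw [h9]
  refine max_le ?_ ?_
  · rw [← hQ0 p, ← hQ0 p', dist_SO3]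
    refine le_of_sq_le_sq ?_ (by positivity)
    nlinarith [sq_nonneg ‖d p 0 - d p' 0‖]
  · rw [← hd0 p, ← hd0 p', dist_eq_norm]
    refine le_of_sq_le_sq ?_ (by positivity)
    nlinarith [sq_nonneg ‖(Q p 0).1 - (Q p' 0).1‖]

/-! ### From the closed loop to the error system -/

/-- The operator of a rectangular matrix on Euclidean spaces. -/
noncomputable def matOp (p q : ℕ) :
    Matrix (Fin p) (Fin q) ℝ →ₗ[ℝ] (EuclideanSpace ℝ (Fin q) →L[ℝ] EuclideanSpace ℝ (Fin p)) :=
  (LinearMap.toContinuousLinearMap (𝕜 := ℝ) (E := EuclideanSpace ℝ (Fin q))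
    (F' := EuclideanSpace ℝ (Fin p))).toLinearMap ∘ₗ (Matrix.toLpLin 2 2).toLinearMap

lemma matOp_apply {p q : ℕ} (M : Matrix (Fin p) (Fin q) ℝ) (v : EuclideanSpace ℝ (Fin q)) :
    matOp p q M v = WithLp.toLp 2 (M *ᵥ v.ofLp) := rfl

lemma inner_toLp {p : ℕ} (u v : EuclideanSpace ℝ (Fin p)) : inner ℝ u v = u.ofLp ⬝ᵥ v.ofLp := by
  simp [PiLp.inner_apply, dotProduct, mul_comm]

lemma adjoint_matOp {p q : ℕ} (M : Matrix (Fin p) (Fin q) ℝ) :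
    ContinuousLinearMap.adjoint (matOp p q M) = matOp q p Mᵀ := by
  symm
  rw [ContinuousLinearMap.eq_adjoint_iff]
  intro u v
  rw [inner_toLp, inner_toLp, matOp_apply, matOp_apply, Matrix.dotProduct_mulVec,
    Matrix.mulVec_transpose]

/-- `matOp` on `3 × 3` matrices as a continuous linear map. -/
noncomputable def rotOp : Mat3 →L[ℝ] (Vec3 →L[ℝ] Vec3) := LinearMap.toContinuousLinearMap (matOp 3 3)

lemma rotOp_apply (M : Mat3) (v : Vec3) : rotOp M v = WithLp.toLp 2 (M *ᵥ v.ofLp) := rfl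

lemma norm_rotOp_transpose (R : SO3) (v : Vec3) : ‖rotOp R.1ᵀ v‖ = ‖v‖ := by
  rw [← sq_eq_sq₀ (norm_nonneg _) (norm_nonneg _), ← real_inner_self_eq_norm_sq,
    ← real_inner_self_eq_norm_sq, inner_toLp, inner_toLp, rotOp_apply,
    Matrix.dotProduct_mulVec, Matrix.vecMul_transpose, Matrix.mulVec_mulVec, SO3.mul_transpose,
    Matrix.one_mulVec]

/-- The transpose of a rotation. -/
def SO3.tr (R : SO3) : SO3 := ⟨R.1ᵀ, (mem_SO3_iff _).mpr ⟨by
  rw [Matrix.transpose_transpose, SO3.transpose_mul], by rw [Matrix.det_transpose, SO3.det_eq]⟩⟩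

/-- The moving frame `R_d X_rᵀ U` in which the error system is written. -/
def frameRot (U Xr Rd : SO3) : SO3 := Rd * (SO3.tr Xr) * U

lemma coe_frameRot (U Xr Rd : SO3) : (frameRot U Xr Rd).1 = Rd.1 * Xr.1ᵀ * U.1 := rfl

/-- The rotation error `Uᵀ Rᵀ R_d X_rᵀ U`. -/
def errRot (U Xr R Rd : SO3) : SO3 := SO3.tr (R * U) * frameRot U Xr Rd

lemma coe_errRot (U Xr R Rd : SO3) :
    (errRot U Xr R Rd).1 = U.1ᵀ * (R.1ᵀ * Rd.1 * Xr.1ᵀ) * U.1 := by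
  change (R.1 * U.1)ᵀ * (Rd.1 * Xr.1ᵀ * U.1) = _
  simp only [Matrix.transpose_mul, Matrix.mul_assoc]

/-- The output map of the error system. -/
noncomputable def outMap {m : ℕ} (C : Matrix (Fin 3) (Fin m) ℝ) (U Xr Rd : SO3) :
    EuclideanSpace ℝ (Fin m) →L[ℝ] Vec3 :=
  (rotOp (frameRot U Xr Rd).1ᵀ) ∘L (matOp 3 m C)

lemma outMap_apply {m : ℕ} (C : Matrix (Fin 3) (Fin m) ℝ) (U Xr Rd : SO3)
    (d : EuclideanSpace ℝ (Fin m)) :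
    (outMap C U Xr Rd d).ofLp = (frameRot U Xr Rd).1ᵀ *ᵥ (C *ᵥ d.ofLp) := rfl

lemma norm_outMap_apply {m : ℕ} (C : Matrix (Fin 3) (Fin m) ℝ) (U Xr Rd : SO3)
    (d : EuclideanSpace ℝ (Fin m)) : ‖outMap C U Xr Rd d‖ = ‖matOp 3 m C d‖ :=
  norm_rotOp_transpose _ _

section Conversion

variable {m ν : ℕ} (C : Matrix (Fin 3) (Fin m) ℝ) (S : Matrix (Fin m) (Fin m) ℝ)
  (kp kI : ℝ) (Xr : SO3) (y₀ : Fin ν → Fin 3 → ℝ)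

lemma hat_cross (a b : Fin 3 → ℝ) :
    hat (a ⨯₃ b) = Matrix.vecMulVec b a - Matrix.vecMulVec a b := by
  ext i j
  fin_cases i <;> fin_cases j <;> simp [hat, cross_apply, Matrix.vecMulVec_apply] <;> ring

lemma yMeas_eq (R Rd : SO3) (i : Fin ν) :
    yMeas y₀ R Rd i = (R.1ᵀ * Rd.1 * Xr.1ᵀ) *ᵥ yRef Xr y₀ i := by
  rw [yMeas, yRef, Matrix.mulVec_mulVec, Matrix.mul_assoc, SO3.transpose_mul, Matrix.mul_one]

lemma Ymat_transpose : (Ymat kp Xr y₀)ᵀ = Ymat kp Xr y₀ := by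
  rw [Ymat, Matrix.transpose_smul, Matrix.transpose_sum]
  simp only [Matrix.transpose_vecMulVec]

/-- By `hat_cross` each summand is a difference of rank-one matrices with `y_i = q y_iʳ`, `q = Rᵀ
R_d X_rᵀ`. The symmetric parts `y_iʳ y_iʳᵀ` cancel, and the sum assembles into `q Y - Y qᵀ`. -/
lemma control_eq (R Rd : SO3) :
    (kp / 2) • ∑ i, hat (errVec Xr y₀ R Rd i ⨯₃ yRef Xr y₀ i)
      = (R.1ᵀ * Rd.1 * Xr.1ᵀ) * Ymat kp Xr y₀ - Ymat kp Xr y₀ * (R.1ᵀ * Rd.1 * Xr.1ᵀ)ᵀ := by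
  rw [Ymat, Matrix.mul_smul, Matrix.smul_mul, ← smul_sub, Finset.mul_sum, Finset.sum_mul,
    ← Finset.sum_sub_distrib]
  congr 1
  refine Finset.sum_congr rfl fun i _ => ?_
  rw [hat_cross, errVec, yMeas_eq Xr, Matrix.mul_vecMulVec, Matrix.vecMulVec_mul,
    Matrix.vecMul_transpose, Matrix.vecMulVec_sub, Matrix.sub_vecMulVec]
  abel

lemma hat_smul_sum (a : ℝ) (v : Fin ν → Fin 3 → ℝ) :
    hat (a • ∑ i, v i) = a • ∑ i, hat (v i) := by
  have h := map_smul hatL a (∑ i, WithLp.toLp 2 (v i))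
  rw [map_sum] at h
  simp only [hatL_apply] at h
  rw [← h]
  congr 1
  ext k
  simp

variable {U : SO3} {l : Fin 3 → ℝ}

/-- The left side is the product-rule derivative of the rotation error. By orthogonality `Y qᵀ q =
Y`, and the two angular velocities enter only through `δ - w`. -/
lemma rotField_errRot (hU : U.1ᵀ * Ymat kp Xr y₀ * U.1 = Matrix.diagonal l) (R Rd : SO3)
    (δ w : EuclideanSpace ℝ (Fin m)) :
    U.1ᵀ * ((R.1 * omegaCtrl C kp Xr y₀ R δ Rd)ᵀ * Rd.1 * Xr.1ᵀ
        + R.1ᵀ * (hat (C *ᵥ w.ofLp) * Rd.1) * Xr.1ᵀ) * U.1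
      = rotField l (outMap C U Xr Rd) (errRot U Xr R Rd).1 (δ - w) := by
  set q : SO3 := SO3.tr R * Rd * SO3.tr Xr with hq
  have hqc : R.1ᵀ * Rd.1 * Xr.1ᵀ = q.1 := rfl
  have hR := SO3.mul_transpose R
  have hRq : R.1 * q.1 = Rd.1 * Xr.1ᵀ := by
    rw [← hqc, ← Matrix.mul_assoc, ← Matrix.mul_assoc, hR, Matrix.one_mul]
  set Y := Ymat kp Xr y₀ with hYd
  have hΩ : (omegaCtrl C kp Xr y₀ R δ Rd)ᵀ
      = -(hat (R.1ᵀ *ᵥ (C *ᵥ δ.ofLp)) + (q.1 * Y - Y * q.1ᵀ)) := by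
    rw [omegaCtrl, control_eq, hqc, SO3.transpose_mul_hat_mul, Matrix.transpose_add, hat_transpose,
      Matrix.transpose_sub, Matrix.transpose_mul, Matrix.transpose_mul, Matrix.transpose_transpose,
      Ymat_transpose]
    abel
  have h1 : R.1ᵀ * (hat (C *ᵥ w.ofLp) * Rd.1) * Xr.1ᵀ = hat (R.1ᵀ *ᵥ (C *ᵥ w.ofLp)) * q.1 := by
    rw [← SO3.transpose_mul_hat_mul]
    simp only [Matrix.mul_assoc, hRq]
  have h2 : (R.1 * omegaCtrl C kp Xr y₀ R δ Rd)ᵀ * Rd.1 * Xr.1ᵀ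
      = -(hat (R.1ᵀ *ᵥ (C *ᵥ δ.ofLp)) + (q.1 * Y - Y * q.1ᵀ)) * q.1 := by
    rw [Matrix.transpose_mul, hΩ, ← hqc]
    simp only [Matrix.mul_assoc]
  have h3 : hat (R.1ᵀ *ᵥ (C *ᵥ (δ - w).ofLp))
      = hat (R.1ᵀ *ᵥ (C *ᵥ δ.ofLp)) - hat (R.1ᵀ *ᵥ (C *ᵥ w.ofLp)) := by
    have := map_sub hatL (WithLp.toLp 2 (R.1ᵀ *ᵥ (C *ᵥ δ.ofLp)))
      (WithLp.toLp 2 (R.1ᵀ *ᵥ (C *ᵥ w.ofLp)))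
    simp only [hatL_apply] at this
    rw [← this]
    congr 1
    simp [Matrix.mulVec_sub]
  have hQ : (errRot U Xr R Rd).1 = U.1ᵀ * q.1 * U.1 := by rw [coe_errRot, hqc]
  have hG : (frameRot U Xr Rd).1ᵀ = (errRot U Xr R Rd).1ᵀ * (U.1ᵀ * R.1ᵀ) := by
    rw [coe_frameRot, ← hRq, hQ]
    simp only [Matrix.transpose_mul, Matrix.transpose_transpose, Matrix.mul_assoc]
    rw [← Matrix.mul_assoc U.1 U.1ᵀ, SO3.mul_transpose, Matrix.one_mul]
  have h4 : (errRot U Xr R Rd).1 * hatL (outMap C U Xr Rd (δ - w))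
      = U.1ᵀ * hat (R.1ᵀ *ᵥ (C *ᵥ (δ - w).ofLp)) * q.1 * U.1 := by
    rw [hatL_apply, outMap_apply, hG, ← Matrix.mulVec_mulVec, ← SO3.transpose_mul_hat_mul,
      ← Matrix.mulVec_mulVec, ← SO3.transpose_mul_hat_mul U]
    simp only [← Matrix.mul_assoc]
    rw [SO3.mul_transpose, Matrix.one_mul, hQ]
    simp only [Matrix.mul_assoc]
    rw [← Matrix.mul_assoc U.1 U.1ᵀ, SO3.mul_transpose, Matrix.one_mul]
  have h5 : (errRot U Xr R Rd).1 * Matrix.diagonal l * (errRot U Xr R Rd).1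
      = U.1ᵀ * (q.1 * Y * q.1) * U.1 := by
    rw [← hU, hQ]
    simp only [Matrix.mul_assoc]
    rw [← Matrix.mul_assoc U.1 U.1ᵀ, SO3.mul_transpose, Matrix.one_mul,
      ← Matrix.mul_assoc U.1 U.1ᵀ, SO3.mul_transpose, Matrix.one_mul]
  rw [rotField, h4, h5, h1, h2, h3, ← hU]
  have h6 : Y * q.1ᵀ * q.1 = Y := by rw [Matrix.mul_assoc, SO3.transpose_mul, Matrix.mul_one]
  have h7 : -(hat (R.1ᵀ *ᵥ (C *ᵥ δ.ofLp)) + (q.1 * Y - Y * q.1ᵀ)) * q.1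
      + hat (R.1ᵀ *ᵥ (C *ᵥ w.ofLp)) * q.1 = Y - q.1 * Y * q.1
        - (hat (R.1ᵀ *ᵥ (C *ᵥ δ.ofLp)) - hat (R.1ᵀ *ᵥ (C *ᵥ w.ofLp))) * q.1 := by
    conv_rhs => enter [1, 1]; rw [← h6]
    noncomm_ring
  rw [h7]
  simp only [Matrix.mul_sub, Matrix.sub_mul, Matrix.mul_assoc]

/-- Since `Q_{so(3)} = 2`, the innovation is `k_I R z` with `z = ∑ e_i ∧ y_iʳ`, while the axial
vector, seen in the moving frame, is `(k_p / 2) R z`. The ratio is `κ = 2 k_I / k_p`. -/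
lemma vecField_errRot (hkp : kp ≠ 0) (hU : U.1ᵀ * Ymat kp Xr y₀ * U.1 = Matrix.diagonal l)
    (R Rd : SO3) (δ w : EuclideanSpace ℝ (Fin m)) :
    WithLp.toLp 2 (S *ᵥ δ.ofLp + Cᵀ *ᵥ (Qso3 *ᵥ betaCtrl kI Xr y₀ R Rd))
        - WithLp.toLp 2 (S *ᵥ w.ofLp)
      = vecField l (2 * kI / kp) (matOp m m S) (outMap C U Xr Rd) (errRot U Xr R Rd).1 (δ - w) := by
  set q : SO3 := SO3.tr R * Rd * SO3.tr Xr with hq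
  have hqc : R.1ᵀ * Rd.1 * Xr.1ᵀ = q.1 := rfl
  have hRq : R.1 * q.1 = Rd.1 * Xr.1ᵀ := by
    rw [← hqc, ← Matrix.mul_assoc, ← Matrix.mul_assoc, SO3.mul_transpose, Matrix.one_mul]
  set Y := Ymat kp Xr y₀ with hYd
  set z := ∑ i, errVec Xr y₀ R Rd i ⨯₃ yRef Xr y₀ i with hz
  set Q := errRot U Xr R Rd with hQd
  set G := frameRot U Xr Rd with hGd
  have hQ : Q.1 = U.1ᵀ * q.1 * U.1 := by rw [hQd, coe_errRot, hqc]
  have hG : G.1 = R.1 * q.1 * U.1 := by rw [hGd, coe_frameRot, hRq]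
  have hzhat : hat ((kp / 2) • z) = q.1 * Y - Y * q.1ᵀ := by
    rw [hz, hat_smul_sum, control_eq, hqc]
  have hGa : G.1 *ᵥ (axial (Matrix.diagonal l * Q.1)).ofLp = (kp / 2) • (R.1 *ᵥ z) := by
    apply hat_injective
    rw [← SO3.mul_hat_mul_transpose, ← hatL_apply, hatL_axial, ← Matrix.mulVec_smul,
      ← SO3.mul_hat_mul_transpose, hzhat]
    have key : G.1 * (Matrix.diagonal l * Q.1) * G.1ᵀ = R.1 * (q.1 * Y) * R.1ᵀ := by
      rw [hG, hQ, ← hU]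
      simp only [Matrix.transpose_mul, Matrix.mul_assoc]
      rw [← Matrix.mul_assoc U.1 U.1ᵀ, SO3.mul_transpose, Matrix.one_mul,
        ← Matrix.mul_assoc U.1 U.1ᵀ, SO3.mul_transpose, Matrix.one_mul,
        ← Matrix.mul_assoc U.1 U.1ᵀ, SO3.mul_transpose, Matrix.one_mul,
        ← Matrix.mul_assoc q.1 q.1ᵀ, SO3.mul_transpose, Matrix.one_mul]
    have key' := congrArg Matrix.transpose key
    rw [Matrix.transpose_mul, Matrix.transpose_mul, Matrix.transpose_transpose,
      Matrix.transpose_mul _ R.1ᵀ, Matrix.transpose_mul R.1 _, Matrix.transpose_transpose] at key'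
    rw [Matrix.mul_sub, Matrix.sub_mul, Matrix.mul_sub, Matrix.sub_mul, key, Matrix.mul_assoc G.1,
      key', Matrix.transpose_mul q.1 Y, Ymat_transpose, Matrix.mul_assoc R.1 (Y * q.1ᵀ)]
  have hadj : ContinuousLinearMap.adjoint (outMap C U Xr Rd) (axial (Matrix.diagonal l * Q.1))
      = WithLp.toLp 2 (Cᵀ *ᵥ (G.1 *ᵥ (axial (Matrix.diagonal l * Q.1)).ofLp)) := by
    have e : rotOp G.1ᵀ = matOp 3 3 G.1ᵀ := rfl
    rw [outMap, ContinuousLinearMap.adjoint_comp, ← hGd, e, adjoint_matOp, adjoint_matOp,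
      Matrix.transpose_transpose]
    rfl
  rw [vecField, hadj, hGa, matOp_apply, Qso3_eq, betaCtrl, ← hz]
  ext i
  simp [Matrix.mulVec_sub, Matrix.mulVec_smul, Matrix.smul_mulVec]
  field_simp
  ring

end Conversion

/-! ### Global solutions -/

/-- A compactly supported `C¹` vector field has global integral curves. -/
theorem exists_global_solution {E : Type*} [NormedAddCommGroup E] [NormedSpace ℝ E]
    [CompleteSpace E] {f : E → E} (hf : ContDiff ℝ 1 f) (hs : HasCompactSupport f) (x₀ : E) :
    ∃ x : ℝ → E, x 0 = x₀ ∧ ∀ t, HasDerivAt x (f (x t)) t := by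
  obtain ⟨K, hK⟩ := hf.lipschitzWith_of_hasCompactSupport hs one_ne_zero
  obtain ⟨L, hL⟩ := hs.exists_bound_of_continuous hf.continuous
  have hL' : ∀ x, ‖f x‖ ≤ (L.toNNReal : ℝ) := fun x => (hL x).trans (Real.le_coe_toNNReal L)
  have hex : ∀ n : ℕ, ∃ α : ℝ → E, α 0 = x₀ ∧ ∀ t ∈ Set.Icc (-(n + 1) : ℝ) (n + 1),
      HasDerivWithinAt α (f (α t)) (Set.Icc (-(n + 1) : ℝ) (n + 1)) t := by
    intro n
    have h0 : (0 : ℝ) ∈ Set.Icc (-(n + 1) : ℝ) (n + 1) :=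
      ⟨by linarith [n.cast_nonneg (α := ℝ)], by positivity⟩
    -- The field is globally bounded and Lipschitz, so a ball of radius bound times length always
    -- works.
    have hPL : IsPicardLindelof (fun _ => f) (⟨0, h0⟩ : Set.Icc (-(n + 1) : ℝ) (n + 1)) x₀
        (L.toNNReal * (n + 1)) 0 L.toNNReal K :=
      IsPicardLindelof.of_time_independent (fun x _ => hL' x) hK.lipschitzOnWith (by simp)
    exact hPL.exists_eq_forall_mem_Icc_hasDerivWithinAt₀
  choose α hα0 hα using hex
  have hαd : ∀ n : ℕ, ∀ t ∈ Set.Ioo (-(n + 1) : ℝ) (n + 1), HasDerivAt (α n) (f (α n t)) t :=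
    fun n t ht => (hα n t (Set.Ioo_subset_Icc_self ht)).hasDerivAt (Icc_mem_nhds ht.1 ht.2)
  have hagree : ∀ k n : ℕ, k ≤ n → Set.EqOn (α k) (α n) (Set.Icc (-(k + 1) : ℝ) (k + 1)) := by
    intro k n hkn
    have hkn' : (k : ℝ) ≤ n := Nat.cast_le.mpr hkn
    have hk0 : (0 : ℝ) ≤ k := Nat.cast_nonneg k
    refine ODE_solution_unique_of_mem_Icc (v := fun _ => f) (s := fun _ => Set.univ) (K := K)
      (t₀ := 0) (fun _ _ => hK.lipschitzOnWith) ⟨by linarith, by linarith⟩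
      (fun t ht => (hα k t ht).continuousWithinAt) (hαd k) (fun _ _ => Set.mem_univ _)
      (fun t ht => ?_) (fun t ht => hαd n t ⟨by linarith [ht.1], by linarith [ht.2]⟩)
      (fun _ _ => Set.mem_univ _) (by rw [hα0, hα0])
    exact ((hα n t ⟨by linarith [ht.1], by linarith [ht.2]⟩).continuousWithinAt).mono
      (Set.Icc_subset_Icc (by linarith) (by linarith))
  have hx : ∀ (n : ℕ) (t : ℝ), |t| < n → α ⌈|t|⌉₊ t = α n t := fun n t ht => by
    refine hagree _ _ (Nat.ceil_le.mpr ht.le) ?_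
    have := abs_le.mp (Nat.le_ceil |t|)
    exact ⟨by linarith, by linarith⟩
  -- The local solutions agree where they overlap, so the glued curve coincides near `t` with any
  -- single `α n` for `n > |t|`.
  refine ⟨fun t => α ⌈|t|⌉₊ t, by simp [hα0], fun t => ?_⟩
  obtain ⟨n, hn⟩ := exists_nat_gt |t|
  have hev : (fun t => α ⌈|t|⌉₊ t) =ᶠ[𝓝 t] α n := by
    filter_upwards [(continuous_abs.tendsto t).eventually (gt_mem_nhds hn)] with τ hτ
    exact hx n τ hτ
  have h1 := (abs_lt.mp hn)
  have h2 := hαd n t ⟨by linarith, by linarith⟩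
  simp only
  rw [hx n t hn]
  exact h2.congr_of_eventuallyEq hev

/-! ### Derivatives of the error variables -/

lemma HasDerivWithinAt.mat_transpose {M : ℝ → Mat3} {M' : Mat3} {s : Set ℝ} {t : ℝ}
    (h : HasDerivWithinAt M M' s t) : HasDerivWithinAt (fun τ => (M τ)ᵀ) M'ᵀ s t :=
  hasDerivWithinAt_matrix_iff.mpr fun i j => hasDerivWithinAt_matrix_iff.mp h j i

section Derivatives

variable {m ν : ℕ} (C : Matrix (Fin 3) (Fin m) ℝ) (S : Matrix (Fin m) (Fin m) ℝ)
  (kp kI : ℝ) (Xr : SO3) (y₀ : Fin ν → Fin 3 → ℝ) {U : SO3} {l : Fin 3 → ℝ}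

/-- The scalar `χ` lets one computation serve both the truncated field of the existence proof and,
with `χ = 1`, the closed loop. -/
lemma hasDerivWithinAt_errRot (hU : U.1ᵀ * Ymat kp Xr y₀ * U.1 = Matrix.diagonal l)
    {R Rd : ℝ → SO3} {δ w : EuclideanSpace ℝ (Fin m)} {χ t : ℝ} {s : Set ℝ}
    (hR : HasDerivWithinAt (fun τ => (R τ).1)
      (χ • ((R t).1 * omegaCtrl C kp Xr y₀ (R t) δ (Rd t))) s t)
    (hRd : HasDerivWithinAt (fun τ => (Rd τ).1) (χ • (hat (C *ᵥ w.ofLp) * (Rd t).1)) s t) :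
    HasDerivWithinAt (fun τ => (errRot U Xr (R τ) (Rd τ)).1)
      (χ • rotField l (outMap C U Xr (Rd t)) (errRot U Xr (R t) (Rd t)).1 (δ - w)) s t := by
  simp only [coe_errRot]
  have h := ((((hR.mat_transpose).mul hRd).mul_const (Xr.1ᵀ)).const_mul (U.1ᵀ)).mul_const U.1
  refine h.congr_deriv ?_
  rw [← coe_errRot, ← rotField_errRot C kp Xr y₀ hU]
  simp only [Matrix.transpose_smul, Matrix.smul_mul, Matrix.mul_smul, Matrix.add_mul, smul_add,
    Matrix.mul_add]

/-- The derivative of the output map when `Ṙ_d = (C w)_× R_d`. -/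
noncomputable def outMapDeriv (U Xr Rd : SO3) (w : EuclideanSpace ℝ (Fin m)) :
    EuclideanSpace ℝ (Fin m) →L[ℝ] Vec3 :=
  (rotOp (hat (C *ᵥ w.ofLp) * (frameRot U Xr Rd).1)ᵀ) ∘L (matOp 3 m C)

lemma hasDerivWithinAt_outMap {Rd : ℝ → SO3} {w : EuclideanSpace ℝ (Fin m)} {t : ℝ} {s : Set ℝ}
    (hRd : HasDerivWithinAt (fun τ => (Rd τ).1) (hat (C *ᵥ w.ofLp) * (Rd t).1) s t) :
    HasDerivWithinAt (fun τ => outMap C U Xr (Rd τ)) (outMapDeriv C U Xr (Rd t) w) s t := by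
  have h1 : HasDerivWithinAt (fun τ => (frameRot U Xr (Rd τ)).1)
      (hat (C *ᵥ w.ofLp) * (frameRot U Xr (Rd t)).1) s t := by
    simp only [coe_frameRot]
    refine ((hRd.mul_const (Xr.1ᵀ)).mul_const U.1).congr_deriv ?_
    simp only [Matrix.mul_assoc]
  have h2 := rotOp.hasFDerivAt.comp_hasDerivWithinAt t h1.mat_transpose
  have h3 := h2.clm_comp (hasDerivWithinAt_const t s (matOp 3 m C))
  refine h3.congr_deriv ?_
  rw [ContinuousLinearMap.comp_zero, add_zero]
  rfl

lemma norm_outMap_le (U Xr Rd : SO3) : ‖outMap C U Xr Rd‖ ≤ ‖matOp 3 m C‖ :=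
  ContinuousLinearMap.opNorm_le_bound _ (norm_nonneg _) fun d => by
    rw [norm_outMap_apply]
    exact (matOp 3 m C).le_opNorm d

lemma norm_rotOp_le (M : Mat3) : ‖rotOp M‖ ≤ ‖M‖ :=
  ContinuousLinearMap.opNorm_le_bound _ (norm_nonneg _) fun v => by
    have h := Matrix.frobenius_norm_mul M (Matrix.replicateCol Unit v.ofLp)
    rw [← Matrix.replicateCol_mulVec, Matrix.frobenius_norm_replicateCol,
      Matrix.frobenius_norm_replicateCol] at h
    exact h

/-- The moving frame turns at a speed proportional to `‖w‖`, which is why the exponential rate is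
uniform only over bounded exosystem states. -/
lemma norm_outMapDeriv_le (U Xr Rd : SO3) (w : EuclideanSpace ℝ (Fin m)) {ρ : ℝ} (hw : ‖w‖ ≤ ρ) :
    ‖outMapDeriv C U Xr Rd w‖ ≤ 2 * (‖matOp 3 m C‖ * ρ) * 2 * ‖matOp 3 m C‖ := by
  refine (ContinuousLinearMap.opNorm_comp_le _ _).trans
    (mul_le_mul_of_nonneg_right ((norm_rotOp_le _).trans ?_) (norm_nonneg _))
  rw [Matrix.frobenius_norm_transpose]
  have h1 : ‖hat (C *ᵥ w.ofLp)‖ ≤ 2 * (‖matOp 3 m C‖ * ρ) :=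
    (norm_hatL_le (matOp 3 m C w)).trans (mul_le_mul_of_nonneg_left
      (((matOp 3 m C).le_opNorm w).trans (mul_le_mul_of_nonneg_left hw (norm_nonneg _))) zero_le_two)
  have h2 := norm_SO3_le (frameRot U Xr Rd)
  have hρ : 0 ≤ ρ := (norm_nonneg _).trans hw
  exact (Matrix.frobenius_norm_mul _ _).trans (mul_le_mul h1 h2 (norm_nonneg _) (by positivity))

lemma inner_matOp_self_eq_zero (hS : S = -Sᵀ) (d : EuclideanSpace ℝ (Fin m)) :
    inner ℝ d (matOp m m S d) = 0 := by
  have h : inner ℝ d (matOp m m S d) = inner ℝ (matOp m m Sᵀ d) d := by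
    rw [← adjoint_matOp, ContinuousLinearMap.adjoint_inner_left]
  have h2 : matOp m m Sᵀ d = -matOp m m S d := by
    have : Sᵀ = -S := by
      conv_rhs => rw [hS]
      rw [neg_neg]
    rw [this, map_neg]
    rfl
  rw [h2, inner_neg_left] at h
  linarith [real_inner_comm d (matOp m m S d)]

/-- The vector field of the closed loop, extended to arbitrary matrices. -/
noncomputable def loopField (p : Mat3 × EuclideanSpace ℝ (Fin m) × Mat3 × EuclideanSpace ℝ (Fin m)) :
    Mat3 × EuclideanSpace ℝ (Fin m) × Mat3 × EuclideanSpace ℝ (Fin m) :=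
  (p.1 * (p.1ᵀ * hatL (matOp 3 m C p.2.1) * p.1 + (p.1ᵀ * p.2.2.1 * Xr.1ᵀ * Ymat kp Xr y₀
      - Ymat kp Xr y₀ * (p.1ᵀ * p.2.2.1 * Xr.1ᵀ)ᵀ)),
    matOp m m S p.2.1 + (2 * kI / kp) • matOp m 3 Cᵀ
      (rotOp p.1 (axial (p.1ᵀ * p.2.2.1 * Xr.1ᵀ * Ymat kp Xr y₀))),
    hatL (matOp 3 m C p.2.2.2) * p.2.2.1, matOp m m S p.2.2.2)

/-- Transposition as a continuous linear map. -/
noncomputable def transposeMat : Mat3 →L[ℝ] Mat3 := LinearMap.toContinuousLinearMap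
  { toFun := fun M => Mᵀ
    map_add' := fun M N => Matrix.transpose_add M N
    map_smul' := fun a M => Matrix.transpose_smul a M }

lemma contDiff_loopField : ContDiff ℝ 1 (loopField C S kp kI Xr y₀) := by
  have h1 : ContDiff ℝ 1 fun p : Mat3 × EuclideanSpace ℝ (Fin m) × Mat3 × EuclideanSpace ℝ (Fin m) =>
      p.1 := contDiff_fst
  have h2 : ContDiff ℝ 1 fun p : Mat3 × EuclideanSpace ℝ (Fin m) × Mat3 × EuclideanSpace ℝ (Fin m) =>
      p.2.1 := contDiff_fst.comp contDiff_snd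
  have h3 : ContDiff ℝ 1 fun p : Mat3 × EuclideanSpace ℝ (Fin m) × Mat3 × EuclideanSpace ℝ (Fin m) =>
      p.2.2.1 := contDiff_fst.comp (contDiff_snd.comp contDiff_snd)
  have h4 : ContDiff ℝ 1 fun p : Mat3 × EuclideanSpace ℝ (Fin m) × Mat3 × EuclideanSpace ℝ (Fin m) =>
      p.2.2.2 := contDiff_snd.comp (contDiff_snd.comp contDiff_snd)
  have h1t : ContDiff ℝ 1 fun p : Mat3 × EuclideanSpace ℝ (Fin m) × Mat3 × EuclideanSpace ℝ (Fin m) =>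
      p.1ᵀ := transposeMat.contDiff.comp h1
  have hq : ContDiff ℝ 1 fun p : Mat3 × EuclideanSpace ℝ (Fin m) × Mat3 × EuclideanSpace ℝ (Fin m) =>
      p.1ᵀ * p.2.2.1 * Xr.1ᵀ := (h1t.mul h3).mul contDiff_const
  have hqt : ContDiff ℝ 1 fun p : Mat3 × EuclideanSpace ℝ (Fin m) × Mat3 × EuclideanSpace ℝ (Fin m) =>
      (p.1ᵀ * p.2.2.1 * Xr.1ᵀ)ᵀ := transposeMat.contDiff.comp hq
  have hqY := hq.mul (contDiff_const (c := Ymat kp Xr y₀))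
  refine ContDiff.prodMk ?_ (ContDiff.prodMk ?_ (ContDiff.prodMk ?_ ?_))
  · exact h1.mul (((h1t.mul (hatL.contDiff.comp ((matOp 3 m C).contDiff.comp h2))).mul h1).add
      (hqY.sub (contDiff_const.mul hqt)))
  · exact ((matOp m m S).contDiff.comp h2).add (((matOp m 3 Cᵀ).contDiff.comp
      ((rotOp.contDiff.comp h1).clm_apply (axial.contDiff.comp hqY))).const_smul (2 * kI / kp))
  · exact (hatL.contDiff.comp ((matOp 3 m C).contDiff.comp h4)).mul h3
  · exact (matOp m m S).contDiff.comp h4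

lemma loopField_rot (R Rd : SO3) (δ w : EuclideanSpace ℝ (Fin m)) :
    (loopField C S kp kI Xr y₀ (R.1, δ, Rd.1, w)).1 = R.1 * omegaCtrl C kp Xr y₀ R δ Rd := by
  rw [omegaCtrl, control_eq]
  rfl

lemma loopField_vec (hkp : kp ≠ 0) (R Rd : SO3) (δ w : EuclideanSpace ℝ (Fin m)) :
    (loopField C S kp kI Xr y₀ (R.1, δ, Rd.1, w)).2.1
      = WithLp.toLp 2 (S *ᵥ δ.ofLp + Cᵀ *ᵥ (Qso3 *ᵥ betaCtrl kI Xr y₀ R Rd)) := by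
  set z := ∑ i, errVec Xr y₀ R Rd i ⨯₃ yRef Xr y₀ i with hz
  have h : (axial (R.1ᵀ * Rd.1 * Xr.1ᵀ * Ymat kp Xr y₀)).ofLp = (kp / 2) • z := by
    apply hat_injective
    rw [← hatL_apply, hatL_axial, hz, hat_smul_sum, control_eq, Matrix.transpose_mul _ (Ymat _ _ _),
      Ymat_transpose]
  simp only [loopField, matOp_apply, rotOp_apply, h]
  rw [Qso3_eq, betaCtrl, ← hz]
  ext i
  simp [Matrix.mulVec_smul, Matrix.smul_mulVec]
  field_simp

end Derivatives

/-! ### Existence of solutions of the closed loop -/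

lemma HasDerivAt.of_fst {E F : Type*} [NormedAddCommGroup E] [NormedSpace ℝ E]
    [NormedAddCommGroup F] [NormedSpace ℝ F] {f : ℝ → E × F} {f' : E × F} {t : ℝ}
    (h : HasDerivAt f f' t) : HasDerivAt (fun τ => (f τ).1) f'.1 t :=
  (ContinuousLinearMap.fst ℝ E F).hasFDerivAt.comp_hasDerivAt t h

lemma HasDerivAt.of_snd {E F : Type*} [NormedAddCommGroup E] [NormedSpace ℝ E]
    [NormedAddCommGroup F] [NormedSpace ℝ F] {f : ℝ → E × F} {f' : E × F} {t : ℝ}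
    (h : HasDerivAt f f' t) : HasDerivAt (fun τ => (f τ).2) f'.2 t :=
  (ContinuousLinearMap.snd ℝ E F).hasFDerivAt.comp_hasDerivAt t h

section Existence

variable {m ν : ℕ} (C : Matrix (Fin 3) (Fin m) ℝ) (S : Matrix (Fin m) (Fin m) ℝ)
  (kp kI : ℝ) (Xr : SO3) (y₀ : Fin ν → Fin 3 → ℝ)

lemma det_eq_one_of_continuous {M : ℝ → Mat3} (hM : Continuous M) (horth : ∀ t, M t * (M t)ᵀ = 1)
    (h0 : (M 0).det = 1) (t : ℝ) : (M t).det = 1 := by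
  have hsq : ∀ τ, (M τ).det * (M τ).det = 1 := fun τ => by
    have := congrArg Matrix.det (horth τ)
    rwa [Matrix.det_mul, Matrix.det_transpose, Matrix.det_one] at this
  rcases mul_self_eq_one_iff.mp (hsq t) with h | h
  · exact h
  · obtain ⟨τ, hτ⟩ := mem_range_of_exists_le_of_exists_ge hM.matrix_det
      ⟨t, (h.le.trans (by norm_num) : (M t).det ≤ 0)⟩ ⟨0, (by rw [h0]; exact zero_le_one)⟩
    have := hsq τ
    simp only at hτ
    rw [hτ] at this
    norm_num at this

/-- The field is extended to all matrices and cut off by a bump function. The truncated flow still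
preserves the rotation groups and `‖w‖`, and does not increase the energy, so it never leaves the
region where the cutoff equals one. -/
lemma forwardComplete_closedLoop (hS : S = -Sᵀ) (hkp : 0 < kp) (hkI : 0 < kI) {U : SO3}
    {l : Fin 3 → ℝ} (hU : U.1ᵀ * Ymat kp Xr y₀ * U.1 = Matrix.diagonal l) (hl : ∀ i, 0 ≤ l i)
    (hinj : Function.Injective l) : ForwardComplete (closedLoop C S kp kI Xr y₀) := by
  rintro ⟨R₀, δ₀, Rd₀, w₀⟩
  have hκ : 0 < 2 * kI / kp := by positivity
  obtain ⟨c, hc, hcl⟩ := exists_le_errEnergy (D := EuclideanSpace ℝ (Fin m)) hl hinj hκ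
  set V₀ := errEnergy l (2 * kI / kp) (errRot U Xr R₀ Rd₀).1 (δ₀ - w₀) with hV₀
  set M := Real.sqrt (V₀ / c) with hM
  -- Rotations have norm at most `2`, `M` is the energy bound on `δ - w`, and `‖w‖` is conserved; in
  -- the sup norm of the product this radius contains the solution.
  set ρ := 2 + M + ‖w₀‖ with hρ
  have hM0 : 0 ≤ M := Real.sqrt_nonneg _
  have hρ0 : 0 < ρ := by positivity
  let χ : ContDiffBump (0 : Mat3 × EuclideanSpace ℝ (Fin m) × Mat3 × EuclideanSpace ℝ (Fin m)) :=
    ⟨ρ, ρ + 1, hρ0, by linarith⟩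
  have hf : ContDiff ℝ 1 fun p => χ p • loopField C S kp kI Xr y₀ p :=
    χ.contDiff.smul (contDiff_loopField C S kp kI Xr y₀)
  have hsupp : HasCompactSupport fun p => χ p • loopField C S kp kI Xr y₀ p :=
    χ.hasCompactSupport.smul_right
  obtain ⟨x, hx0, hx⟩ := exists_global_solution hf hsupp (R₀.1, δ₀, Rd₀.1, w₀)
  set F := loopField C S kp kI Xr y₀ with hF
  have d1 : ∀ t, HasDerivAt (fun τ => (x τ).1) (χ (x t) • (F (x t)).1) t := fun t =>
    (hx t).of_fst
  have dx2 : ∀ t, HasDerivAt (fun τ => (x τ).2) (χ (x t) • (F (x t)).2) t := fun t =>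
    (hx t).of_snd
  have d2 : ∀ t, HasDerivAt (fun τ => (x τ).2.1) (χ (x t) • (F (x t)).2.1) t := fun t =>
    (dx2 t).of_fst
  have dx3 : ∀ t, HasDerivAt (fun τ => (x τ).2.2) (χ (x t) • (F (x t)).2.2) t := fun t =>
    (dx2 t).of_snd
  have d3 : ∀ t, HasDerivAt (fun τ => (x τ).2.2.1) (χ (x t) • (F (x t)).2.2.1) t := fun t =>
    (dx3 t).of_fst
  have d4 : ∀ t, HasDerivAt (fun τ => (x τ).2.2.2) (χ (x t) • (F (x t)).2.2.2) t := fun t =>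
    (dx3 t).of_snd
  have dtr : ∀ {N : ℝ → Mat3} {N' : Mat3} {t : ℝ}, HasDerivAt N N' t →
      HasDerivAt (fun τ => (N τ)ᵀ) N'ᵀ t := fun h =>
    hasDerivWithinAt_univ.mp (hasDerivWithinAt_univ.mpr h).mat_transpose
  have hconst : ∀ {E : Type} [NormedAddCommGroup E] [NormedSpace ℝ E] {g : ℝ → E},
      (∀ t, HasDerivAt g 0 t) → ∀ t, g t = g 0 := fun hg t =>
    is_const_of_deriv_eq_zero (fun τ => (hg τ).differentiableAt) (fun τ => (hg τ).deriv) t 0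
  have hskew : ∀ v : Vec3, (hatL v)ᵀ = -hatL v := fun v => hat_transpose _
  have o1 : ∀ t, (x t).1 * ((x t).1)ᵀ = 1 := fun t => by
    have h := hconst (g := fun τ => (x τ).1 * ((x τ).1)ᵀ) (fun τ => by
      refine ((d1 τ).mul (dtr (d1 τ))).congr_deriv ?_
      simp only [hF, loopField]
      simp only [Matrix.transpose_smul, Matrix.transpose_mul, Matrix.transpose_add,
        Matrix.transpose_sub, Matrix.transpose_transpose, hskew, Ymat_transpose, Matrix.smul_mul,
        Matrix.mul_smul]
      rw [← smul_add]
      convert smul_zero _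
      noncomm_ring) t
    simp only [hx0] at h
    rw [h, SO3.mul_transpose]
  have o3' : ∀ t, ((x t).2.2.1)ᵀ * (x t).2.2.1 = 1 := fun t => by
    have h := hconst (g := fun τ => ((x τ).2.2.1)ᵀ * (x τ).2.2.1) (fun τ => by
      refine ((dtr (d3 τ)).mul (d3 τ)).congr_deriv ?_
      simp only [hF, loopField]
      simp only [Matrix.transpose_smul, Matrix.transpose_mul, hskew, Matrix.smul_mul,
        Matrix.mul_smul]
      rw [← smul_add]
      convert smul_zero _
      noncomm_ring) t
    simp only [hx0] at h
    rw [h, SO3.transpose_mul]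
  have o3 : ∀ t, (x t).2.2.1 * ((x t).2.2.1)ᵀ = 1 := fun t => mul_eq_one_comm.mp (o3' t)
  have det1 := det_eq_one_of_continuous
    (continuous_iff_continuousAt.mpr fun t => (d1 t).continuousAt) o1 (by rw [hx0]; exact R₀.det_eq)
  have det3 := det_eq_one_of_continuous
    (continuous_iff_continuousAt.mpr fun t => (d3 t).continuousAt) o3 (by rw [hx0]; exact Rd₀.det_eq)
  set R : ℝ → SO3 := fun t => ⟨(x t).1, (mem_SO3_iff _).mpr ⟨o1 t, det1 t⟩⟩ with hR
  set Rd : ℝ → SO3 := fun t => ⟨(x t).2.2.1, (mem_SO3_iff _).mpr ⟨o3 t, det3 t⟩⟩ with hRd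
  have hxe : ∀ t, x t = ((R t).1, (x t).2.1, (Rd t).1, (x t).2.2.2) := fun t => rfl
  have hw : ∀ t, ‖(x t).2.2.2‖ = ‖w₀‖ := fun t => by
    have h := hconst (g := fun τ => ‖(x τ).2.2.2‖ ^ 2) (fun τ => by
      refine ((d4 τ).norm_sq).congr_deriv ?_
      rw [inner_smul_right]
      simp only [hF, loopField]
      rw [inner_matOp_self_eq_zero S hS]
      simp) t
    simp only [hx0] at h
    rwa [sq_eq_sq₀ (norm_nonneg _) (norm_nonneg _)] at h
  have f1 : ∀ t, (F (x t)).1 = (R t).1 * omegaCtrl C kp Xr y₀ (R t) (x t).2.1 (Rd t) := fun t =>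
    loopField_rot C S kp kI Xr y₀ (R t) (Rd t) (x t).2.1 (x t).2.2.2
  have f2 : ∀ t, (F (x t)).2.1 = WithLp.toLp 2 (S *ᵥ (x t).2.1.ofLp
      + Cᵀ *ᵥ (Qso3 *ᵥ betaCtrl kI Xr y₀ (R t) (Rd t))) := fun t =>
    loopField_vec C S kp kI Xr y₀ hkp.ne' (R t) (Rd t) (x t).2.1 (x t).2.2.2
  have f3 : ∀ t, (F (x t)).2.2.1 = hat (C *ᵥ (x t).2.2.2.ofLp) * (Rd t).1 := fun t => rfl
  have f4 : ∀ t, (F (x t)).2.2.2 = WithLp.toLp 2 (S *ᵥ (x t).2.2.2.ofLp) := fun t => rfl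
  simp only [f1] at d1
  simp only [f2] at d2
  simp only [f3] at d3
  simp only [f4] at d4
  have hen : ∀ t ≥ 0, errEnergy l (2 * kI / kp) (errRot U Xr (R t) (Rd t)).1
      ((x t).2.1 - (x t).2.2.2) ≤ V₀ := by
    have hder : ∀ t ≥ 0, HasDerivWithinAt (fun τ => errEnergy l (2 * kI / kp)
        (errRot U Xr (R τ) (Rd τ)).1 ((x τ).2.1 - (x τ).2.2.2))
        (-(χ (x t) * ‖axial (Matrix.diagonal l * (errRot U Xr (R t) (Rd t)).1)‖ ^ 2))
        (Set.Ici 0) t := by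
      intro t _
      have hQ := hasDerivWithinAt_errRot C kp Xr y₀ hU (R := R) (Rd := Rd) (s := Set.Ici 0)
        (d1 t).hasDerivWithinAt (d3 t).hasDerivWithinAt
      have hd := ((d2 t).fun_sub (d4 t)).hasDerivWithinAt (s := Set.Ici 0)
      rw [← smul_sub, vecField_errRot C S kp kI Xr y₀ hkp.ne' hU] at hd
      refine (hasDerivWithinAt_errEnergy l hκ.ne' hQ hd).congr_deriv ?_
      have e := errEnergy_deriv_eq l hκ.ne' (matOp m m S) (inner_matOp_self_eq_zero S hS)
        (outMap C U Xr (Rd t)) (errRot U Xr (R t) (Rd t)) ((x t).2.1 - (x t).2.2.2)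
      rw [← mul_neg, ← e, inner_smul_right]
      simp only [Matrix.smul_apply, smul_eq_mul]
      rw [mul_add, mul_neg, Finset.mul_sum, mul_div_assoc]
      congr 2
      refine Finset.sum_congr rfl fun i _ => ?_
      ring
    intro t ht
    have := sub_le_mul_of_deriv_le hder le_rfl ht (c := 0) (fun τ _ _ =>
      neg_nonpos.mpr (mul_nonneg χ.nonneg (sq_nonneg _)))
    have e0 : errEnergy l (2 * kI / kp) (errRot U Xr (R 0) (Rd 0)).1 ((x 0).2.1 - (x 0).2.2.2)
        = V₀ := by
      have r0 : R 0 = R₀ := Subtype.ext (by simp only [hR, hx0])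
      have rd0 : Rd 0 = Rd₀ := Subtype.ext (by simp only [hRd, hx0])
      rw [r0, rd0, hx0]
    linarith
  have hχ : ∀ t ≥ 0, χ (x t) = 1 := by
    intro t ht
    refine χ.one_of_mem_closedBall ?_
    rw [mem_closedBall_zero_iff]
    have hdn : ‖(x t).2.1 - (x t).2.2.2‖ ≤ M := by
      refine Real.le_sqrt_of_sq_le ?_
      rw [le_div_iff₀ hc]
      nlinarith [hcl (errRot U Xr (R t) (Rd t)) ((x t).2.1 - (x t).2.2.2), hen t ht,
        sq_nonneg ‖(errRot U Xr (R t) (Rd t)).1 - 1‖]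
    have hδ : ‖(x t).2.1‖ ≤ M + ‖w₀‖ := by
      have h1 := norm_add_le ((x t).2.1 - (x t).2.2.2) (x t).2.2.2
      rw [sub_add_cancel, hw] at h1
      linarith
    have n1 : ‖(x t).1‖ ≤ 2 := norm_SO3_le (R t)
    have n3 : ‖(x t).2.2.1‖ ≤ 2 := norm_SO3_le (Rd t)
    have hw0 := norm_nonneg w₀
    refine max_le (by simp only [χ]; linarith) (max_le (by simp only [χ]; linarith)
      (max_le (by simp only [χ]; linarith) ?_))
    simp only [χ]
    linarith [(hw t).le]
  refine ⟨fun t => (R t, (x t).2.1, Rd t, (x t).2.2.2), fun t ht => ?_, ?_⟩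
  · have e1 := d1 t
    have e2 := d2 t
    have e3 := d3 t
    have e4 := d4 t
    rw [hχ t ht, one_smul] at e1 e2 e3 e4
    exact ⟨hasDerivWithinAt_matrix_iff.mp e1.hasDerivWithinAt, e2.hasDerivWithinAt,
      hasDerivWithinAt_matrix_iff.mp e3.hasDerivWithinAt, e4.hasDerivWithinAt⟩
  · have r0 : R 0 = R₀ := Subtype.ext (by simp only [hR, hx0])
    have rd0 : Rd 0 = Rd₀ := Subtype.ext (by simp only [hRd, hx0])
    simp only [r0, rd0, hx0]

end Existence

/-! ### Diagonalization of the gain matrix -/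

lemma Ymat_posSemidef {ν : ℕ} {kp : ℝ} (hkp : 0 ≤ kp) (Xr : SO3) (y₀ : Fin ν → Fin 3 → ℝ) :
    (Ymat kp Xr y₀).PosSemidef := by
  refine Matrix.PosSemidef.smul (Matrix.posSemidef_sum _ fun i _ => ?_) (by positivity)
  have := Matrix.posSemidef_vecMulVec_self_star (yRef Xr y₀ i)
  rwa [star_trivial] at this

/-- Three distinct eigenvalues exhaust the spectral list of a `3 × 3` matrix, so that list is
injective. -/
lemma exists_SO3_diagonalization {Y : Mat3} (hY : Y.PosSemidef) {l : Fin 3 → ℝ}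
    (hl : Function.Injective l)
    (heig : ∀ k, Module.End.HasEigenvalue (Matrix.toLin' Y) (l k)) :
    ∃ (U : SO3) (e : Fin 3 → ℝ), U.1ᵀ * Y * U.1 = Matrix.diagonal e ∧ (∀ i, 0 ≤ e i) ∧
      Function.Injective e := by
  set e := hY.isHermitian.eigenvalues with he
  have hsub : ∀ k, ∃ j, e j = l k := fun k => by
    have h := (heig k).mem_spectrum
    rw [Matrix.spectrum_toLin', hY.isHermitian.spectrum_real_eq_range_eigenvalues] at h
    exact h
  choose g hg using hsub
  have hgi : Function.Injective g := fun a b hab => hl (by rw [← hg a, ← hg b, hab])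
  have hgs : Function.Surjective g := Finite.injective_iff_surjective.mp hgi
  have hei : Function.Injective e := fun a b hab => by
    obtain ⟨a, rfl⟩ := hgs a
    obtain ⟨b, rfl⟩ := hgs b
    rw [hg, hg] at hab
    rw [hl hab]
  set V : Mat3 := hY.isHermitian.eigenvectorUnitary.1 with hV
  have hVV : V * Vᵀ = 1 := by
    have h := (Matrix.mem_unitaryGroup_iff).mp hY.isHermitian.eigenvectorUnitary.2
    rwa [Matrix.star_eq_conjTranspose, Matrix.conjTranspose_eq_transpose_of_trivial] at h
  have hdiag : Vᵀ * Y * V = Matrix.diagonal e := by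
    have h := hY.isHermitian.conjStarAlgAut_star_eigenvectorUnitary
    rw [Unitary.conjStarAlgAut_star_apply] at h
    rw [← Matrix.conjTranspose_eq_transpose_of_trivial, ← Matrix.star_eq_conjTranspose]
    exact h
  have hdet : V.det * V.det = 1 := by
    have := congrArg Matrix.det hVV
    rwa [Matrix.det_mul, Matrix.det_transpose, Matrix.det_one] at this
  rcases mul_self_eq_one_iff.mp hdet with h | h
  · exact ⟨⟨V, (mem_SO3_iff V).mpr ⟨hVV, h⟩⟩, e, hdiag, hY.eigenvalues_nonneg, hei⟩
  -- In odd dimension `-V` has the opposite determinant and conjugates in the same way.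
  · refine ⟨⟨-V, (mem_SO3_iff _).mpr ⟨by simp [hVV], ?_⟩⟩, e, ?_, hY.eigenvalues_nonneg, hei⟩
    · rw [Matrix.det_neg, h]
      norm_num
    · simpa using hdiag

/-! ### Observability -/

/-- The open sets `C S^k d ≠ 0` cover the unit sphere. Compactness yields finitely many derivatives
and a positive minimum, and homogeneity extends the bound. -/
lemma exists_observability_bound {D E : Type*} [NormedAddCommGroup D] [NormedSpace ℝ D]
    [FiniteDimensional ℝ D] [NormedAddCommGroup E] [NormedSpace ℝ E] (C : D →L[ℝ] E)
    (S : D →L[ℝ] D) (hobs : ∀ d, (∀ k : ℕ, C ((S ^ k) d) = 0) → d = 0) :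
    ∃ (n : ℕ) (K₀ : ℝ), ∀ d, ‖d‖ ^ 2 ≤ K₀ * ∑ k ∈ Finset.range (n + 1), ‖C ((S ^ k) d)‖ ^ 2 := by
  have hcomp : IsCompact (Metric.sphere (0 : D) 1) := isCompact_sphere 0 1
  have hcont : ∀ k : ℕ, Continuous fun d => C ((S ^ k) d) := fun k =>
    C.continuous.comp (S ^ k).continuous
  obtain ⟨t, ht⟩ := hcomp.elim_finite_subcover (fun k : ℕ => {d | C ((S ^ k) d) ≠ 0})
    (fun k => isOpen_ne_fun (hcont k) continuous_const) (fun d hd => by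
      by_contra h
      simp only [Set.mem_iUnion, Set.mem_ofPred_eq, not_exists, not_not] at h
      rw [hobs d h] at hd
      simp at hd)
  obtain ⟨n, hn⟩ := t.exists_le
  obtain ⟨a, ha, hmin⟩ := hcomp.exists_forall_le' (a := 0)
    (f := fun d => ∑ k ∈ Finset.range (n + 1), ‖C ((S ^ k) d)‖ ^ 2)
    (continuous_finsetSum _ fun k _ => (hcont k).norm.pow 2).continuousOn (fun d hd => by
      obtain ⟨k, hk⟩ := Set.mem_iUnion.mp (ht hd)
      obtain ⟨hkt, hk⟩ := Set.mem_iUnion.mp hk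
      refine Finset.sum_pos' (fun _ _ => sq_nonneg _)
        ⟨k, Finset.mem_range.mpr (Nat.lt_succ_of_le (hn k hkt)), ?_⟩
      exact pow_pos (norm_pos_iff.mpr hk) 2)
  refine ⟨n, a⁻¹, fun d => ?_⟩
  rcases eq_or_ne d 0 with rfl | hd
  · simp
  have hd' : 0 < ‖d‖ := norm_pos_iff.mpr hd
  have h := hmin (‖d‖⁻¹ • d) (by simp [norm_smul, hd'.ne'])
  simp only [map_smul, norm_smul, norm_inv, norm_norm, mul_pow, ← Finset.mul_sum] at h
  rw [inv_mul_eq_div, le_div_iff₀ ha]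
  rw [inv_pow, inv_mul_eq_div, le_div_iff₀ (by positivity)] at h
  linarith

lemma matOp_pow_apply {m : ℕ} (S : Matrix (Fin m) (Fin m) ℝ) (k : ℕ) (d : EuclideanSpace ℝ (Fin m)) :
    ((matOp m m S) ^ k) d = WithLp.toLp 2 ((S ^ k) *ᵥ d.ofLp) := by
  induction k with
  | zero => simp
  | succ k ih =>
    rw [pow_succ', pow_succ', mul_apply_eq_comp, ih, matOp_apply, Matrix.mulVec_mulVec]

lemma IsObservablePair.exists_detectability_form {m : ℕ} {C : Matrix (Fin 3) (Fin m) ℝ}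
    {S : Matrix (Fin m) (Fin m) ℝ} (h : IsObservablePair C S) :
    ∃ (P : EuclideanSpace ℝ (Fin m) →L[ℝ] EuclideanSpace ℝ (Fin m)) (c K : ℝ), 0 < c ∧ 0 ≤ K ∧
      ∀ d, c * ‖d‖ ^ 2 - K * ‖matOp 3 m C d‖ ^ 2
        ≤ inner ℝ (P (matOp m m S d)) d + inner ℝ (P d) (matOp m m S d) := by
  obtain ⟨n, K₀, hK₀⟩ := exists_observability_bound (matOp 3 m C) (matOp m m S) fun d hd => by
    refine (WithLp.ofLp_eq_zero 2).mp (h d.ofLp fun k => ?_)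
    have := hd k
    rw [matOp_pow_apply, matOp_apply] at this
    exact (WithLp.toLp_eq_zero 2).mp this
  exact _root_.exists_detectability_form _ _ n K₀ hK₀

/-! ### Distance to the target set -/

section Distance

variable {m : ℕ} (U Xr : SO3)

lemma norm_errRot_sub (R₁ R₂ Rd₁ Rd₂ : SO3) :
    ‖(errRot U Xr R₁ Rd₁).1 - (errRot U Xr R₂ Rd₂).1‖
      = ‖R₁.1ᵀ * Rd₁.1 * Xr.1ᵀ - R₂.1ᵀ * Rd₂.1 * Xr.1ᵀ‖ := by
  rw [coe_errRot, coe_errRot, ← Matrix.sub_mul, ← Matrix.mul_sub, norm_mul_SO3,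
    norm_transpose_SO3_mul]

lemma norm_errRot_sub_one (R Rd : SO3) :
    ‖(errRot U Xr R Rd).1 - 1‖ = ‖R.1 - Rd.1 * Xr.1ᵀ‖ := by
  have h : (errRot U Xr R Rd).1 - 1 = U.1ᵀ * (R.1ᵀ * (Rd.1 * Xr.1ᵀ - R.1)) * U.1 := by
    rw [coe_errRot, Matrix.mul_sub, SO3.transpose_mul, Matrix.mul_sub, Matrix.sub_mul,
      Matrix.mul_one, SO3.transpose_mul, Matrix.mul_assoc R.1ᵀ]
  rw [h, norm_mul_SO3, norm_transpose_SO3_mul, norm_transpose_SO3_mul, norm_sub_rev]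

lemma mem_targetSet_iff (p : LoopState m) :
    p ∈ targetSet m Xr ↔ p.1 = p.2.2.1 * SO3.tr Xr ∧ p.2.1 = p.2.2.2 := by
  refine and_congr_left fun _ => ⟨fun h => Subtype.ext ?_, fun h => ?_⟩
  · change p.1.1 = p.2.2.1.1 * Xr.1ᵀ
    rw [← h, Matrix.transpose_mul, Matrix.transpose_transpose, ← Matrix.mul_assoc,
      SO3.mul_transpose, Matrix.one_mul]
  · rw [h]
    change (p.2.2.1.1 * Xr.1ᵀ)ᵀ * p.2.2.1.1 = Xr.1
    rw [Matrix.transpose_mul, Matrix.transpose_transpose, Matrix.mul_assoc, SO3.transpose_mul,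
      Matrix.mul_one]

lemma mk_mem_targetSet (Rd : SO3) (w : EuclideanSpace ℝ (Fin m)) :
    ((Rd * SO3.tr Xr, w, Rd, w) : LoopState m) ∈ targetSet m Xr :=
  (mem_targetSet_iff Xr _).mpr ⟨rfl, rfl⟩

lemma infDist_targetSet_le (p : LoopState m) :
    Metric.infDist p (targetSet m Xr)
      ≤ max ‖(errRot U Xr p.1 p.2.2.1).1 - 1‖ ‖p.2.1 - p.2.2.2‖ := by
  refine (Metric.infDist_le_dist_of_mem (mk_mem_targetSet Xr p.2.2.1 p.2.2.2)).trans ?_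
  rw [norm_errRot_sub_one]
  refine max_le (le_max_of_le_left (dist_SO3 _ _).le) (max_le ?_ ?_)
  · exact le_max_of_le_right (dist_eq_norm _ _).le
  · exact (dist_self (p.2.2 : SO3 × EuclideanSpace ℝ (Fin m))).le.trans
      (le_max_of_le_left (norm_nonneg _))

lemma infDist_targetSet_sq_le (p : LoopState m) :
    Metric.infDist p (targetSet m Xr) ^ 2
      ≤ ‖(errRot U Xr p.1 p.2.2.1).1 - 1‖ ^ 2 + ‖p.2.1 - p.2.2.2‖ ^ 2 := by
  have h := pow_le_pow_left₀ Metric.infDist_nonneg (infDist_targetSet_le U Xr p) 2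
  refine h.trans ?_
  rcases max_cases ‖(errRot U Xr p.1 p.2.2.1).1 - 1‖ ‖p.2.1 - p.2.2.2‖ with ⟨h, -⟩ | ⟨h, -⟩
  · rw [h]
    exact le_add_of_nonneg_right (sq_nonneg _)
  · rw [h]
    exact le_add_of_nonneg_left (sq_nonneg _)

/-- Moving to a point of the target set changes each error by at most twice the distance, once
through each of its two ingredients; two squared terms give `2 · 2² = 8`. -/
lemma sq_add_sq_le_infDist_targetSet (p : LoopState m) :
    ‖(errRot U Xr p.1 p.2.2.1).1 - 1‖ ^ 2 + ‖p.2.1 - p.2.2.2‖ ^ 2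
      ≤ 8 * Metric.infDist p (targetSet m Xr) ^ 2 := by
  have hne : (targetSet m Xr).Nonempty := ⟨_, mk_mem_targetSet Xr p.2.2.1 p.2.2.2⟩
  have h1 : ‖(errRot U Xr p.1 p.2.2.1).1 - 1‖ / 2 ≤ Metric.infDist p (targetSet m Xr) := by
    refine (Metric.le_infDist hne).mpr fun {a} ha => ?_
    have ha1 : a.1.1 = a.2.2.1.1 * Xr.1ᵀ :=
      congrArg Subtype.val ((mem_targetSet_iff Xr a).mp ha).1
    have k1 : ‖p.1.1 - a.1.1‖ ≤ dist p a := (dist_SO3 _ _).symm.le.trans (le_max_left _ _)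
    have k2 : ‖p.2.2.1.1 - a.2.2.1.1‖ ≤ dist p a :=
      (dist_SO3 _ _).symm.le.trans
        ((le_max_left _ _).trans ((le_max_right _ _).trans (le_max_right _ _)))
    have k3 : p.1.1 - p.2.2.1.1 * Xr.1ᵀ
        = (p.1.1 - a.1.1) - (p.2.2.1.1 - a.2.2.1.1) * Xr.1ᵀ := by
      rw [Matrix.sub_mul, ha1]
      abel
    have k4 := norm_sub_le (p.1.1 - a.1.1) ((p.2.2.1.1 - a.2.2.1.1) * Xr.1ᵀ)
    rw [norm_mul_transpose_SO3, ← k3, ← norm_errRot_sub_one U] at k4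
    linarith
  have h2 : ‖p.2.1 - p.2.2.2‖ / 2 ≤ Metric.infDist p (targetSet m Xr) := by
    refine (Metric.le_infDist hne).mpr fun {a} ha => ?_
    have ha2 := ((mem_targetSet_iff Xr a).mp ha).2
    have k1 : ‖p.2.1 - a.2.1‖ ≤ dist p a :=
      (dist_eq_norm _ _).symm.le.trans ((le_max_left _ _).trans (le_max_right _ _))
    have k2 : ‖p.2.2.2 - a.2.2.2‖ ≤ dist p a :=
      (dist_eq_norm _ _).symm.le.trans
        ((le_max_right _ _).trans ((le_max_right _ _).trans (le_max_right _ _)))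
    have k3 : p.2.1 - p.2.2.2 = (p.2.1 - a.2.1) - (p.2.2.2 - a.2.2.2) := by
      rw [ha2]
      abel
    have k4 := norm_sub_le (p.2.1 - a.2.1) (p.2.2.2 - a.2.2.2)
    rw [← k3] at k4
    linarith
  have := norm_nonneg ((errRot U Xr p.1 p.2.2.1).1 - 1)
  have := norm_nonneg (p.2.1 - p.2.2.2)
  nlinarith

/-- For a fixed exosystem state, passing to error coordinates preserves the Hausdorff dimension of
sets of initial states. -/
lemma isometry_errRot (Rd : SO3) (w : EuclideanSpace ℝ (Fin m)) :
    Isometry fun p : SO3 × EuclideanSpace ℝ (Fin m) => (errRot U Xr p.1 Rd, p.2 - w) := by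
  refine Isometry.of_dist_eq fun p q => ?_
  have h1 : dist (errRot U Xr p.1 Rd) (errRot U Xr q.1 Rd) = dist p.1 q.1 := by
    rw [dist_SO3, dist_SO3, norm_errRot_sub, ← Matrix.sub_mul, norm_mul_transpose_SO3,
      ← Matrix.sub_mul, norm_mul_SO3, ← Matrix.transpose_sub, Matrix.frobenius_norm_transpose]
  have h2 : dist (p.2 - w) (q.2 - w) = dist p.2 q.2 := dist_sub_right _ _ _
  exact congrArg₂ max h1 h2

end Distance

/-! ### The closed loop in error coordinates -/

section ClosedLoop

variable {m ν : ℕ} {C : Matrix (Fin 3) (Fin m) ℝ} {S : Matrix (Fin m) (Fin m) ℝ}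
  {kp kI : ℝ} {Xr : SO3} {y₀ : Fin ν → Fin 3 → ℝ} {U : SO3} {l : Fin 3 → ℝ}

lemma eq_of_hasDerivWithinAt_zero {E : Type*} [NormedAddCommGroup E] [NormedSpace ℝ E] {g : ℝ → E}
    (hg : ∀ t ≥ 0, HasDerivWithinAt g 0 (Set.Ici 0) t) {t : ℝ} (ht : 0 ≤ t) : g t = g 0 :=
  constant_of_has_deriv_right_zero
    (fun τ hτ => ((hg τ hτ.1).continuousWithinAt).mono Set.Icc_subset_Ici_self)
    (fun τ hτ => (hg τ hτ.1).mono (Set.Ici_subset_Ici.mpr hτ.1)) t ⟨ht, le_rfl⟩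

lemma norm_eq_of_deriv_matOp (hS : S = -Sᵀ) {w : ℝ → EuclideanSpace ℝ (Fin m)}
    (hw : ∀ t ≥ 0, HasDerivWithinAt w (matOp m m S (w t)) (Set.Ici 0) t) {t : ℝ} (ht : 0 ≤ t) :
    ‖w t‖ = ‖w 0‖ := by
  have h := eq_of_hasDerivWithinAt_zero (g := fun τ => ‖w τ‖ ^ 2) (fun τ hτ => by
    refine ((hw τ hτ).norm_sq).congr_deriv ?_
    rw [inner_matOp_self_eq_zero S hS, mul_zero]) ht
  exact (sq_eq_sq₀ (norm_nonneg _) (norm_nonneg _)).mp h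

lemma isErrTraj_of_mem_closedLoop (hkp : kp ≠ 0)
    (hU : U.1ᵀ * Ymat kp Xr y₀ * U.1 = Matrix.diagonal l) {x : ℝ → LoopState m}
    (hx : x ∈ closedLoop C S kp kI Xr y₀) :
    IsErrTraj l (2 * kI / kp) (matOp m m S) (fun t => outMap C U Xr (x t).2.2.1)
      (fun t => errRot U Xr (x t).1 (x t).2.2.1) (fun t => (x t).2.1 - (x t).2.2.2) where
  rot t ht := by
    obtain ⟨h1, -, h3, -⟩ := hx t ht
    have h := hasDerivWithinAt_errRot C kp Xr y₀ hU (R := fun t => (x t).1)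
      (Rd := fun t => (x t).2.2.1) (δ := (x t).2.1) (w := (x t).2.2.2) (χ := 1) (s := Set.Ici 0)
      (t := t) (by rw [one_smul]; exact hasDerivWithinAt_matrix_iff.mpr h1)
      (by rw [one_smul]; exact hasDerivWithinAt_matrix_iff.mpr h3)
    rwa [one_smul] at h
  vec t ht := by
    obtain ⟨-, h2, -, h4⟩ := hx t ht
    have h := h2.fun_sub h4
    rwa [vecField_errRot C S kp kI Xr y₀ hkp hU] at h

lemma norm_exo_eq (hS : S = -Sᵀ) {x : ℝ → LoopState m} (hx : x ∈ closedLoop C S kp kI Xr y₀)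
    {t : ℝ} (ht : 0 ≤ t) : ‖(x t).2.2.2‖ = ‖(x 0).2.2.2‖ :=
  norm_eq_of_deriv_matOp hS (w := fun τ => (x τ).2.2.2) (fun τ hτ => (hx τ hτ).2.2.2) ht

/-- The exosystem evolves autonomously: `‖w - w'‖` is conserved because `S` is skew, and then `R_dᵀ
R_d'` is constant. Solutions with the same exosystem data thus share one output map `B`. -/
lemma exo_eq (hS : S = -Sᵀ) {x x' : ℝ → LoopState m} (hx : x ∈ closedLoop C S kp kI Xr y₀)
    (hx' : x' ∈ closedLoop C S kp kI Xr y₀) (h0 : (x 0).2.2 = (x' 0).2.2) {t : ℝ} (ht : 0 ≤ t) :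
    (x t).2.2.1 = (x' t).2.2.1 := by
  have hw : ∀ τ ≥ 0, (x τ).2.2.2 = (x' τ).2.2.2 := fun τ hτ => by
    have h := norm_eq_of_deriv_matOp hS (w := fun τ => (x τ).2.2.2 - (x' τ).2.2.2)
      (fun σ hσ => by
        rw [map_sub]
        exact (hx σ hσ).2.2.2.fun_sub (hx' σ hσ).2.2.2) hτ
    simp only [h0, sub_self, norm_zero, norm_eq_zero] at h
    exact sub_eq_zero.mp h
  have h := eq_of_hasDerivWithinAt_zero (g := fun τ => (x τ).2.2.1.1ᵀ * (x' τ).2.2.1.1)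
    (fun τ hτ => by
      have d := hasDerivWithinAt_matrix_iff.mpr (hx τ hτ).2.2.1
      have d' := hasDerivWithinAt_matrix_iff.mpr (hx' τ hτ).2.2.1
      refine (d.mat_transpose.mul d').congr_deriv ?_
      rw [← hw τ hτ, Matrix.transpose_mul, hat_transpose]
      noncomm_ring) ht
  simp only [h0, SO3.transpose_mul] at h
  refine Subtype.ext ?_
  have := congrArg (fun M => (x t).2.2.1.1 * M) h
  simp only [← Matrix.mul_assoc, SO3.mul_transpose, Matrix.one_mul, Matrix.mul_one] at this
  exact this.symm

/-- The frame is orthogonal, so the detectability inequality of the constant pair `(C, S)` transfers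
to the moving output map at every time. -/
lemma isDetectableOutput_of_mem_closedLoop (hS : S = -Sᵀ)
    {P : EuclideanSpace ℝ (Fin m) →L[ℝ] EuclideanSpace ℝ (Fin m)} {c K ρ : ℝ}
    (hP : ∀ d, c * ‖d‖ ^ 2 - K * ‖matOp 3 m C d‖ ^ 2
        ≤ inner ℝ (P (matOp m m S d)) d + inner ℝ (P d) (matOp m m S d))
    {x : ℝ → LoopState m} (hx : x ∈ closedLoop C S kp kI Xr y₀) (hρ : ‖(x 0).2.2.2‖ ≤ ρ) :
    IsDetectableOutput (matOp m m S) P ‖matOp 3 m C‖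
      (2 * (‖matOp 3 m C‖ * ρ) * 2 * ‖matOp 3 m C‖) c K (fun t => outMap C U Xr (x t).2.2.1)
      (fun t => outMapDeriv C U Xr (x t).2.2.1 (x t).2.2.2) where
  deriv t ht := hasDerivWithinAt_outMap C (Rd := fun t => (x t).2.2.1)
    (U := U) (Xr := Xr) (hasDerivWithinAt_matrix_iff.mpr (hx t ht).2.2.1)
  norm_le t _ := norm_outMap_le C U Xr _
  norm_deriv_le t ht := norm_outMapDeriv_le C U Xr _ _ ((norm_exo_eq hS hx ht).le.trans hρ)
  detect t _ d := by
    rw [norm_outMap_apply]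
    exact hP d

end ClosedLoop

/-! ### Stability of the target set -/

lemma IsErrTraj.exists_sq_le {D : Type*} [NormedAddCommGroup D] [InnerProductSpace ℝ D]
    [CompleteSpace D] {l : Fin 3 → ℝ} (hl : ∀ i, 0 ≤ l i) (hinj : Function.Injective l) {κ : ℝ}
    (hκ : 0 < κ) {S : D →L[ℝ] D} (hS : ∀ d, inner ℝ d (S d) = 0) :
    ∃ A > 0, ∀ (B : ℝ → D →L[ℝ] Vec3) (Q : ℝ → SO3) (d : ℝ → D), IsErrTraj l κ S B Q d →
      ∀ t ≥ 0, ‖(Q t).1 - 1‖ ^ 2 + ‖d t‖ ^ 2 ≤ A * (‖(Q 0).1 - 1‖ ^ 2 + ‖d 0‖ ^ 2) := by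
  obtain ⟨c, hc, hcl⟩ := exists_le_errEnergy (D := D) hl hinj hκ
  obtain ⟨M, hM, hMu⟩ := exists_errEnergy_le (D := D) hl hκ
  refine ⟨M / c, by positivity, fun B Q d h t ht => ?_⟩
  have h1 := (hcl (Q t) (d t)).trans ((h.energy_le hκ.ne' hS ht).trans (hMu (Q 0) (d 0)))
  rw [div_mul_eq_mul_div, le_div_iff₀ hc, mul_comm]
  exact h1

lemma dist_eq_zero_of_diagonal_of_tendsto {Q : ℝ → SO3} {q : SO3} {s : Fin 3 → ℝ}
    (hs : ∀ i, s i ^ 2 = 1) (hq : q.1 = Matrix.diagonal s)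
    (hlim : Tendsto (fun t => dist (Q t) q) atTop (𝓝 0)) {r : ℝ} (hr : r < 2)
    (hQ : ∀ t ≥ 0, ‖(Q t).1 - 1‖ ≤ r) : q = 1 := by
  by_contra hne
  have h2 := two_le_dist_diagonal_SO3 (c' := (1 : SO3)) (s' := fun _ => 1) hs
    (fun _ => one_pow 2) hq (Matrix.diagonal_one.symm) hne
  obtain ⟨t, ht, ht0⟩ :=
    ((hlim.eventually_lt_const (sub_pos.mpr hr)).and (eventually_ge_atTop 0)).exists
  have h3 := dist_triangle_left q 1 (Q t)
  rw [dist_SO3 (Q t) 1] at h3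
  have h4 : ‖(Q t).1 - (1 : SO3).1‖ ≤ r := hQ t ht0
  linarith

lemma isNullOfDim_of_dimH_lt {X : Type*} [MetricSpace X] {B : Set X} {d : NNReal}
    (h : dimH B < d) : IsNullOfDim d B := by
  let _ : MeasurableSpace X := borel X
  have _ : BorelSpace X := ⟨rfl⟩
  exact hausdorffMeasure_of_dimH_lt h

section Stability

variable {m ν : ℕ} {C : Matrix (Fin 3) (Fin m) ℝ} {S : Matrix (Fin m) (Fin m) ℝ}
  {kp kI : ℝ} {Xr : SO3} {y₀ : Fin ν → Fin 3 → ℝ} {U : SO3} {l : Fin 3 → ℝ}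

lemma convergesTo_targetSet {x : ℝ → LoopState m}
    (hQ : Tendsto (fun t => dist (errRot U Xr (x t).1 (x t).2.2.1) 1) atTop (𝓝 0))
    (hd : Tendsto (fun t => (x t).2.1 - (x t).2.2.2) atTop (𝓝 0)) :
    ConvergesTo x (targetSet m Xr) := by
  have h := hQ.max hd.norm
  rw [norm_zero, max_self] at h
  refine squeeze_zero (fun t => Metric.infDist_nonneg) (fun t => ?_) h
  rw [dist_SO3]
  exact infDist_targetSet_le U Xr (x t)

lemma exists_closedLoop_sq_le (hS : S = -Sᵀ) (hkp : 0 < kp) (hkI : 0 < kI)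
    (hU : U.1ᵀ * Ymat kp Xr y₀ * U.1 = Matrix.diagonal l) (hl : ∀ i, 0 ≤ l i)
    (hinj : Function.Injective l) :
    ∃ a > 0, ∀ x ∈ closedLoop C S kp kI Xr y₀, ∀ t ≥ 0,
      ‖(errRot U Xr (x t).1 (x t).2.2.1).1 - 1‖ ^ 2 + ‖(x t).2.1 - (x t).2.2.2‖ ^ 2
        ≤ (a * Metric.infDist (x 0) (targetSet m Xr)) ^ 2 := by
  obtain ⟨A, hA, h⟩ := IsErrTraj.exists_sq_le hl hinj (κ := 2 * kI / kp) (by positivity)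
    (inner_matOp_self_eq_zero S hS)
  refine ⟨Real.sqrt (A * 8), by positivity, fun x hx t ht => ?_⟩
  rw [mul_pow, Real.sq_sqrt (by positivity), mul_assoc]
  exact (h _ _ _ (isErrTraj_of_mem_closedLoop hkp.ne' hU hx) t ht).trans
    (mul_le_mul_of_nonneg_left (sq_add_sq_le_infDist_targetSet U Xr (x 0)) hA.le)

lemma isLyapunovStable_targetSet (hS : S = -Sᵀ) (hkp : 0 < kp) (hkI : 0 < kI)
    (hU : U.1ᵀ * Ymat kp Xr y₀ * U.1 = Matrix.diagonal l) (hl : ∀ i, 0 ≤ l i)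
    (hinj : Function.Injective l) :
    IsLyapunovStable (closedLoop C S kp kI Xr y₀) (targetSet m Xr) := by
  obtain ⟨a, ha, h⟩ := exists_closedLoop_sq_le (C := C) hS hkp hkI hU hl hinj
  refine fun ε hε => ⟨ε / a, by positivity, fun x hx h0 t ht => ?_⟩
  have h1 := (infDist_targetSet_sq_le U Xr (x t)).trans (h x hx t ht)
  have h2 := le_of_sq_le_sq h1 (mul_nonneg ha.le Metric.infDist_nonneg)
  rw [lt_div_iff₀ ha] at h0
  linarith

lemma isLocallyAttractive_targetSet (hS : S = -Sᵀ) (hCS : IsObservablePair C S) (hkp : 0 < kp)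
    (hkI : 0 < kI) (hU : U.1ᵀ * Ymat kp Xr y₀ * U.1 = Matrix.diagonal l) (hl : ∀ i, 0 ≤ l i)
    (hinj : Function.Injective l) :
    IsLocallyAttractive (closedLoop C S kp kI Xr y₀) (targetSet m Xr) := by
  obtain ⟨a, ha, h⟩ := exists_closedLoop_sq_le (C := C) hS hkp hkI hU hl hinj
  obtain ⟨P, c, K, hc, hK, hP⟩ := hCS.exists_detectability_form
  -- With this radius `Q` stays within distance `1` of the identity, whereas every other possible
  -- limit is at distance at least `2` from it.
  refine ⟨1 / a, by positivity, fun x hx h0 => ?_⟩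
  have hQ : ∀ t ≥ 0, ‖(errRot U Xr (x t).1 (x t).2.2.1).1 - 1‖ ≤ 1 := fun t ht => by
    rw [lt_div_iff₀ ha] at h0
    have h1 := le_of_sq_le_sq ((le_add_of_nonneg_right (sq_nonneg _)).trans (h x hx t ht))
      (mul_nonneg ha.le Metric.infDist_nonneg)
    linarith
  obtain ⟨q, ⟨s, hs, hq⟩, hlim, hd⟩ := (isErrTraj_of_mem_closedLoop hkp.ne' hU hx).exists_tendsto hl
    hinj (by positivity) (inner_matOp_self_eq_zero S hS) hc hK
    (isDetectableOutput_of_mem_closedLoop hS hP hx le_rfl)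
  obtain rfl := dist_eq_zero_of_diagonal_of_tendsto hs hq hlim one_lt_two hQ
  exact convergesTo_targetSet hlim hd

lemma isNullOfDim_not_convergesTo (hS : S = -Sᵀ) (hCS : IsObservablePair C S) (hkp : 0 < kp)
    (hkI : 0 < kI) (hU : U.1ᵀ * Ymat kp Xr y₀ * U.1 = Matrix.diagonal l) (hl : ∀ i, 0 ≤ l i)
    (hinj : Function.Injective l) (Rd₀ : SO3) (w₀ : EuclideanSpace ℝ (Fin m)) :
    IsNullOfDim (3 + m : ℝ) {p : SO3 × EuclideanSpace ℝ (Fin m) |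
      ¬ ∀ x ∈ closedLoop C S kp kI Xr y₀, x 0 = (p.1, p.2, Rd₀, w₀) →
        ConvergesTo x (targetSet m Xr)} := by
  obtain ⟨P, c, K, hc, hK, hP⟩ := hCS.exists_detectability_form
  -- A reference solution with the given exosystem data; it provides the common `B` to which the
  -- dimension bound is applied.
  obtain ⟨z, hz, hz0⟩ := forwardComplete_closedLoop C S kp kI Xr y₀ hS hkp hkI hU hl hinj
    (1, 0, Rd₀, w₀)
  have hdim := dimH_not_tendsto_le hl hinj (κ := 2 * kI / kp) (by positivity) (matOp m m S) P
    (inner_matOp_self_eq_zero S hS) hc hK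
    (isDetectableOutput_of_mem_closedLoop (U := U) hS hP hz le_rfl)
  set N := {p : SO3 × EuclideanSpace ℝ (Fin m) |
      ¬ ∀ x ∈ closedLoop C S kp kI Xr y₀, x 0 = (p.1, p.2, Rd₀, w₀) →
        ConvergesTo x (targetSet m Xr)} with hN
  have hlt : dimH N < ((3 + m : NNReal) : ENNReal) := by
    rw [← (isometry_errRot U Xr Rd₀ w₀).dimH_image N]
    refine (dimH_mono ?_).trans_lt (hdim.trans_lt ?_)
    · rintro _ ⟨p, hp, rfl⟩
      obtain ⟨x, hx⟩ := not_forall.mp hp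
      obtain ⟨hx, hx'⟩ := Classical.not_imp.mp hx
      obtain ⟨hx0, hnc⟩ := Classical.not_imp.mp hx'
      have hexo : ∀ t ≥ 0, (x t).2.2.1 = (z t).2.2.1 := fun t ht =>
        exo_eq hS hx hz (by rw [hx0, hz0]) ht
      have htraj := isErrTraj_of_mem_closedLoop hkp.ne' hU hx
      refine ⟨fun t => errRot U Xr (x t).1 (x t).2.2.1, fun t => (x t).2.1 - (x t).2.2.2,
        ⟨fun t ht => ?_, fun t ht => ?_⟩, by simp only [hx0], by simp only [hx0],
        fun hconv => hnc (convergesTo_targetSet hconv.1 hconv.2)⟩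
      · have := htraj.rot t ht
        simp only [hexo t ht] at this ⊢
        exact this
      · have := htraj.vec t ht
        simp only [hexo t ht] at this ⊢
        exact this
    · rw [finrank_euclideanSpace_fin]
      have : (2 + m : NNReal) < 3 + m := by gcongr; norm_num
      exact_mod_cast this
  have h := isNullOfDim_of_dimH_lt hlt
  rwa [NNReal.coe_add, NNReal.coe_natCast, NNReal.coe_ofNat] at h

lemma isLocallyExponentiallyStable_targetSet (hS : S = -Sᵀ) (hCS : IsObservablePair C S)
    (hkp : 0 < kp) (hkI : 0 < kI) (hU : U.1ᵀ * Ymat kp Xr y₀ * U.1 = Matrix.diagonal l)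
    (hl : ∀ i, 0 ≤ l i) (hinj : Function.Injective l) :
    IsLocallyExponentiallyStable (closedLoop C S kp kI Xr y₀) (targetSet m Xr) := by
  intro ρ
  obtain ⟨a, ha, h⟩ := exists_closedLoop_sq_le (C := C) hS hkp hkI hU hl hinj
  obtain ⟨P, c, K, hc, hK, hP⟩ := hCS.exists_detectability_form
  obtain ⟨r, hr, k, hk, α, hα, hexp⟩ := exists_exp_decay hl hinj (κ := 2 * kI / kp)
    (by positivity) (matOp m m S) P (inner_matOp_self_eq_zero S hS)
    (b := ‖matOp 3 m C‖) (b' := 2 * (‖matOp 3 m C‖ * |ρ|) * 2 * ‖matOp 3 m C‖)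
    (norm_nonneg _) hc hK
  -- Radius `r / a` keeps `Q` within `r` of the identity for all time. The decay estimate concerns
  -- squares, hence the square root and the halved rate; `8` compares the errors with the distance.
  refine ⟨r / a, by positivity, Real.sqrt (k * 8), by positivity, α / 2, by positivity,
    fun x hx hρ h0 t ht => ?_⟩
  have hQ : ∀ t ≥ 0, ‖(errRot U Xr (x t).1 (x t).2.2.1).1 - 1‖ ≤ r := fun t ht => by
    rw [lt_div_iff₀ ha] at h0
    have h1 := le_of_sq_le_sq ((le_add_of_nonneg_right (sq_nonneg _)).trans (h x hx t ht))
      (mul_nonneg ha.le Metric.infDist_nonneg)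
    linarith
  have h1 := (infDist_targetSet_sq_le U Xr (x t)).trans
    (hexp _ _ (isDetectableOutput_of_mem_closedLoop hS hP hx (le_trans hρ (le_abs_self ρ))) _ _
      (isErrTraj_of_mem_closedLoop hkp.ne' hU hx) hQ t ht)
  have hE : Real.exp (-α * t) = Real.exp (-(α / 2) * t) ^ 2 := by
    rw [← Real.exp_nat_mul]
    congr 1
    push_cast
    ring
  refine le_of_sq_le_sq (h1.trans ?_)
    (mul_nonneg (by positivity) Metric.infDist_nonneg)
  rw [mul_pow, mul_pow, Real.sq_sqrt (by positivity), hE]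
  have h2 := mul_le_mul_of_nonneg_left (sq_add_sq_le_infDist_targetSet U Xr (x 0))
    (by positivity : 0 ≤ k * Real.exp (-(α / 2) * t) ^ 2)
  linarith

end Stability

/-! ### The main theorem -/

theorem proposition1 {m ν : ℕ} (hm : 3 ≤ m)
    (C : Matrix (Fin 3) (Fin m) ℝ) (S : Matrix (Fin m) (Fin m) ℝ) (hS : S = -Sᵀ)
    (hCS : IsObservablePair C S)
    (kp kI : ℝ) (hkp : 0 < kp) (hkI : 0 < kI)
    (Xr : SO3) (y₀ : Fin ν → Fin 3 → ℝ)
    (hindep : ∃ i j, LinearIndependent ℝ ![y₀ i, y₀ j])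
    (hY : ∃ l : Fin 3 → ℝ, Function.Injective l ∧
      ∀ k, Module.End.HasEigenvalue (Matrix.toLin' (Ymat kp Xr y₀)) (l k)) :
    IsAlmostGloballyAsymptoticallyStable (closedLoop C S kp kI Xr y₀) (targetSet m Xr) ∧
      IsLocallyExponentiallyStable (closedLoop C S kp kI Xr y₀) (targetSet m Xr) := by
  obtain ⟨e, he, heig⟩ := hY
  obtain ⟨U, l, hU, hl, hinj⟩ :=
    exists_SO3_diagonalization (Ymat_posSemidef hkp.le Xr y₀) he heig
  exact ⟨⟨forwardComplete_closedLoop C S kp kI Xr y₀ hS hkp hkI hU hl hinj,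
    isLyapunovStable_targetSet hS hkp hkI hU hl hinj,
    isLocallyAttractive_targetSet hS hCS hkp hkI hU hl hinj,
    isNullOfDim_not_convergesTo hS hCS hkp hkI hU hl hinj⟩,
    isLocallyExponentiallyStable_targetSet hS hCS hkp hkI hU hl hinj⟩
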